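/- **Setting.** Let $a<b$, $T>0$; all functions of $x\in(a,b)$ are extended $(b-a)$-periodically. For a horizon $\delta>0$ let $\gamma\ge 0$ be an even kernel with $0<C_\delta:=\int_{-\delta}^{\delta}s^2\gamma(s)\,ds<\infty$ ($\gamma$ itself may be non-integrable). Let $(u,q)$ solve $$u_{tt}=2\int_0^\delta s^2\gamma(s)\,\frac{q(x,t;s)-q(x-s,t;s)}{s}\,ds,\qquad q(x,t;s)=\frac{u(x+s,t)-u(x,t)}{s}\quad(0<s\le\delta)$$ for $(x,t)\in(a,b)\times(0,T)$, with periodic boundary conditions, and let $u$ be of class $C^{k+4}$ in $(x,t)\in\mathbb R\times[0,T]$. Let $a=x_{1/2}<\dots<x_{N+1/2}=b$ be a mesh with cells $I_j=(x_{j-1/2},x_{j+1/2})$ of length $h_j$, $h=\max_j h_j$, and $\nu h\le\min_j h_j$ with $\nu>0$. Let $V_h^k$ be the space of functions that are polynomials of degree at most $k$ on each $I_j$, and let $u_h(\cdot,t),\,q_h(\cdot,t;s)\in V_h^k$ satisfy, for all $t\in[0,T]$, $s\in(0,\delta]$, all $j$ and all $v,w\in V_h^k$, $$\int_{I_j}(u_h)_{tt}v\,dx=2\int_0^\delta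 s^2\gamma(s)\int_{I_j}\frac{q_h(x,t;s)-q_h(x-s,t;s)}{s}\,v(x)\,dx\,ds,$$ $$\int_{I_j}q_h(x,t;s)\,w(x)\,dx=\int_{I_j}\frac{u_h(x+s,t)-u_h(x,t)}{s}\,w(x)\,dx,$$ where $u_h$ is $C^2$ in $t$, and $u_h(\cdot,0)$, $(u_h)_t(\cdot,0)$ are the projections of $u(\cdot,0)$, $u_t(\cdot,0)$ onto $V_h^k$: the $L^2$-projections if $k\ge1$, and the Gauss–Radau projections $P_h^+$ if $k=0$ (on $I_j$, $P_h^+g$ is then the constant $g(x_{j-1/2}^+)$). Put $e_u=u_h-u$, $e_q=q_h-q$. **Theorem.** (i) If $k\ge1$, then for all $t\in[0,T]$ $$\|e_u(\cdot,t)\|_{L^2(a,b)}^2\le Ch^{2k},\qquad \int_0^\delta s^2\gamma(s)\,\|e_q(\cdot,t;s)\|_{L^2(a,b)}^2\,ds\le Ch^{2k}.$$ (ii) If $k=0$ and $h_j=h$ for all $j$, then for all $t\in[0,T]$ $$\|e_u(\cdot,t)\|_{L^2(a,b)}^2\le Ch,\qquad \int_0^\delta s^2\gamma(s)\,\|e_q(\cdot,t;s)\|_{L^2(a,b)}^2\,ds\le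 Ch.$$ Here $C>0$ depends only on $a,b,T,k,\nu$, on an upper bound for $C_\delta$, and on an upper bound for the seminorms $|u_t(\cdot,t)|_{H^{k+1}(a,b)}$, $|u(\cdot,t)|_{H^{k+1}(a,b)}$, $|q(\cdot,t;s)|_{H^{k+1}(a,b)}$ over $t\in[0,T]$, $s\in(0,\delta]$; it does not otherwise depend on $h$, the mesh, $\delta$ or $\gamma$. (iii) (Asymptotic compatibility.) Let $u_{\rm loc}$ be a periodic $C^2$ solution of $u_{tt}=u_{xx}$ on $[0,T]$. For each small $\delta>0$ let $\gamma_\delta$ be a kernel as above, with $C_\delta\to1$ as $\delta\to0$, and let $u^\delta$ be a $C^{k+4}$ solution of the corresponding nonlocal problem with $u^\delta(\cdot,0)=u_{\rm loc}(\cdot,0)$, $u^\delta_t(\cdot,0)=(u_{\rm loc})_t(\cdot,0)$. Then the corresponding discrete solutions $u_h$ (on meshes with a fixed $\nu$, uniform if $k=0$) satisfy $$\lim_{\delta,h\to0}\ \|u_h(\cdot,t)-u_{\rm loc}(\cdot,t)\|_{L^2(a,b)}=0\quad\text{uniformly in } t\in[0,T].$$ -/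

import Mathlib

open Set Filter Topology MeasureTheory

namespace NonlocalDG

noncomputable section

/-! ### Norms on the interval `(a, b)` -/

/-- The `L²(a,b)` norm. -/
def l2Norm (a b : ℝ) (f : ℝ → ℝ) : ℝ := Real.sqrt (∫ x in a..b, f x ^ 2)

/-- The `H^m(a,b)` seminorm `|f|_{H^m(a,b)} = ‖f^{(m)}‖_{L²(a,b)}`; it is only used for functions
that are `m` times continuously differentiable. -/
def hSeminorm (a b : ℝ) (m : ℕ) (f : ℝ → ℝ) : ℝ := l2Norm a b (iteratedDeriv m f)

/-- The time derivative `u_t(x,t)` of a function `u(x,t)` given for times in `[0,T]`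
(one-sided at `t = 0` and `t = T`). -/
def timeDeriv (T : ℝ) (u : ℝ → ℝ → ℝ) (x t : ℝ) : ℝ :=
  derivWithin (fun τ => u x τ) (Icc 0 T) t

/-- `u(x,t)` is of class `C^m` jointly in `(x,t)` for `x ∈ ℝ`, `t ∈ [0,T]`. -/
def IsSmoothOfOrder (T : ℝ) (m : ℕ) (u : ℝ → ℝ → ℝ) : Prop :=
  ContDiffOn ℝ (m : WithTop ℕ∞) (fun p : ℝ × ℝ => u p.1 p.2) (univ ×ˢ Icc 0 T)

/-! ### The kernel and the continuous problems -/

/-- `C_δ = ∫_{-δ}^{δ} s² γ(s) ds`. -/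
def kernelMass (δ : ℝ) (γ : ℝ → ℝ) : ℝ := ∫ s in (-δ)..δ, s ^ 2 * γ s

/-- A nonnegative radial kernel with `0 < C_δ < ∞`. The kernel itself need not be integrable. -/
structure IsKernel (δ : ℝ) (γ : ℝ → ℝ) : Prop where
  nonneg : ∀ s, 0 ≤ γ s
  radial : ∀ s, γ (-s) = γ s
  integrable : IntervalIntegrable (fun s => s ^ 2 * γ s) volume (-δ) δ
  mass_pos : 0 < kernelMass δ γ

/-- `(u, q)`, with `u = u(x,t)` and `q = q(x,t;s)`, solves the periodic nonlocal wave equation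
written as the system
`u_tt = 2 ∫_0^δ s² γ(s) (q(x,t;s) - q(x-s,t;s)) / s ds`, `q(x,t;s) = (u(x+s,t) - u(x,t)) / s`.
Functions on `(a,b)` are extended periodically to the line. -/
structure IsExactSolution (a b T δ : ℝ) (γ : ℝ → ℝ) (u : ℝ → ℝ → ℝ) (q : ℝ → ℝ → ℝ → ℝ) :
    Prop where
  periodic : ∀ t ∈ Icc 0 T, Function.Periodic (fun x => u x t) (b - a)
  wave : ∀ x ∈ Ioo a b, ∀ t ∈ Ioo 0 T,
    timeDeriv T (timeDeriv T u) x t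
      - 2 * ∫ s in (0 : ℝ)..δ, s ^ 2 * γ s * ((q x t s - q (x - s) t s) / s) = 0
  flux : ∀ x, ∀ t ∈ Icc 0 T, ∀ s ∈ Ioc 0 δ, q x t s - (u (x + s) t - u x t) / s = 0

/-- `u` is a classical solution of the periodic local wave equation `u_tt = u_xx`. -/
structure IsLocalSolution (a b T : ℝ) (u : ℝ → ℝ → ℝ) : Prop where
  smooth : IsSmoothOfOrder T 2 u
  periodic : ∀ t ∈ Icc 0 T, Function.Periodic (fun x => u x t) (b - a)
  wave : ∀ x ∈ Ioo a b, ∀ t ∈ Ioo 0 T,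
    timeDeriv T (timeDeriv T u) x t - iteratedDeriv 2 (fun y => u y t) x = 0

/-! ### Meshes and piecewise polynomials -/

/-- A partition of `(a,b)` into `N` cells; cell `j` is `(node j, node (j+1))`. -/
structure Mesh (a b : ℝ) where
  N : ℕ
  node : Fin (N + 1) → ℝ
  strictMono : StrictMono node
  node_zero : node 0 = a
  node_last : node (Fin.last N) = b

namespace Mesh

variable {a b : ℝ}

/-- Left end point of cell `j`. -/
def left (m : Mesh a b) (j : Fin m.N) : ℝ := m.node j.castSucc

/-- Right end point of cell `j`. -/
def right (m : Mesh a b) (j : Fin m.N) : ℝ := m.node j.succ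

/-- The open cell `I_j`. -/
def cell (m : Mesh a b) (j : Fin m.N) : Set ℝ := Ioo (m.left j) (m.right j)

/-- The length `h_j` of cell `j`. -/
def length (m : Mesh a b) (j : Fin m.N) : ℝ := m.right j - m.left j

/-- The mesh size `h = max_j h_j`. -/
def size (m : Mesh a b) : ℝ := ⨆ j : Fin m.N, m.length j

/-- `ν max_j h_j ≤ min_j h_j`. -/
def IsRegular (m : Mesh a b) (ν : ℝ) : Prop := ∀ j, ν * m.size ≤ m.length j

/-- `h_j = h` for all `j`. -/
def IsUniform (m : Mesh a b) : Prop := ∀ j, m.length j = m.size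

end Mesh

/-- `v ∈ V_h^k`: `v` is (the periodic extension of) a function that is on every open cell a
polynomial of degree at most `k`. Values at the nodes are immaterial. -/
def MemVh {a b : ℝ} (m : Mesh a b) (k : ℕ) (v : ℝ → ℝ) : Prop :=
  Function.Periodic v (b - a) ∧
    ∀ j, ∃ p : Polynomial ℝ, p.natDegree ≤ k ∧ ∀ x ∈ m.cell j, v x = p.eval x

/-- `P` is the `L²`-projection of `u` onto `V_h^k`. -/
def IsL2Projection {a b : ℝ} (m : Mesh a b) (k : ℕ) (u P : ℝ → ℝ) : Prop :=
  MemVh m k P ∧ ∀ j, ∀ p : Polynomial ℝ, p.natDegree ≤ k →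
    ∫ x in m.left j..m.right j, (u x - P x) * p.eval x = 0

/-- `P` is the Gauss-Radau projection `P_h^+ u`: orthogonality of `u - P` to polynomials of degree
less than `k` on every cell (no condition if `k = 0`), and agreement of the right limits of `u`
and `P` at the left end point of every cell. -/
def IsGaussRadauPlus {a b : ℝ} (m : Mesh a b) (k : ℕ) (u P : ℝ → ℝ) : Prop :=
  MemVh m k P ∧
    (∀ j, ∀ p : Polynomial ℝ, p.degree < (k : WithBot ℕ) →
      ∫ x in m.left j..m.right j, (u x - P x) * p.eval x = 0) ∧
    ∀ j, Tendsto (fun x => u x - P x) (𝓝[>] m.left j) (𝓝 0)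

/-! ### The semi-discrete scheme -/

/-- `H_j(v,w;s) = ∫_{I_j} (v(x+s) - v(x)) / s * w(x) dx`. -/
def opH {a b : ℝ} (m : Mesh a b) (j : Fin m.N) (v w : ℝ → ℝ) (s : ℝ) : ℝ :=
  ∫ x in m.left j..m.right j, (v (x + s) - v x) / s * w x

/-- `K_j(v,w;s) = ∫_{I_j} (v(x) - v(x-s)) / s * w(x) dx`. -/
def opK {a b : ℝ} (m : Mesh a b) (j : Fin m.N) (v w : ℝ → ℝ) (s : ℝ) : ℝ :=
  ∫ x in m.left j..m.right j, (v x - v (x - s)) / s * w x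

/-- `(u_h, q_h)`, with `u_h = u_h(x,t)` and `q_h = q_h(x,t;s)`, is a solution of the semi-discrete
DG scheme with polynomial degree `k`. -/
structure IsDGSolution {a b : ℝ} (T δ : ℝ) (γ : ℝ → ℝ) (m : Mesh a b) (k : ℕ)
    (uh : ℝ → ℝ → ℝ) (qh : ℝ → ℝ → ℝ → ℝ) : Prop where
  mem_u : ∀ t ∈ Icc 0 T, MemVh m k (fun x => uh x t)
  mem_q : ∀ t ∈ Icc 0 T, ∀ s ∈ Ioc 0 δ, MemVh m k (fun x => qh x t s)
  smooth : ∀ j, ∀ x ∈ m.cell j, ContDiffOn ℝ 2 (fun t => uh x t) (Icc 0 T)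
  wave : ∀ t ∈ Icc 0 T, ∀ v, MemVh m k v → ∀ j,
    (∫ x in m.left j..m.right j, timeDeriv T (timeDeriv T uh) x t * v x)
      - 2 * ∫ s in (0 : ℝ)..δ, s ^ 2 * γ s * opK m j (fun x => qh x t s) v s = 0
  flux : ∀ t ∈ Icc 0 T, ∀ s ∈ Ioc 0 δ, ∀ w, MemVh m k w → ∀ j,
    (∫ x in m.left j..m.right j, qh x t s * w x) - opH m j (fun x => uh x t) w s = 0

/-- The discrete initial data are projections of the exact ones: `u_h` and `(u_h)_t` at time zero
are the `L²`-projections (if `k ≥ 1`) or the Gauss-Radau projections `P_h^+` (if `k = 0`) of `u`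
and `u_t` at time zero. -/
def HasProjectedData {a b : ℝ} (T : ℝ) (m : Mesh a b) (k : ℕ) (u uh : ℝ → ℝ → ℝ) : Prop :=
  (1 ≤ k →
    IsL2Projection m k (fun x => u x 0) (fun x => uh x 0) ∧
    IsL2Projection m k (fun x => timeDeriv T u x 0) (fun x => timeDeriv T uh x 0)) ∧
  (k = 0 →
    IsGaussRadauPlus m k (fun x => u x 0) (fun x => uh x 0) ∧
    IsGaussRadauPlus m k (fun x => timeDeriv T u x 0) (fun x => timeDeriv T uh x 0))

/-- The seminorms `|u_t|`, `|u|` and `|q|` in `L^∞([0,T]; H^{k+1}(a,b))`, the last one uniformly in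
`s ∈ (0,δ]`, are at most `R`. -/
def SeminormsBounded (a b T δ : ℝ) (k : ℕ) (R : ℝ) (u : ℝ → ℝ → ℝ) (q : ℝ → ℝ → ℝ → ℝ) : Prop :=
  ∀ t ∈ Icc 0 T,
    hSeminorm a b (k + 1) (fun x => timeDeriv T u x t) ≤ R ∧
    hSeminorm a b (k + 1) (fun x => u x t) ≤ R ∧
    ∀ s ∈ Ioc 0 δ, hSeminorm a b (k + 1) (fun x => q x t s) ≤ R

/-- At every time in `[0,T]` both `‖u_h - u‖²` and `∫_0^δ s² γ(s) ‖q_h - q‖² ds` are at most `B`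
(norms in `L²(a,b)`), where the integral over `s` exists. -/
def ErrorsBounded (a b T δ : ℝ) (γ : ℝ → ℝ) (u uh : ℝ → ℝ → ℝ) (q qh : ℝ → ℝ → ℝ → ℝ) (B : ℝ) :
    Prop :=
  ∀ t ∈ Icc 0 T,
    l2Norm a b (fun x => uh x t - u x t) ^ 2 ≤ B ∧
    IntervalIntegrable
      (fun s => s ^ 2 * γ s * l2Norm a b (fun x => qh x t s - q x t s) ^ 2) volume 0 δ ∧
    ∫ s in (0 : ℝ)..δ, s ^ 2 * γ s * l2Norm a b (fun x => qh x t s - q x t s) ^ 2 ≤ B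

end

end NonlocalDG

namespace NonlocalDG

/-! Write ω(s) = s²γ(s) and D_s f(x) = (f(x+s) - f(x))/s. The equation reads u_tt = 2∫ω D_{-s}D_s u,
and on periodic functions the adjoint of D_s is -D_{-s}. The natural energy is therefore ½‖u‖² +
½‖u_t‖² + ∫ω‖D_s u‖². Only ω is integrable, so every bound on difference quotients has to be uniform
as s → 0. The Grönwall argument for this energy, `energy_estimate`, serves the scheme and the
continuous problem alike.

For the scheme, u_h is compared with the L²-projection PU of a smooth solution U. When the discrete
energy is differentiated the coupling of velocity and flux errors cancels
(`OrthoBasis.energy_identity_le`). What remains are difference quotients of the projection errors η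
of U_t and of D_s U, tested with V_h^k. They are controlled by `ShiftBound`: |∫(η(x+σ) - η(x))v| ≤
|σ|α‖v‖ with α independent of σ. `IsDGSolution.energy` turns this into an energy bound of order α²
plus the initial energy, and `IsDGSolution.errors_le` returns from the projected quantities to the
errors themselves.

If k ≥ 1, then U = u. Moving the shift onto the polynomial test function, the part inside each cell
vanishes by orthogonality, and only strips of width |σ| at the cell ends remain. This gives α ~ h^k
(`exists_shiftBound_const`); for |σ| larger than a multiple of h the size of η suffices.

If k = 0, that argument yields only α = O(1). On a uniform mesh, however, testing with piecewise
constants sees η only through η(x+h) - η(x), and the projection commutes with the step h, so α is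
governed by the derivative of f(x+h) - f(x) (`shiftBound_err_of_uniform`). Now let U be the average
of the n translates u(x+ih), again an exact solution. Its increments telescope to (u(x+nh) -
u(x))/n, so α ~ 1/n, while U differs from u by O(nh). With n ~ h^{-1/2} both are O(h^{1/2}), and the
squared error is O(h).

For asymptotic compatibility, the constants depend on δ only through bounds for C_δ and for the
seminorms of u^δ. The derivatives ∂_x^{k+1}u^δ and their difference quotients solve the same
equation, so the energy bounds them by the initial data, which are common to all δ
(`IsExactSolution.seminormsBounded`). Finally u^δ - u_loc solves the nonlocal equation with the
consistency error as forcing, and that error tends to zero uniformly (`abs_nonlocalLap_sub_le`). -/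

/-! ### Calculus on the space-time slab ℝ × [0,T] -/

/-- The space derivative `u_x(x,t)`. -/
noncomputable def spaceDeriv (u : ℝ → ℝ → ℝ) (x t : ℝ) : ℝ := deriv (fun y => u y t) x

theorem uniqueDiffOn_slab {T : ℝ} (hT : 0 < T) :
    UniqueDiffOn ℝ ((univ : Set ℝ) ×ˢ Icc 0 T) :=
  uniqueDiffOn_univ.prod (uniqueDiffOn_Icc hT)

namespace IsSmoothOfOrder

variable {T : ℝ} {n : ℕ} {u v : ℝ → ℝ → ℝ}

theorem mono {k : ℕ} (hu : IsSmoothOfOrder T n u) (h : k ≤ n) : IsSmoothOfOrder T k u :=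
  ContDiffOn.of_le hu (by exact_mod_cast h)

theorem differentiableOn (hu : IsSmoothOfOrder T n u) (hn : n ≠ 0) :
    DifferentiableOn ℝ (fun p : ℝ × ℝ => u p.1 p.2) (univ ×ˢ Icc 0 T) :=
  ContDiffOn.differentiableOn hu (by exact_mod_cast hn)

theorem continuousOn (hu : IsSmoothOfOrder T n u) :
    ContinuousOn (fun p : ℝ × ℝ => u p.1 p.2) (univ ×ˢ Icc 0 T) :=
  ContDiffOn.continuousOn hu

/-- The slab is unbounded in the space direction, so the x-derivative is two-sided even at t = 0 and
t = T; only the time derivative is one-sided there. -/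
theorem hasDerivAt_fderivWithin (hu : IsSmoothOfOrder T n u) (hn : n ≠ 0) (x : ℝ) {t : ℝ}
    (ht : t ∈ Icc 0 T) :
    HasDerivAt (fun y => u y t)
      (fderivWithin ℝ (fun p : ℝ × ℝ => u p.1 p.2) (univ ×ˢ Icc 0 T) (x, t) (1, 0)) x := by
  have h1 := (hu.differentiableOn hn (x, t) ⟨mem_univ _, ht⟩).hasFDerivWithinAt
  have h2 : HasDerivWithinAt (fun y : ℝ => (y, t)) ((1 : ℝ), (0 : ℝ)) univ x :=
    ((hasDerivAt_id x).prodMk (hasDerivAt_const x t)).hasDerivWithinAt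
  have hm : MapsTo (fun y : ℝ => (y, t)) univ ((univ : Set ℝ) ×ˢ Icc 0 T) :=
    fun y _ => ⟨mem_univ _, ht⟩
  have h3 := h1.comp_hasDerivWithinAt x h2 hm
  rwa [hasDerivWithinAt_univ] at h3

theorem hasDerivWithinAt_fderivWithin (hu : IsSmoothOfOrder T n u) (hn : n ≠ 0) (x : ℝ) {t : ℝ}
    (ht : t ∈ Icc 0 T) :
    HasDerivWithinAt (fun τ => u x τ)
      (fderivWithin ℝ (fun p : ℝ × ℝ => u p.1 p.2) (univ ×ˢ Icc 0 T) (x, t) (0, 1))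
      (Icc 0 T) t := by
  have h1 := (hu.differentiableOn hn (x, t) ⟨mem_univ _, ht⟩).hasFDerivWithinAt
  have h2 : HasDerivWithinAt (fun τ : ℝ => (x, τ)) ((0 : ℝ), (1 : ℝ)) (Icc 0 T) t :=
    ((hasDerivAt_const t x).prodMk (hasDerivAt_id t)).hasDerivWithinAt
  exact h1.comp_hasDerivWithinAt t h2 (fun y hy => ⟨mem_univ _, hy⟩)

theorem spaceDeriv_eq (hu : IsSmoothOfOrder T n u) (hn : n ≠ 0) (x : ℝ) {t : ℝ}
    (ht : t ∈ Icc 0 T) : spaceDeriv u x t =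
      fderivWithin ℝ (fun p : ℝ × ℝ => u p.1 p.2) (univ ×ˢ Icc 0 T) (x, t) (1, 0) :=
  (hu.hasDerivAt_fderivWithin hn x ht).deriv

theorem timeDeriv_eq (hT : 0 < T) (hu : IsSmoothOfOrder T n u) (hn : n ≠ 0) (x : ℝ) {t : ℝ}
    (ht : t ∈ Icc 0 T) : timeDeriv T u x t =
      fderivWithin ℝ (fun p : ℝ × ℝ => u p.1 p.2) (univ ×ˢ Icc 0 T) (x, t) (0, 1) :=
  (hu.hasDerivWithinAt_fderivWithin hn x ht).derivWithin (uniqueDiffOn_Icc hT t ht)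

theorem hasDerivAt_space (hu : IsSmoothOfOrder T n u) (hn : n ≠ 0) (x : ℝ) {t : ℝ}
    (ht : t ∈ Icc 0 T) : HasDerivAt (fun y => u y t) (spaceDeriv u x t) x := by
  rw [hu.spaceDeriv_eq hn x ht]; exact hu.hasDerivAt_fderivWithin hn x ht

theorem hasDerivWithinAt_time (hT : 0 < T) (hu : IsSmoothOfOrder T n u) (hn : n ≠ 0) (x : ℝ)
    {t : ℝ} (ht : t ∈ Icc 0 T) :
    HasDerivWithinAt (fun τ => u x τ) (timeDeriv T u x t) (Icc 0 T) t := by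
  rw [hu.timeDeriv_eq hT hn x ht]; exact hu.hasDerivWithinAt_fderivWithin hn x ht

theorem fderivWithin_apply (hT : 0 < T) (hu : IsSmoothOfOrder T (n + 1) u) (w : ℝ × ℝ) :
    ContDiffOn ℝ n
      (fun p => fderivWithin ℝ (fun p : ℝ × ℝ => u p.1 p.2) (univ ×ˢ Icc 0 T) p w)
      (univ ×ˢ Icc 0 T) :=
  (ContDiffOn.fderivWithin hu (uniqueDiffOn_slab hT) (by norm_cast)).clm_apply contDiffOn_const

theorem space (hT : 0 < T) (hu : IsSmoothOfOrder T (n + 1) u) :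
    IsSmoothOfOrder T n (spaceDeriv u) :=
  (hu.fderivWithin_apply hT (1, 0)).congr
    (fun p hp => hu.spaceDeriv_eq n.succ_ne_zero p.1 hp.2)

theorem time (hT : 0 < T) (hu : IsSmoothOfOrder T (n + 1) u) :
    IsSmoothOfOrder T n (timeDeriv T u) :=
  (hu.fderivWithin_apply hT (0, 1)).congr
    (fun p hp => hu.timeDeriv_eq hT n.succ_ne_zero p.1 hp.2)

/-- Symmetry of second derivatives up to the time boundary. It is available because the slab lies in
the closure of its interior. -/
theorem timeDeriv_spaceDeriv (hT : 0 < T) (hu : IsSmoothOfOrder T (n + 2) u) (x : ℝ) {t : ℝ}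
    (ht : t ∈ Icc 0 T) :
    timeDeriv T (spaceDeriv u) x t = spaceDeriv (timeDeriv T u) x t := by
  set F := fun p : ℝ × ℝ => u p.1 p.2 with hF
  set S := (univ : Set ℝ) ×ˢ Icc 0 T with hS
  have hp : (x, t) ∈ S := ⟨mem_univ _, ht⟩
  have hsymm : IsSymmSndFDerivWithinAt ℝ F S (x, t) := by
    refine ContDiffWithinAt.isSymmSndFDerivWithinAt (n := 2) ?_ (by simp)
      (uniqueDiffOn_slab hT) ?_ hp
    · exact ContDiffOn.of_le hu (by norm_cast; omega) _ hp
    · rw [hS, interior_prod_eq, interior_univ, interior_Icc, closure_prod_eq, closure_univ,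
        closure_Ioo hT.ne]
      exact hp
  have hd : DifferentiableWithinAt ℝ (fun p => fderivWithin ℝ F S p) S (x, t) :=
    (ContDiffOn.fderivWithin (m := 1) hu (uniqueDiffOn_slab hT) (by norm_cast; omega)
      |>.differentiableOn (by norm_num)) _ hp
  have key : ∀ w : ℝ × ℝ, fderivWithin ℝ (fun p => fderivWithin ℝ F S p w) S (x, t)
      = (ContinuousLinearMap.apply ℝ ℝ w).comp
        (fderivWithin ℝ (fun p => fderivWithin ℝ F S p) S (x, t)) := by
    intro w
    exact ((ContinuousLinearMap.apply ℝ ℝ w).hasFDerivAt.comp_hasFDerivWithinAt _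
      hd.hasFDerivWithinAt).fderivWithin (uniqueDiffOn_slab hT _ hp)
  have hu1 : IsSmoothOfOrder T (n + 1) (spaceDeriv u) := hu.space hT
  have hu2 : IsSmoothOfOrder T (n + 1) (timeDeriv T u) := hu.time hT
  rw [hu1.timeDeriv_eq hT n.succ_ne_zero x ht, hu2.spaceDeriv_eq n.succ_ne_zero x ht]
  have e1 : fderivWithin ℝ (fun p : ℝ × ℝ => spaceDeriv u p.1 p.2) S (x, t)
      = fderivWithin ℝ (fun p => fderivWithin ℝ F S p (1, 0)) S (x, t) :=
    fderivWithin_congr (fun p hp => hu.spaceDeriv_eq (n + 1).succ_ne_zero p.1 hp.2)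
      (hu.spaceDeriv_eq (n + 1).succ_ne_zero x ht)
  have e2 : fderivWithin ℝ (fun p : ℝ × ℝ => timeDeriv T u p.1 p.2) S (x, t)
      = fderivWithin ℝ (fun p => fderivWithin ℝ F S p (0, 1)) S (x, t) :=
    fderivWithin_congr (fun p hp => hu.timeDeriv_eq hT (n + 1).succ_ne_zero p.1 hp.2)
      (hu.timeDeriv_eq hT (n + 1).succ_ne_zero x ht)
  rw [e1, e2, key, key]
  exact hsymm.eq _ _

theorem congr (hu : IsSmoothOfOrder T n u) (h : ∀ x, ∀ t ∈ Icc 0 T, v x t = u x t) :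
    IsSmoothOfOrder T n v :=
  ContDiffOn.congr hu (fun p hp => h p.1 p.2 hp.2)

theorem sub (hu : IsSmoothOfOrder T n u) (hv : IsSmoothOfOrder T n v) :
    IsSmoothOfOrder T n (fun x t => u x t - v x t) :=
  ContDiffOn.sub hu hv

theorem const_mul (c : ℝ) (hu : IsSmoothOfOrder T n u) :
    IsSmoothOfOrder T n (fun x t => c * u x t) :=
  contDiffOn_const.mul hu

theorem sum {ι : Type*} (I : Finset ι) {w : ι → ℝ → ℝ → ℝ}
    (hw : ∀ i ∈ I, IsSmoothOfOrder T n (w i)) :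
    IsSmoothOfOrder T n (fun x t => ∑ i ∈ I, w i x t) :=
  ContDiffOn.sum hw

theorem translate (y : ℝ) (hu : IsSmoothOfOrder T n u) :
    IsSmoothOfOrder T n (fun x t => u (x + y) t) := by
  have h : ContDiff ℝ n (fun p : ℝ × ℝ => (p.1 + y, p.2)) :=
    (contDiff_fst.add contDiff_const).prodMk contDiff_snd
  exact ContDiffOn.comp (g := fun p : ℝ × ℝ => u p.1 p.2) hu h.contDiffOn
    (fun p hp => ⟨mem_univ _, hp.2⟩)

theorem contDiff_slice (hu : IsSmoothOfOrder T n u) {t : ℝ} (ht : t ∈ Icc 0 T) :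
    ContDiff ℝ n (fun x => u x t) := by
  have h : ContDiff ℝ n (fun x : ℝ => (x, t)) := contDiff_id.prodMk contDiff_const
  exact contDiffOn_univ.1 (ContDiffOn.comp (g := fun p : ℝ × ℝ => u p.1 p.2) hu h.contDiffOn
    (fun p _ => ⟨mem_univ _, ht⟩))

theorem continuous_slice (hu : IsSmoothOfOrder T n u) {t : ℝ} (ht : t ∈ Icc 0 T) :
    Continuous (fun x => u x t) := (hu.contDiff_slice ht).continuous

/-- Compactness of one period times [0,T], carried to all x by periodicity. -/
theorem exists_bound {L : ℝ} (hL : 0 < L) (hu : IsSmoothOfOrder T n u)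
    (hp : ∀ t ∈ Icc 0 T, Function.Periodic (fun x => u x t) L) :
    ∃ B, 0 ≤ B ∧ ∀ x, ∀ t ∈ Icc 0 T, |u x t| ≤ B := by
  have hc : IsCompact (Icc 0 L ×ˢ Icc 0 T : Set (ℝ × ℝ)) := isCompact_Icc.prod isCompact_Icc
  obtain ⟨B, hB⟩ := hc.exists_bound_of_continuousOn
    (hu.continuousOn.mono (prod_mono (subset_univ _) le_rfl))
  refine ⟨max B 0, le_max_right _ _, fun x t ht => ?_⟩
  obtain ⟨y, hy, hxy⟩ := (hp t ht).exists_mem_Ico₀ hL x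
  have hxy' : u x t = u y t := hxy
  rw [hxy']
  exact (hB (y, t) ⟨Ico_subset_Icc_self hy, ht⟩).trans (le_max_left _ _)

end IsSmoothOfOrder

theorem timeDeriv_periodic {T L : ℝ} {u : ℝ → ℝ → ℝ}
    (hp : ∀ t ∈ Icc 0 T, Function.Periodic (fun x => u x t) L) {t : ℝ} (ht : t ∈ Icc 0 T) :
    Function.Periodic (fun x => timeDeriv T u x t) L := fun x =>
  derivWithin_congr (fun τ hτ => hp τ hτ x) (hp t ht x)

theorem spaceDeriv_periodic {L t : ℝ} {u : ℝ → ℝ → ℝ}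
    (hp : Function.Periodic (fun x => u x t) L) :
    Function.Periodic (fun x => spaceDeriv u x t) L := fun x => by
  have h : (fun y => u (y + L) t) = fun y => u y t := funext hp
  have := deriv_comp_add_const (fun y => u y t) L x
  simp only [spaceDeriv]
  rw [← this, h]

theorem iteratedDeriv_eq_iterate_spaceDeriv (u : ℝ → ℝ → ℝ) (t : ℝ) (n : ℕ) :
    iteratedDeriv n (fun x => u x t) = fun x => (spaceDeriv^[n] u) x t := by
  induction n with
  | zero => simp
  | succ n ih =>
    rw [iteratedDeriv_succ, ih]
    funext x
    rw [Function.iterate_succ_apply']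
    rfl

theorem IsSmoothOfOrder.iterate_space {T : ℝ} (hT : 0 < T) {n : ℕ} (m : ℕ) {u : ℝ → ℝ → ℝ}
    (hu : IsSmoothOfOrder T (n + m) u) : IsSmoothOfOrder T n (spaceDeriv^[m] u) := by
  induction m generalizing n with
  | zero => exact hu
  | succ m ih =>
    rw [Function.iterate_succ_apply']
    exact (ih (n := n + 1) (by rwa [add_assoc, add_comm 1 m])).space hT

theorem timeDeriv_congr {T : ℝ} {u v : ℝ → ℝ → ℝ} {x t : ℝ}
    (h : ∀ τ ∈ Icc 0 T, u x τ = v x τ) (ht : t ∈ Icc 0 T) :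
    timeDeriv T u x t = timeDeriv T v x t :=
  derivWithin_congr h (h t ht)

theorem IsSmoothOfOrder.iterate_spaceDeriv_timeDeriv {T : ℝ} (hT : 0 < T) {n : ℕ} (m : ℕ)
    {u : ℝ → ℝ → ℝ} (hu : IsSmoothOfOrder T (n + m + 1) u) (x : ℝ) {t : ℝ} (ht : t ∈ Icc 0 T) :
    (spaceDeriv^[m] (timeDeriv T u)) x t = timeDeriv T (spaceDeriv^[m] u) x t := by
  induction m generalizing n x with
  | zero => rfl
  | succ m ih =>
    rw [Function.iterate_succ_apply', Function.iterate_succ_apply']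
    have h1 : IsSmoothOfOrder T (n + 2) (spaceDeriv^[m] u) :=
      iterate_space hT m (hu.mono (by omega))
    rw [h1.timeDeriv_spaceDeriv hT x ht]
    have : (fun y => (spaceDeriv^[m] (timeDeriv T u)) y t)
        = fun y => timeDeriv T (spaceDeriv^[m] u) y t :=
      funext fun y => ih (n := n + 1) (hu.mono (by omega)) y
    simp only [spaceDeriv, this]

theorem iterate_spaceDeriv_periodic {L t : ℝ} {u : ℝ → ℝ → ℝ} (m : ℕ)
    (hp : Function.Periodic (fun x => u x t) L) :
    Function.Periodic (fun x => (spaceDeriv^[m] u) x t) L := by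
  induction m with
  | zero => exact hp
  | succ m ih => rw [Function.iterate_succ_apply']; exact spaceDeriv_periodic ih

/-! ### Bounded periodic functions and L² estimates -/

/-- Essentially bounded, a.e. strongly measurable, `L`-periodic functions. -/
structure PerBdd (L : ℝ) (f : ℝ → ℝ) : Prop where
  periodic : Function.Periodic f L
  aesm : AEStronglyMeasurable f volume
  bdd : ∃ B, 0 ≤ B ∧ ∀ᵐ x, |f x| ≤ B

theorem ae_translate {p : ℝ → Prop} (h : ∀ᵐ x, p x) (y : ℝ) : ∀ᵐ x, p (x + y) :=
  (measurePreserving_add_right volume y).quasiMeasurePreserving.ae h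

/-- The quadratic polynomial l ↦ ∫(f + l g)² is nonnegative, hence has nonpositive discriminant. -/
theorem sq_integral_mul_le {a b : ℝ} (hab : a ≤ b) {f g : ℝ → ℝ}
    (hf : IntervalIntegrable (fun x => f x ^ 2) volume a b)
    (hg : IntervalIntegrable (fun x => g x ^ 2) volume a b)
    (hfg : IntervalIntegrable (fun x => f x * g x) volume a b) :
    (∫ x in a..b, f x * g x) ^ 2 ≤ (∫ x in a..b, f x ^ 2) * ∫ x in a..b, g x ^ 2 := by
  have h : ∀ l : ℝ, 0 ≤ (∫ x in a..b, g x ^ 2) * (l * l) + (2 * ∫ x in a..b, f x * g x) * l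
      + ∫ x in a..b, f x ^ 2 := by
    intro l
    have e : (∫ x in a..b, g x ^ 2) * (l * l) + (2 * ∫ x in a..b, f x * g x) * l
        + ∫ x in a..b, f x ^ 2 = ∫ x in a..b, (f x + l * g x) ^ 2 := by
      have : ∀ x, (f x + l * g x) ^ 2 = (l * l) * g x ^ 2 + (2 * l) * (f x * g x) + f x ^ 2 :=
        fun x => by ring
      simp only [this]
      rw [intervalIntegral.integral_add ((hg.const_mul _).add (hfg.const_mul _)) hf,
        intervalIntegral.integral_add (hg.const_mul _) (hfg.const_mul _),
        intervalIntegral.integral_const_mul, intervalIntegral.integral_const_mul]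
      ring
    rw [e]
    exact intervalIntegral.integral_nonneg hab (fun x _ => sq_nonneg _)
  have := discrim_le_zero h
  rw [discrim] at this
  nlinarith

theorem sq_integral_le {a b : ℝ} (hab : a ≤ b) {f : ℝ → ℝ}
    (hf : IntervalIntegrable f volume a b)
    (hf2 : IntervalIntegrable (fun x => f x ^ 2) volume a b) :
    (∫ x in a..b, f x) ^ 2 ≤ (b - a) * ∫ x in a..b, f x ^ 2 := by
  have := sq_integral_mul_le hab (f := fun _ => (1 : ℝ)) (g := f) (by simp) hf2 (by simpa using hf)
  simpa using this

theorem l2Norm_nonneg (a b : ℝ) (f : ℝ → ℝ) : 0 ≤ l2Norm a b f := Real.sqrt_nonneg _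

theorem l2Norm_sq {a b : ℝ} (hab : a ≤ b) (f : ℝ → ℝ) :
    l2Norm a b f ^ 2 = ∫ x in a..b, f x ^ 2 :=
  Real.sq_sqrt (intervalIntegral.integral_nonneg hab (fun _ _ => sq_nonneg _))

namespace PerBdd

variable {L : ℝ} {f g : ℝ → ℝ}

theorem of_continuous (hL : 0 < L) (hp : Function.Periodic f L) (hc : Continuous f) :
    PerBdd L f := by
  obtain ⟨B, hB⟩ := (isCompact_Icc (a := 0) (b := L)).exists_bound_of_continuousOn hc.continuousOn
  refine ⟨hp, hc.aestronglyMeasurable, max B 0, le_max_right _ _, .of_forall fun x => ?_⟩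
  obtain ⟨y, hy, hxy⟩ := hp.exists_mem_Ico₀ hL x
  rw [hxy]
  exact (hB y (Ico_subset_Icc_self hy)).trans (le_max_left _ _)

theorem const (L c : ℝ) : PerBdd L (fun _ => c) :=
  ⟨fun _ => rfl, aestronglyMeasurable_const, |c|, abs_nonneg _, .of_forall fun _ => le_rfl⟩

theorem add (hf : PerBdd L f) (hg : PerBdd L g) : PerBdd L (fun x => f x + g x) := by
  obtain ⟨A, hA0, hA⟩ := hf.bdd
  obtain ⟨B, hB0, hB⟩ := hg.bdd
  refine ⟨hf.periodic.add hg.periodic, hf.aesm.add hg.aesm, A + B, by positivity, ?_⟩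
  filter_upwards [hA, hB] with x h1 h2
  exact (abs_add_le _ _).trans (add_le_add h1 h2)

theorem mul (hf : PerBdd L f) (hg : PerBdd L g) : PerBdd L (fun x => f x * g x) := by
  obtain ⟨A, hA0, hA⟩ := hf.bdd
  obtain ⟨B, hB0, hB⟩ := hg.bdd
  refine ⟨hf.periodic.mul hg.periodic, hf.aesm.mul hg.aesm, A * B, by positivity, ?_⟩
  filter_upwards [hA, hB] with x h1 h2
  rw [abs_mul]
  exact mul_le_mul h1 h2 (abs_nonneg _) hA0

theorem const_mul (c : ℝ) (hf : PerBdd L f) : PerBdd L (fun x => c * f x) := (const L c).mul hf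

theorem div_const (c : ℝ) (hf : PerBdd L f) : PerBdd L (fun x => f x / c) := by
  simpa [div_eq_inv_mul] using hf.const_mul c⁻¹

theorem sub (hf : PerBdd L f) (hg : PerBdd L g) : PerBdd L (fun x => f x - g x) := by
  simpa [sub_eq_add_neg] using hf.add (hg.const_mul (-1))

theorem sq (hf : PerBdd L f) : PerBdd L (fun x => f x ^ 2) := by
  simpa [pow_two] using hf.mul hf

theorem sum {ι : Type*} (I : Finset ι) {F : ι → ℝ → ℝ} (h : ∀ i ∈ I, PerBdd L (F i)) :
    PerBdd L (fun x => ∑ i ∈ I, F i x) := by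
  classical
  induction I using Finset.induction_on with
  | empty => simpa using const L 0
  | insert i I hi ih =>
    simp only [Finset.sum_insert hi]
    exact (h i (by simp)).add (ih fun j hj => h j (by simp [hj]))

theorem translate (y : ℝ) (hf : PerBdd L f) : PerBdd L (fun x => f (x + y)) := by
  obtain ⟨A, hA0, hA⟩ := hf.bdd
  refine ⟨fun x => ?_, hf.aesm.comp_quasiMeasurePreserving
    (measurePreserving_add_right volume y).quasiMeasurePreserving, A, hA0, ae_translate hA y⟩
  rw [show x + L + y = x + y + L by ring, hf.periodic]

theorem congr (hf : PerBdd L f) (hp : Function.Periodic g L) (h : f =ᵐ[volume] g) :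
    PerBdd L g := by
  obtain ⟨A, hA0, hA⟩ := hf.bdd
  refine ⟨hp, hf.aesm.congr h, A, hA0, ?_⟩
  filter_upwards [hA, h] with x h1 h2
  rwa [← h2]

theorem intervalIntegrable (hf : PerBdd L f) (x y : ℝ) : IntervalIntegrable f volume x y := by
  obtain ⟨A, hA0, hA⟩ := hf.bdd
  rw [intervalIntegrable_iff]
  refine Measure.integrableOn_of_bounded (M := A) (by simp) hf.aesm ?_
  exact ae_restrict_of_ae hA

theorem integral_translate {a b : ℝ} (hf : PerBdd (b - a) f) (y : ℝ) :
    ∫ x in a..b, f (x + y) = ∫ x in a..b, f x := by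
  rw [intervalIntegral.integral_comp_add_right]
  have := hf.periodic.intervalIntegral_add_eq (a + y) a
  rw [show a + y + (b - a) = b + y by ring, show a + (b - a) = b by ring] at this
  exact this

theorem sq_integral_mul_le {a b : ℝ} (hab : a ≤ b) (hf : PerBdd L f) (hg : PerBdd L g) :
    (∫ x in a..b, f x * g x) ^ 2 ≤ (∫ x in a..b, f x ^ 2) * ∫ x in a..b, g x ^ 2 :=
  NonlocalDG.sq_integral_mul_le hab (hf.sq.intervalIntegrable _ _) (hg.sq.intervalIntegrable _ _)
    ((hf.mul hg).intervalIntegrable _ _)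

theorem abs_integral_mul_le {a b : ℝ} (hab : a ≤ b) (hf : PerBdd L f) (hg : PerBdd L g) :
    |∫ x in a..b, f x * g x| ≤ l2Norm a b f * l2Norm a b g := by
  refine abs_le_of_sq_le_sq ?_ (mul_nonneg (l2Norm_nonneg _ _ _) (l2Norm_nonneg _ _ _))
  rw [mul_pow, l2Norm_sq hab, l2Norm_sq hab]
  exact hf.sq_integral_mul_le hab hg

theorem l2Norm_translate {a b : ℝ} (hf : PerBdd (b - a) f) (y : ℝ) :
    l2Norm a b (fun x => f (x + y)) = l2Norm a b f := by
  rw [l2Norm, l2Norm, hf.sq.integral_translate y]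

theorem l2Norm_add_le {a b : ℝ} (hab : a ≤ b) (hf : PerBdd L f) (hg : PerBdd L g) :
    l2Norm a b (fun x => f x + g x) ≤ l2Norm a b f + l2Norm a b g := by
  refine abs_le_of_sq_le_sq' ?_ (add_nonneg (l2Norm_nonneg _ _ _) (l2Norm_nonneg _ _ _)) |>.2
  have h := hf.abs_integral_mul_le hab hg
  have e : ∫ x in a..b, (f x + g x) ^ 2 = (∫ x in a..b, f x ^ 2) + 2 * (∫ x in a..b, f x * g x)
      + ∫ x in a..b, g x ^ 2 := by
    have : ∀ x, (f x + g x) ^ 2 = f x ^ 2 + 2 * (f x * g x) + g x ^ 2 := fun x => by ring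
    simp only [this]
    rw [intervalIntegral.integral_add (((hf.sq.add ((hf.mul hg).const_mul 2))).intervalIntegrable _ _)
      (hg.sq.intervalIntegrable _ _), intervalIntegral.integral_add (hf.sq.intervalIntegrable _ _)
      (((hf.mul hg).const_mul 2).intervalIntegrable _ _), intervalIntegral.integral_const_mul]
  rw [l2Norm_sq hab, e, add_sq, l2Norm_sq hab, l2Norm_sq hab]
  have := le_abs_self (∫ x in a..b, f x * g x)
  nlinarith

theorem l2Norm_sub_le {a b : ℝ} (hab : a ≤ b) (hf : PerBdd L f) (hg : PerBdd L g) :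
    l2Norm a b (fun x => f x - g x) ≤ l2Norm a b f + l2Norm a b g := by
  have := hf.l2Norm_add_le hab (hg.const_mul (-1))
  simpa [sub_eq_add_neg, l2Norm] using this

end PerBdd

theorem l2Norm_const_mul (a b c : ℝ) (f : ℝ → ℝ) :
    l2Norm a b (fun x => c * f x) = |c| * l2Norm a b f := by
  simp only [l2Norm, mul_pow]
  rw [intervalIntegral.integral_const_mul, Real.sqrt_mul (sq_nonneg c), Real.sqrt_sq_eq_abs]

theorem l2Norm_div_const (a b c : ℝ) (f : ℝ → ℝ) :
    l2Norm a b (fun x => f x / c) = l2Norm a b f / |c| := by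
  simp only [div_eq_inv_mul]
  rw [l2Norm_const_mul, abs_inv]

theorem l2Norm_congr_ae {a b : ℝ} {f g : ℝ → ℝ} (h : ∀ᵐ x, f x = g x) :
    l2Norm a b f = l2Norm a b g := by
  rw [l2Norm, l2Norm]
  congr 1
  exact intervalIntegral.integral_congr_ae (h.mono fun x hx _ => by rw [hx])

theorem intervalIntegral_swap {a b c d : ℝ} (hab : a ≤ b) (hcd : c ≤ d) {f : ℝ → ℝ → ℝ}
    (hf : IntegrableOn (Function.uncurry f) (Ioc a b ×ˢ Ioc c d) (volume.prod volume)) :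
    ∫ x in a..b, ∫ y in c..d, f x y = ∫ y in c..d, ∫ x in a..b, f x y := by
  simp only [intervalIntegral.integral_of_le hab, intervalIntegral.integral_of_le hcd]
  refine integral_integral_swap ?_
  rwa [Measure.prod_restrict]

/-- The difference quotient in space is controlled by the derivative. -/
theorem l2Norm_shift_sub_le {a b : ℝ} (hab : a < b) {f f' : ℝ → ℝ}
    (hf : ∀ x, HasDerivAt f (f' x) x) (hf' : Continuous f')
    (hp' : Function.Periodic f' (b - a)) (y : ℝ) :
    l2Norm a b (fun x => f (x + y) - f x) ≤ |y| * l2Norm a b f' := by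
  have hL : 0 < b - a := sub_pos.2 hab
  have P : PerBdd (b - a) f' := .of_continuous hL hp' hf'
  refine abs_le_of_sq_le_sq' ?_ (mul_nonneg (abs_nonneg _) (l2Norm_nonneg _ _ _)) |>.2
  have hc : Continuous f := continuous_iff_continuousAt.2 fun x => (hf x).continuousAt
  rw [mul_pow, l2Norm_sq hab.le, l2Norm_sq hab.le, sq_abs]
  -- The fundamental theorem along the segment from x to x + y. After squaring with Cauchy–Schwarz
  -- in τ and exchanging integrals, every translate of f' has the same norm over a period.
  have h1 : ∀ x, f (x + y) - f x = ∫ τ in (0 : ℝ)..1, y * f' (x + τ * y) := by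
    intro x
    have hd : ∀ τ ∈ uIcc (0 : ℝ) 1,
        HasDerivAt (fun τ => f (x + τ * y)) (y * f' (x + τ * y)) τ := by
      intro τ _
      have h := ((hasDerivAt_id τ).mul_const y).const_add x
      have := (hf (x + τ * y)).comp τ h
      simpa [mul_comm, Function.comp_def] using this
    rw [intervalIntegral.integral_eq_sub_of_hasDerivAt hd
      ((by fun_prop : Continuous fun τ => y * f' (x + τ * y)).intervalIntegrable _ _)]
    simp
  have h2 : ∀ x, (f (x + y) - f x) ^ 2 ≤ ∫ τ in (0 : ℝ)..1, y ^ 2 * f' (x + τ * y) ^ 2 := by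
    intro x
    rw [h1]
    have := sq_integral_le (a := 0) (b := 1) zero_le_one (f := fun τ => y * f' (x + τ * y))
      ((by fun_prop : Continuous fun τ => y * f' (x + τ * y)).intervalIntegrable _ _)
      ((by fun_prop : Continuous fun τ => (y * f' (x + τ * y)) ^ 2).intervalIntegrable _ _)
    simpa [mul_pow] using this
  have hc2 : Continuous (fun p : ℝ × ℝ => y ^ 2 * f' (p.1 + p.2 * y) ^ 2) := by fun_prop
  calc ∫ x in a..b, (f (x + y) - f x) ^ 2
      ≤ ∫ x in a..b, ∫ τ in (0 : ℝ)..1, y ^ 2 * f' (x + τ * y) ^ 2 := by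
        refine intervalIntegral.integral_mono_on hab.le
          ((by fun_prop : Continuous fun x => (f (x + y) - f x) ^ 2).intervalIntegrable _ _)
          ?_ (fun x _ => h2 x)
        exact (intervalIntegral.continuous_parametric_intervalIntegral_of_continuous'
          (f := fun x τ => y ^ 2 * f' (x + τ * y) ^ 2) hc2 0 1).intervalIntegrable _ _
    _ = ∫ τ in (0 : ℝ)..1, ∫ x in a..b, y ^ 2 * f' (x + τ * y) ^ 2 := by
        refine intervalIntegral_swap hab.le zero_le_one ?_
        exact (hc2.continuousOn.integrableOn_compact (isCompact_Icc.prod isCompact_Icc)).mono_set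
          (prod_mono Ioc_subset_Icc_self Ioc_subset_Icc_self)
    _ = ∫ τ in (0 : ℝ)..1, y ^ 2 * ∫ x in a..b, f' x ^ 2 := by
        refine intervalIntegral.integral_congr fun τ _ => ?_
        rw [intervalIntegral.integral_const_mul, P.sq.integral_translate (τ * y)]
    _ = _ := by simp

/-! ### Reduction modulo the period, meshes and piecewise polynomials -/

/-- The representative of `x` modulo `b - a` in `[a, b)`. -/
noncomputable def wrap (a b x : ℝ) : ℝ := a + (b - a) * Int.fract ((x - a) / (b - a))

theorem measurable_wrap (a b : ℝ) : Measurable (wrap a b) := by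
  unfold wrap
  exact (measurable_const.mul (measurable_fract.comp
    ((measurable_id.sub_const a).div_const (b - a)))).const_add a

theorem wrap_mem {a b : ℝ} (hab : a < b) (x : ℝ) : wrap a b x ∈ Ico a b := by
  have hL : 0 < b - a := sub_pos.2 hab
  have h0 := Int.fract_nonneg ((x - a) / (b - a))
  have h1 := Int.fract_lt_one ((x - a) / (b - a))
  constructor <;> unfold wrap <;> nlinarith

theorem wrap_eq_sub {a b : ℝ} (hab : a < b) (x : ℝ) :
    wrap a b x = x - ⌊(x - a) / (b - a)⌋ * (b - a) := by
  have hL : b - a ≠ 0 := (sub_pos.2 hab).ne'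
  rw [wrap, ← Int.self_sub_floor]
  field_simp
  ring

theorem wrap_periodic {a b : ℝ} (hab : a < b) : Function.Periodic (wrap a b) (b - a) := by
  have hL : b - a ≠ 0 := (sub_pos.2 hab).ne'
  intro x
  rw [wrap, wrap, show (x + (b - a) - a) / (b - a) = (x - a) / (b - a) + 1 by field_simp; ring,
    Int.fract_add_one]

theorem wrap_of_mem {a b x : ℝ} (hx : x ∈ Ico a b) : wrap a b x = x := by
  have hL : 0 < b - a := by linarith [hx.1, hx.2]
  rw [wrap, Int.fract_eq_self.2 ⟨div_nonneg (by linarith [hx.1]) hL.le,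
    (div_lt_one hL).2 (by linarith [hx.2])⟩]
  field_simp
  ring

theorem Function.Periodic.wrap_eq {a b : ℝ} (hab : a < b) {f : ℝ → ℝ}
    (hf : Function.Periodic f (b - a)) (x : ℝ) : f (wrap a b x) = f x := by
  rw [wrap_eq_sub hab]
  exact hf.sub_int_mul_eq _

namespace Mesh

variable {a b : ℝ} (m : Mesh a b)

theorem left_lt_right (j : Fin m.N) : m.left j < m.right j :=
  m.strictMono (Fin.castSucc_lt_succ)

theorem length_pos (j : Fin m.N) : 0 < m.length j := sub_pos.2 (m.left_lt_right j)

theorem node_mem (i : Fin (m.N + 1)) : m.node i ∈ Icc a b := by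
  constructor
  · exact m.node_zero.symm.le.trans (m.strictMono.monotone (Fin.zero_le _))
  · exact (m.strictMono.monotone (Fin.le_last _)).trans m.node_last.le

theorem le_left (j : Fin m.N) : a ≤ m.left j := (m.node_mem _).1

theorem right_le (j : Fin m.N) : m.right j ≤ b := (m.node_mem _).2

theorem cell_subset (j : Fin m.N) : m.cell j ⊆ Ioo a b :=
  Ioo_subset_Ioo (m.le_left j) (m.right_le j)

/-- Telescoping: the right end points are the nodes without the first one, the left end points the
nodes without the last one. -/
theorem sum_right_sub_left (F : ℝ → ℝ) : ∑ j, (F (m.right j) - F (m.left j)) = F b - F a := by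
  have h1 := Fin.sum_univ_succ (fun i => F (m.node i))
  have h2 := Fin.sum_univ_castSucc (fun i => F (m.node i))
  simp only [left, right, Finset.sum_sub_distrib]
  rw [m.node_zero] at h1
  rw [m.node_last] at h2
  linarith

theorem sum_left_eq_sum_right (F : ℝ → ℝ) (hF : F a = F b) :
    ∑ j, F (m.left j) = ∑ j, F (m.right j) := by
  have := m.sum_right_sub_left F
  rw [Finset.sum_sub_distrib, hF] at this
  linarith

theorem sum_integral {f : ℝ → ℝ} (hf : ∀ x y, IntervalIntegrable f volume x y) :
    ∑ j, ∫ x in m.left j..m.right j, f x = ∫ x in a..b, f x := by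
  have := m.sum_right_sub_left (fun y => ∫ x in a..y, f x)
  rw [intervalIntegral.integral_same, sub_zero] at this
  rw [← this]
  exact Finset.sum_congr rfl fun j _ =>
    (intervalIntegral.integral_interval_sub_left (hf _ _) (hf _ _)).symm

theorem N_pos (hab : a < b) : 0 < m.N := by
  rcases Nat.eq_zero_or_pos m.N with h | h
  · have h1 := m.node_zero
    have h2 := m.node_last
    have : (0 : Fin (m.N + 1)) = Fin.last m.N := by ext; simp [h]
    rw [this, h2] at h1
    exact absurd h1 hab.ne'
  · exact h

theorem length_le_size (j : Fin m.N) : m.length j ≤ m.size :=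
  le_ciSup (f := m.length) (Set.finite_range _).bddAbove j

theorem size_pos (hab : a < b) : 0 < m.size :=
  (m.length_pos ⟨0, m.N_pos hab⟩).trans_le (m.length_le_size _)

theorem size_le (hab : a < b) : m.size ≤ b - a := by
  have : Nonempty (Fin m.N) := ⟨⟨0, m.N_pos hab⟩⟩
  exact ciSup_le fun j => sub_le_sub (m.right_le j) (m.le_left j)

/-- If no cell contained x, induction along the nodes would place all of them at or below x,
including the last one, b. -/
theorem exists_mem_Ico {x : ℝ} (hx : x ∈ Ico a b) : ∃ j, x ∈ Ico (m.left j) (m.right j) := by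
  by_contra! h
  have key : ∀ i : Fin (m.N + 1), m.node i ≤ x := by
    intro i
    induction i using Fin.induction with
    | zero => rw [m.node_zero]; exact hx.1
    | succ i ih =>
      by_contra! hlt
      exact h i ⟨ih, hlt⟩
  have := key (Fin.last _)
  rw [m.node_last] at this
  exact absurd hx.2 this.not_gt

theorem eq_of_mem {x : ℝ} {i j : Fin m.N} (hi : x ∈ Ico (m.left i) (m.right i))
    (hj : x ∈ Ico (m.left j) (m.right j)) : i = j := by
  by_contra hne
  rcases lt_or_gt_of_ne hne with h | h
  · have : m.right i ≤ m.left j := m.strictMono.monotone (by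
      rw [Fin.le_def]; simpa using h)
    linarith [hi.2, hj.1]
  · have : m.right j ≤ m.left i := m.strictMono.monotone (by
      rw [Fin.le_def]; simpa using h)
    linarith [hj.2, hi.1]

/-- Membership in V_h^k leaves the values at the nodes open. Disagreement can occur only at the
periodic translates of finitely many nodes, so such functions may be exchanged under integrals. -/
theorem countable_ne (hab : a < b) {f g : ℝ → ℝ} (hf : Function.Periodic f (b - a))
    (hg : Function.Periodic g (b - a)) (h : ∀ j, ∀ x ∈ m.cell j, f x = g x) :
    {x | f x ≠ g x}.Countable := by
  have : {x | f x ≠ g x} ⊆ ⋃ z : ℤ, ⋃ i, {m.node i + z * (b - a)} := by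
    intro x hx
    obtain ⟨j, hj⟩ := m.exists_mem_Ico (wrap_mem hab x)
    have hne : f (wrap a b x) ≠ g (wrap a b x) := by
      rwa [Function.Periodic.wrap_eq hab hf, Function.Periodic.wrap_eq hab hg]
    have hl : wrap a b x = m.left j := by
      by_contra hl
      exact hne (h j _ ⟨lt_of_le_of_ne hj.1 (Ne.symm hl), hj.2⟩)
    simp only [mem_iUnion, mem_singleton_iff]
    refine ⟨⌊(x - a) / (b - a)⌋, j.castSucc, ?_⟩
    rw [show m.node j.castSucc = m.left j from rfl, ← hl, wrap_eq_sub hab]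
    ring
  exact (countable_iUnion fun z => countable_iUnion fun i => countable_singleton _).mono this

theorem ae_eq (hab : a < b) {f g : ℝ → ℝ} (hf : Function.Periodic f (b - a))
    (hg : Function.Periodic g (b - a)) (h : ∀ j, ∀ x ∈ m.cell j, f x = g x) :
    f =ᵐ[volume] g :=
  (m.countable_ne hab hf hg h).measure_zero _

/-- The periodic function that is equal to `p` on cell `j` and zero on the other cells. -/
noncomputable def cellFun (j : Fin m.N) (p : Polynomial ℝ) (x : ℝ) : ℝ :=
  (m.cell j).indicator (fun y => p.eval y) (wrap a b x)

theorem cellFun_measurable (j : Fin m.N) (p : Polynomial ℝ) : Measurable (m.cellFun j p) :=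
  (p.continuous.measurable.indicator measurableSet_Ioo).comp (measurable_wrap a b)

theorem cellFun_of_mem {j : Fin m.N} (p : Polynomial ℝ) {x : ℝ} (hx : x ∈ m.cell j) :
    m.cellFun j p x = p.eval x := by
  rw [cellFun, wrap_of_mem (Ioo_subset_Ico_self (m.cell_subset j hx)), indicator_of_mem hx]

theorem cellFun_of_ne {i j : Fin m.N} (h : i ≠ j) (p : Polynomial ℝ) {x : ℝ}
    (hx : x ∈ m.cell i) : m.cellFun j p x = 0 := by
  rw [cellFun, wrap_of_mem (Ioo_subset_Ico_self (m.cell_subset i hx)), indicator_of_notMem]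
  exact fun hx' => h (m.eq_of_mem (Ioo_subset_Ico_self hx) (Ioo_subset_Ico_self hx'))

theorem cellFun_memVh (hab : a < b) {k : ℕ} (j : Fin m.N) {p : Polynomial ℝ}
    (hp : p.natDegree ≤ k) : MemVh m k (m.cellFun j p) := by
  refine ⟨(wrap_periodic hab).comp _, fun i => ?_⟩
  by_cases h : i = j
  · subst h
    exact ⟨p, hp, fun x hx => m.cellFun_of_mem p hx⟩
  · exact ⟨0, by simp, fun x hx => by rw [m.cellFun_of_ne h p hx]; simp⟩

theorem cellFun_bdd (j : Fin m.N) (p : Polynomial ℝ) : ∃ B, 0 ≤ B ∧ ∀ x, |m.cellFun j p x| ≤ B := by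
  obtain ⟨B, hB⟩ := (isCompact_Icc (a := m.left j) (b := m.right j)).exists_bound_of_continuousOn
    p.continuous.continuousOn
  refine ⟨max B 0, le_max_right _ _, fun x => ?_⟩
  rw [cellFun]
  by_cases h : wrap a b x ∈ m.cell j
  · rw [indicator_of_mem h]
    exact (hB _ (Ioo_subset_Icc_self h)).trans (le_max_left _ _)
  · rw [indicator_of_notMem h, abs_zero]; exact le_max_right _ _

theorem cellFun_perBdd (hab : a < b) (j : Fin m.N) (p : Polynomial ℝ) :
    PerBdd (b - a) (m.cellFun j p) := by
  obtain ⟨B, hB0, hB⟩ := m.cellFun_bdd j p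
  exact ⟨(m.cellFun_memVh hab j le_rfl).1, (m.cellFun_measurable j p).aestronglyMeasurable,
    B, hB0, .of_forall hB⟩

theorem integral_cell_congr (j : Fin m.N) {f g : ℝ → ℝ} (h : ∀ x ∈ m.cell j, f x = g x) :
    ∫ x in m.left j..m.right j, f x = ∫ x in m.left j..m.right j, g x := by
  rw [intervalIntegral.integral_of_le (m.left_lt_right j).le,
    intervalIntegral.integral_of_le (m.left_lt_right j).le,
    integral_Ioc_eq_integral_Ioo, integral_Ioc_eq_integral_Ioo]
  exact setIntegral_congr_fun measurableSet_Ioo h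

/-- Testing with a function supported in one cell. -/
theorem integral_mul_cellFun (hab : a < b) {f : ℝ → ℝ} (hf : PerBdd (b - a) f) (j : Fin m.N)
    (p : Polynomial ℝ) :
    ∫ x in a..b, f x * m.cellFun j p x = ∫ x in m.left j..m.right j, f x * p.eval x := by
  rw [← m.sum_integral (hf.mul (m.cellFun_perBdd hab j p)).intervalIntegrable,
    Finset.sum_eq_single j]
  · exact m.integral_cell_congr j fun x hx => by rw [m.cellFun_of_mem p hx]
  · intro i _ hi
    rw [m.integral_cell_congr i (g := fun _ => 0) fun x hx => by
      rw [m.cellFun_of_ne hi p hx, mul_zero]]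
    simp
  · simp

end Mesh

namespace MemVh

variable {a b : ℝ} {m : Mesh a b} {k : ℕ} {v w : ℝ → ℝ}

theorem exists_eq_sum (hv : MemVh m k v) : ∃ p : Fin m.N → Polynomial ℝ,
    (∀ j, (p j).natDegree ≤ k) ∧ ∀ j, ∀ x ∈ m.cell j, v x = ∑ i, m.cellFun i (p i) x := by
  choose p hp h using hv.2
  refine ⟨p, hp, fun j x hx => ?_⟩
  rw [h j x hx, Finset.sum_eq_single j (fun i _ hi => m.cellFun_of_ne hi.symm _ hx) (by simp),
    m.cellFun_of_mem _ hx]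

/-- `MemVh` contains no measurability or boundedness on the whole line. Both are inherited from an
a.e. equal finite sum of cell functions, which are Borel and bounded. -/
theorem perBdd (hab : a < b) (hv : MemVh m k v) : PerBdd (b - a) v := by
  obtain ⟨p, -, h⟩ := hv.exists_eq_sum
  have hs : PerBdd (b - a) (fun x => ∑ i, m.cellFun i (p i) x) :=
    PerBdd.sum _ fun i _ => m.cellFun_perBdd hab i (p i)
  exact hs.congr hv.1 (m.ae_eq hab hs.periodic hv.1 fun j x hx => (h j x hx).symm)

theorem sum {ι : Type*} (I : Finset ι) (c : ι → ℝ) {F : ι → ℝ → ℝ}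
    (h : ∀ i ∈ I, MemVh m k (F i)) : MemVh m k (fun x => ∑ i ∈ I, c i * F i x) := by
  classical
  induction I using Finset.induction_on with
  | empty => exact ⟨fun x => by simp, fun j => ⟨0, by simp, fun x _ => by simp⟩⟩
  | insert i I hi ih =>
    have h1 := ih fun j hj => h j (by simp [hj])
    have h2 := h i (by simp)
    simp only [Finset.sum_insert hi]
    refine ⟨(((PerBdd.const _ (c i)).periodic).mul h2.1).add h1.1, fun j => ?_⟩
    obtain ⟨p, hp, e1⟩ := h1.2 j
    obtain ⟨q, hq, e2⟩ := h2.2 j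
    refine ⟨Polynomial.C (c i) * q + p, (Polynomial.natDegree_add_le _ _).trans (max_le
      ((Polynomial.natDegree_C_mul_le _ _).trans hq) hp), fun x hx => ?_⟩
    have e3 : ∑ i ∈ I, c i * F i x = p.eval x := e1 x hx
    simp [e2 x hx, e3]

end MemVh

/-! ### Orthonormal bases of the discrete space -/

/-- The `L²(l,r)` inner product of polynomials. -/
noncomputable def polyForm (l r : ℝ) (k : ℕ) :
    LinearMap.BilinForm ℝ (Polynomial.degreeLT ℝ (k + 1)) :=
  LinearMap.mk₂ ℝ (fun p q => ∫ x in l..r, p.1.eval x * q.1.eval x)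
    (fun p q w => by
      simp only [Submodule.coe_add, Polynomial.eval_add, add_mul]
      exact intervalIntegral.integral_add
        ((p.1.continuous.mul w.1.continuous).intervalIntegrable _ _)
        ((q.1.continuous.mul w.1.continuous).intervalIntegrable _ _))
    (fun c p q => by
      simp only [Submodule.coe_smul, Polynomial.eval_smul, smul_eq_mul, mul_assoc]
      exact intervalIntegral.integral_const_mul _ _)
    (fun p q w => by
      simp only [Submodule.coe_add, Polynomial.eval_add, mul_add]
      exact intervalIntegral.integral_add
        ((p.1.continuous.mul q.1.continuous).intervalIntegrable _ _)
        ((p.1.continuous.mul w.1.continuous).intervalIntegrable _ _))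
    (fun c p q => by
      simp only [Submodule.coe_smul, Polynomial.eval_smul, smul_eq_mul, mul_left_comm _ c]
      exact intervalIntegral.integral_const_mul _ _)

theorem polyForm_apply (l r : ℝ) (k : ℕ) (p q : Polynomial.degreeLT ℝ (k + 1)) :
    polyForm l r k p q = ∫ x in l..r, p.1.eval x * q.1.eval x := rfl

/-- A nonzero polynomial cannot vanish on a whole interval; by continuity its square then has a
positive integral. -/
theorem eq_zero_of_integral_sq {l r : ℝ} (h : l < r) (p : Polynomial ℝ)
    (hp : ∫ x in l..r, p.eval x ^ 2 = 0) : p = 0 := by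
  have hc : Continuous fun x => p.eval x ^ 2 := p.continuous.pow 2
  by_contra hne
  have hfin := p.rootSet_finite ℝ
  obtain ⟨x, hx, hroot⟩ : ∃ x ∈ Ioo l r, p.eval x ≠ 0 := by
    by_contra! hcon
    refine hne (Polynomial.eq_zero_of_infinite_isRoot p ((Ioo_infinite h).mono ?_))
    exact fun x hx => hcon x hx
  have := intervalIntegral.integral_pos h hc.continuousOn (fun y _ => sq_nonneg _)
    ⟨x, Ioo_subset_Icc_self hx, by positivity⟩
  exact this.ne' hp

theorem natDegree_le_of_mem_degreeLT {k : ℕ} {p : Polynomial ℝ}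
    (hp : p ∈ Polynomial.degreeLT ℝ (k + 1)) : p.natDegree ≤ k := by
  rcases eq_or_ne p 0 with rfl | h0
  · simp
  · rw [Polynomial.mem_degreeLT, ← Polynomial.natDegree_lt_iff_degree_lt h0] at hp
    exact Nat.lt_succ_iff.1 hp

theorem mem_degreeLT_of_natDegree_le {k : ℕ} {p : Polynomial ℝ} (hp : p.natDegree ≤ k) :
    p ∈ Polynomial.degreeLT ℝ (k + 1) := by
  rw [Polynomial.mem_degreeLT]
  exact (Polynomial.natDegree_le_iff_degree_le.1 hp).trans_lt (by exact_mod_cast k.lt_succ_self)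

/-- Orthonormal polynomials on an interval. -/
theorem exists_orthonormal_polynomials {l r : ℝ} (h : l < r) (k : ℕ) :
    ∃ e : Fin (k + 1) → Polynomial ℝ, (∀ i, (e i).natDegree ≤ k) ∧
      (∀ i j, ∫ x in l..r, (e i).eval x * (e j).eval x = if i = j then 1 else 0) ∧
      ∀ p : Polynomial ℝ, p.natDegree ≤ k →
        p = ∑ i, (∫ x in l..r, p.eval x * (e i).eval x) • e i := by
  have hsymm : LinearMap.IsSymm (polyForm l r k) := ⟨fun p q => by
    simp only [polyForm_apply, mul_comm, RingHom.id_apply]⟩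
  have hfr : Module.finrank ℝ (Polynomial.degreeLT ℝ (k + 1)) = k + 1 := by
    rw [(Polynomial.degreeLTEquiv ℝ (k + 1)).finrank_eq]; simp
  -- Symmetry alone yields an orthogonal basis; definiteness enters only in `hpos`, to normalise it.
  obtain ⟨v, hv⟩ := LinearMap.BilinForm.exists_orthogonal_basis hsymm
  let w := v.reindex (finCongr hfr)
  have hpos : ∀ i, 0 < ∫ x in l..r, (w i).1.eval x * (w i).1.eval x := by
    intro i
    have h0 : 0 ≤ ∫ x in l..r, (w i).1.eval x * (w i).1.eval x :=
      intervalIntegral.integral_nonneg h.le fun x _ => mul_self_nonneg _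
    refine lt_of_le_of_ne h0 fun hcon => w.ne_zero i ?_
    exact Subtype.ext (eq_zero_of_integral_sq h _ (by simp only [pow_two]; exact hcon.symm))
  have horth : ∀ i j, i ≠ j → ∫ x in l..r, (w i).1.eval x * (w j).1.eval x = 0 := by
    intro i j hij
    have := hv (i := (finCongr hfr).symm i) (j := (finCongr hfr).symm j)
      (fun hcon => hij ((finCongr hfr).symm.injective hcon))
    simpa [w, Function.onFun, polyForm_apply] using this
  let n : Fin (k + 1) → ℝ := fun i => Real.sqrt (∫ x in l..r, (w i).1.eval x * (w i).1.eval x)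
  have hn : ∀ i, n i ≠ 0 := fun i => (Real.sqrt_pos.2 (hpos i)).ne'
  have hn2 : ∀ i, n i * n i = ∫ x in l..r, (w i).1.eval x * (w i).1.eval x := fun i =>
    Real.mul_self_sqrt (hpos i).le
  let e : Fin (k + 1) → Polynomial ℝ := fun i => (n i)⁻¹ • (w i).1
  have hee : ∀ i j, ∫ x in l..r, (e i).eval x * (e j).eval x = if i = j then 1 else 0 := by
    intro i j
    have : ∀ x, (e i).eval x * (e j).eval x
        = ((n i)⁻¹ * (n j)⁻¹) * ((w i).1.eval x * (w j).1.eval x) := by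
      intro x
      simp only [e, Polynomial.eval_smul, smul_eq_mul]; ring
    simp only [this]
    rw [intervalIntegral.integral_const_mul]
    split_ifs with hij
    · subst hij
      rw [← hn2]
      field_simp [hn i]
    · rw [horth i j hij, mul_zero]
  have hdeg : ∀ i, (e i).natDegree ≤ k := fun i =>
    (Polynomial.natDegree_smul_le _ _).trans (natDegree_le_of_mem_degreeLT (w i).2)
  refine ⟨e, hdeg, hee, fun p hp => ?_⟩
  have hrep := w.sum_repr ⟨p, mem_degreeLT_of_natDegree_le hp⟩
  set c : Fin (k + 1) → ℝ := fun i => w.repr ⟨p, mem_degreeLT_of_natDegree_le hp⟩ i * n i with hc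
  have hp' : p = ∑ i, c i • e i := by
    have := congrArg Subtype.val hrep
    simp only [Submodule.coe_sum, Submodule.coe_smul] at this
    rw [← this]
    refine Finset.sum_congr rfl fun i _ => ?_
    simp only [hc, e, smul_smul, mul_assoc, mul_inv_cancel₀ (hn i), mul_one]
  have hci : ∀ i, ∫ x in l..r, p.eval x * (e i).eval x = c i := by
    intro i
    have : ∀ x, p.eval x * (e i).eval x = ∑ j, c j * ((e j).eval x * (e i).eval x) := by
      intro x
      conv_lhs => rw [hp']
      rw [Polynomial.eval_finsetSum, Finset.sum_mul]
      simp [mul_assoc]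
    simp only [this]
    have hint : ∀ j ∈ Finset.univ, IntervalIntegrable
        (fun x => c j * ((e j).eval x * (e i).eval x)) volume l r := fun j _ =>
      (continuous_const.mul ((e j).continuous.mul (e i).continuous)).intervalIntegrable _ _
    rw [intervalIntegral.integral_finsetSum hint]
    simp only [intervalIntegral.integral_const_mul, hee]
    simp
  simp only [hci]
  exact hp'

/-- A finite orthonormal basis of `V_h^k` in `L²(a,b)`. -/
structure OrthoBasis {a b : ℝ} (m : Mesh a b) (k : ℕ) (ι : Type) [Fintype ι] [DecidableEq ι] where
  fn : ι → ℝ → ℝ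
  memVh : ∀ i, MemVh m k (fn i)
  measurable : ∀ i, Measurable (fn i)
  ortho : ∀ i j, ∫ x in a..b, fn i x * fn j x = if i = j then 1 else 0
  expand : ∀ v, MemVh m k v → ∀ j, ∀ x ∈ m.cell j, v x = ∑ i, (∫ y in a..b, v y * fn i y) * fn i x

/-- Orthonormal polynomials on the single cells, extended by zero: distinct cells are disjoint, so
the union stays orthonormal. -/
theorem exists_orthoBasis {a b : ℝ} (hab : a < b) (m : Mesh a b) (k : ℕ) :
    Nonempty (OrthoBasis m k (Fin m.N × Fin (k + 1))) := by
  choose e hdeg hee hexp using fun j : Fin m.N =>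
    exists_orthonormal_polynomials (m.left_lt_right j) k
  refine ⟨⟨fun i => m.cellFun i.1 (e i.1 i.2), fun i => m.cellFun_memVh hab i.1 (hdeg i.1 i.2),
    fun i => m.cellFun_measurable _ _, ?_, ?_⟩⟩
  · rintro ⟨i, i'⟩ ⟨j, j'⟩
    rw [m.integral_mul_cellFun hab (m.cellFun_perBdd hab _ _)]
    by_cases hij : i = j
    · subst hij
      rw [m.integral_cell_congr i fun x hx => by rw [m.cellFun_of_mem _ hx]]
      simp only [hee]
      by_cases h : i' = j' <;> simp [h]
    · rw [m.integral_cell_congr j (g := fun _ => 0) fun x hx => by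
        rw [m.cellFun_of_ne (Ne.symm hij) _ hx, zero_mul]]
      simp [hij]
  · intro v hv j x hx
    obtain ⟨p, hp, hvp⟩ := hv.2 j
    rw [hvp x hx, Fintype.sum_prod_type, Finset.sum_eq_single j]
    · conv_lhs => rw [hexp j p hp, Polynomial.eval_finsetSum]
      refine Finset.sum_congr rfl fun i _ => ?_
      rw [m.integral_mul_cellFun hab (hv.perBdd hab), m.cellFun_of_mem _ hx,
        Polynomial.eval_smul, smul_eq_mul,
        m.integral_cell_congr j (f := fun y => v y * (e j i).eval y)
          (g := fun y => p.eval y * (e j i).eval y) fun y hy => by rw [hvp y hy]]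
    · intro i _ hi
      refine Finset.sum_eq_zero fun i' _ => ?_
      rw [m.cellFun_of_ne hi.symm _ hx, mul_zero]
    · simp

namespace OrthoBasis

variable {a b : ℝ} {m : Mesh a b} {k : ℕ} {ι : Type} [Fintype ι] [DecidableEq ι]
  (φ : OrthoBasis m k ι)

theorem perBdd (hab : a < b) (i : ι) : PerBdd (b - a) (φ.fn i) := (φ.memVh i).perBdd hab

/-- The coefficients of the `L²`-projection onto `V_h^k`. -/
noncomputable def coef (_φ : OrthoBasis m k ι) (f : ℝ → ℝ) (i : ι) : ℝ :=
  ∫ x in a..b, f x * _φ.fn i x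

/-- The element of `V_h^k` with given coefficients. -/
noncomputable def comb (_φ : OrthoBasis m k ι) (c : ι → ℝ) (x : ℝ) : ℝ := ∑ i, c i * _φ.fn i x

theorem comb_memVh (c : ι → ℝ) : MemVh m k (φ.comb c) := MemVh.sum _ c fun i _ => φ.memVh i

theorem comb_perBdd (hab : a < b) (c : ι → ℝ) : PerBdd (b - a) (φ.comb c) :=
  (φ.comb_memVh c).perBdd hab

theorem eq_comb_coef {v : ℝ → ℝ} (hv : MemVh m k v) (j : Fin m.N) {x : ℝ} (hx : x ∈ m.cell j) :
    v x = φ.comb (φ.coef v) x := φ.expand v hv j x hx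

theorem ae_eq_comb_coef (hab : a < b) {v : ℝ → ℝ} (hv : MemVh m k v) :
    v =ᵐ[volume] φ.comb (φ.coef v) :=
  m.ae_eq hab hv.1 (φ.comb_memVh _).1 fun j _ hx => φ.eq_comb_coef hv j hx

theorem integral_mul_comb (hab : a < b) {f : ℝ → ℝ} (hf : PerBdd (b - a) f) (c : ι → ℝ) :
    ∫ x in a..b, f x * φ.comb c x = ∑ i, c i * φ.coef f i := by
  simp only [comb, Finset.mul_sum]
  rw [intervalIntegral.integral_finsetSum fun i _ =>
    (hf.mul ((φ.perBdd hab i).const_mul (c i))).intervalIntegrable _ _]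
  refine Finset.sum_congr rfl fun i _ => ?_
  rw [coef, ← intervalIntegral.integral_const_mul]
  exact intervalIntegral.integral_congr fun x _ => by ring

theorem coef_comb (hab : a < b) (c : ι → ℝ) (i : ι) : φ.coef (φ.comb c) i = c i := by
  rw [coef]
  simp only [mul_comm (φ.comb c _)]
  rw [φ.integral_mul_comb hab (φ.perBdd hab i)]
  simp [coef, φ.ortho]

theorem coef_sub (hab : a < b) {f g : ℝ → ℝ} (hf : PerBdd (b - a) f) (hg : PerBdd (b - a) g)
    (i : ι) : φ.coef (fun x => f x - g x) i = φ.coef f i - φ.coef g i := by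
  simp only [coef, sub_mul]
  exact intervalIntegral.integral_sub ((hf.mul (φ.perBdd hab i)).intervalIntegrable _ _)
    ((hg.mul (φ.perBdd hab i)).intervalIntegrable _ _)

theorem l2Norm_comb_sq (hab : a < b) (c : ι → ℝ) :
    l2Norm a b (φ.comb c) ^ 2 = ∑ i, c i ^ 2 := by
  rw [l2Norm_sq hab.le]
  simp only [pow_two]
  rw [φ.integral_mul_comb hab (φ.comb_perBdd hab c)]
  simp only [φ.coef_comb hab]

/-- Bessel's inequality. -/
theorem sum_coef_sq_le (hab : a < b) {f : ℝ → ℝ} (hf : PerBdd (b - a) f) :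
    ∑ i, φ.coef f i ^ 2 ≤ l2Norm a b f ^ 2 := by
  have h := hf.abs_integral_mul_le hab.le (φ.comb_perBdd hab (φ.coef f))
  rw [φ.integral_mul_comb hab hf] at h
  have h1 := φ.l2Norm_comb_sq hab (φ.coef f)
  simp only [← pow_two] at h
  rw [← h1] at h ⊢
  rw [abs_of_nonneg (sq_nonneg _)] at h
  have h2 := l2Norm_nonneg a b (φ.comb (φ.coef f))
  have h3 := l2Norm_nonneg a b f
  rcases h2.eq_or_lt with h0 | h0
  · rw [← h0, zero_pow two_ne_zero]; positivity
  · have : l2Norm a b (φ.comb (φ.coef f)) ≤ l2Norm a b f := by nlinarith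
    gcongr

theorem coef_congr_ae {f g : ℝ → ℝ} (h : f =ᵐ[volume] g) (i : ι) : φ.coef f i = φ.coef g i :=
  intervalIntegral.integral_congr_ae (h.mono fun x hx _ => by rw [hx])

/-- The projection error is orthogonal to polynomials on every cell. -/
theorem integral_sub_mul_eval (hab : a < b) {f : ℝ → ℝ} (hf : PerBdd (b - a) f) (j : Fin m.N)
    {p : Polynomial ℝ} (hp : p.natDegree ≤ k) :
    ∫ x in m.left j..m.right j, (φ.comb (φ.coef f) x - f x) * p.eval x = 0 := by
  have h1 := (φ.comb_perBdd hab (φ.coef f)).sub hf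
  rw [← m.integral_mul_cellFun hab h1 j p]
  have h2 := φ.ae_eq_comb_coef hab (m.cellFun_memVh hab j hp)
  have h3 : ∫ x in a..b, (φ.comb (φ.coef f) x - f x) * m.cellFun j p x
      = ∫ x in a..b, (φ.comb (φ.coef f) x - f x) * φ.comb (φ.coef (m.cellFun j p)) x :=
    intervalIntegral.integral_congr_ae (h2.mono fun x hx _ => by rw [hx])
  rw [h3, φ.integral_mul_comb hab h1]
  refine Finset.sum_eq_zero fun i _ => ?_
  rw [φ.coef_sub hab (φ.comb_perBdd hab _) hf, φ.coef_comb hab, sub_self, mul_zero]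

end OrthoBasis

/-! ### Translations of projection errors tested with V_h^k -/

/-- `η(x + σ) - η(x)`, tested with functions of `V_h^k`, is of size `|σ| α`. -/
def ShiftBound {a b : ℝ} (m : Mesh a b) (k : ℕ) (η : ℝ → ℝ) (α : ℝ) : Prop :=
  ∀ σ v, MemVh m k v →
    |∫ x in a..b, (η (x + σ) - η x) * v x| ≤ |σ| * α * l2Norm a b v

/-- Cauchy–Schwarz for oriented integrals. The strips between y and y + σ have either orientation,
hence the absolute values. -/
theorem sq_intervalIntegral_mul_le {L : ℝ} {f g : ℝ → ℝ} (hf : PerBdd L f)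
    (hg : Continuous g) {B x y : ℝ} (hB : ∀ z ∈ uIcc x y, |g z| ≤ B) :
    (∫ z in x..y, f z * g z) ^ 2 ≤ B ^ 2 * |y - x| * |∫ z in x..y, f z ^ 2| := by
  wlog hxy : x ≤ y generalizing x y
  · have := this (by rwa [uIcc_comm]) (le_of_not_ge hxy)
    rw [intervalIntegral.integral_symm x y, neg_sq, intervalIntegral.integral_symm x y, abs_neg,
      abs_sub_comm] at this
    exact this
  have h1 := sq_integral_mul_le hxy (hf.sq.intervalIntegrable x y)
    ((hg.pow 2).intervalIntegrable x y) ((hf.intervalIntegrable x y).mul_continuousOn hg.continuousOn)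
  have h2 : ∫ z in x..y, g z ^ 2 ≤ B ^ 2 * (y - x) := by
    have := intervalIntegral.integral_mono_on hxy (μ := volume) ((hg.pow 2).intervalIntegrable x y)
      (intervalIntegrable_const (c := B ^ 2)) (fun z hz => by
        have := hB z (by rwa [uIcc_of_le hxy])
        change g z ^ 2 ≤ B ^ 2
        rw [← sq_abs (g z)]
        exact pow_le_pow_left₀ (abs_nonneg _) this 2)
    simpa [mul_comm] using this
  have h3 : 0 ≤ ∫ z in x..y, f z ^ 2 := intervalIntegral.integral_nonneg hxy fun _ _ => sq_nonneg _
  rw [abs_of_nonneg h3, abs_of_nonneg (sub_nonneg.2 hxy)]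
  calc _ ≤ _ := h1
    _ ≤ (∫ z in x..y, f z ^ 2) * (B ^ 2 * (y - x)) := by gcongr
    _ = _ := by ring

/-- A translation of one factor, moved to the other factor up to boundary strips. -/
theorem integral_shift_sub_mul_eval {L : ℝ} {f : ℝ → ℝ} (hf : PerBdd L f) (p : Polynomial ℝ)
    (l r σ : ℝ) :
    ∫ x in l..r, (f (x + σ) - f x) * p.eval x =
      (∫ x in l..r, f x * (p.eval (x - σ) - p.eval x)) +
      ((∫ x in r..r + σ, f x * p.eval (x - σ)) - ∫ x in l..l + σ, f x * p.eval (x - σ)) := by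
  have hc : Continuous fun x => p.eval (x - σ) := p.continuous.comp (continuous_sub_right σ)
  have hI : ∀ x y, IntervalIntegrable (fun x => f x * p.eval (x - σ)) volume x y := fun x y =>
    (hf.intervalIntegrable x y).mul_continuousOn hc.continuousOn
  have hI' : ∀ x y, IntervalIntegrable (fun x => f x * p.eval x) volume x y := fun x y =>
    (hf.intervalIntegrable x y).mul_continuousOn p.continuous.continuousOn
  have hI'' : IntervalIntegrable (fun x => f (x + σ) * p.eval x) volume l r :=
    ((hf.translate σ).intervalIntegrable l r).mul_continuousOn p.continuous.continuousOn
  have h1 : ∫ x in l..r, f (x + σ) * p.eval x = ∫ x in l + σ..r + σ, f x * p.eval (x - σ) := by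
    rw [← intervalIntegral.integral_comp_add_right (fun x => f x * p.eval (x - σ))]
    simp
  simp only [sub_mul, mul_sub]
  rw [intervalIntegral.integral_sub hI'' (hI' _ _), intervalIntegral.integral_sub (hI _ _) (hI' _ _),
    h1, ← intervalIntegral.integral_add_adjacent_intervals (hI (l + σ) l) (hI l (r + σ)),
    ← intervalIntegral.integral_add_adjacent_intervals (hI l r) (hI r (r + σ)),
    intervalIntegral.integral_symm l (l + σ)]
  ring

theorem integral_shift_sub_mul {a b : ℝ} (m : Mesh a b) {f v : ℝ → ℝ}
    (hf : PerBdd (b - a) f) (hv : PerBdd (b - a) v) {p : Fin m.N → Polynomial ℝ}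
    (hp : ∀ j, ∀ x ∈ m.cell j, v x = (p j).eval x) (σ : ℝ) :
    ∫ x in a..b, (f (x + σ) - f x) * v x =
      ∑ j, ((∫ x in m.left j..m.right j, f x * ((p j).eval (x - σ) - (p j).eval x)) +
        ((∫ x in m.right j..m.right j + σ, f x * (p j).eval (x - σ)) -
          ∫ x in m.left j..m.left j + σ, f x * (p j).eval (x - σ))) := by
  rw [← m.sum_integral (((hf.translate σ).sub hf).mul hv).intervalIntegrable]
  refine Finset.sum_congr rfl fun j _ => ?_
  rw [← integral_shift_sub_mul_eval hf,
    m.integral_cell_congr j fun x hx => by rw [hp j x hx]]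

theorem abs_integral_mul_le_of_bound {L : ℝ} {f g : ℝ → ℝ} {A B x y : ℝ} (hA0 : 0 ≤ A)
    (hA : ∀ᵐ z, |f z| ≤ A)
    (hB : ∀ z ∈ uIcc x y, |g z| ≤ B) (hL : |y - x| ≤ L) :
    |∫ z in x..y, f z * g z| ≤ A * B * L := by
  have hB0 : 0 ≤ B := (abs_nonneg _).trans (hB x left_mem_uIcc)
  have h := intervalIntegral.norm_integral_le_of_norm_le_const_ae (a := x) (b := y)
    (f := fun z => f z * g z) (C := A * B) (hA.mono fun z hz hz' => by
      rw [Real.norm_eq_abs, abs_mul]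
      exact mul_le_mul hz (hB z (uIoc_subset_uIcc hz')) (abs_nonneg _) hA0)
  rw [Real.norm_eq_abs] at h
  exact h.trans (by gcongr)

/-- Difference quotients tested with a fixed element of `V_h^k` are bounded uniformly in the step. -/
theorem MemVh.exists_shift_bound {a b : ℝ} (hab : a < b) {m : Mesh a b} {k : ℕ} {v : ℝ → ℝ}
    (hv : MemVh m k v) {f : ℝ → ℝ} (hf : PerBdd (b - a) f) (δ : ℝ) :
    ∃ C, 0 ≤ C ∧ ∀ σ, |σ| ≤ δ → |∫ x in a..b, (f (x + σ) - f x) * v x| ≤ C * |σ| := by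
  choose p hp h using hv.2
  obtain ⟨A, hA0, hA⟩ := hf.bdd
  have hB : ∀ j, ∃ B, 0 ≤ B ∧ ∀ σ, |σ| ≤ δ →
      |(∫ x in m.left j..m.right j, f x * ((p j).eval (x - σ) - (p j).eval x)) +
        ((∫ x in m.right j..m.right j + σ, f x * (p j).eval (x - σ)) -
          ∫ x in m.left j..m.left j + σ, f x * (p j).eval (x - σ))| ≤ B * |σ| := by
    intro j
    set l := m.left j
    set r := m.right j
    -- The polynomial is evaluated at x - σ, which leaves the cell by at most δ; hence bounds for it
    -- and its derivative on the enlarged interval. The interior term is then O(|σ|) by the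
    -- derivative, the strips by their width.
    obtain ⟨P, hP⟩ := (isCompact_Icc (a := l - δ) (b := r + δ)).exists_bound_of_continuousOn
      (f := fun x => (p j).eval x) (p j).continuous.continuousOn
    obtain ⟨D, hD⟩ := (isCompact_Icc (a := l - δ) (b := r + δ)).exists_bound_of_continuousOn
      (f := fun x => (p j).derivative.eval x) (p j).derivative.continuous.continuousOn
    have hlr : l ≤ r := (m.left_lt_right j).le
    refine ⟨A * |D| * (r - l) + A * |P| * 2, ?_, fun σ hσ => ?_⟩
    · have := sub_nonneg.2 hlr
      positivity
    have hσ1 := abs_le.1 hσ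
    have e1 : |∫ x in l..r, f x * ((p j).eval (x - σ) - (p j).eval x)|
        ≤ A * (|D| * |σ|) * (r - l) := by
      refine abs_integral_mul_le_of_bound hA0 hA (fun z hz => ?_) (abs_of_nonneg (sub_nonneg.2 hlr)).le
      rw [uIcc_of_le hlr] at hz
      have := (convex_Icc (l - δ) (r + δ)).norm_image_sub_le_of_norm_hasDerivWithin_le
        (f := fun x => (p j).eval x) (f' := fun x => (p j).derivative.eval x) (C := |D|)
        (fun x _ => ((p j).hasDerivAt x).hasDerivWithinAt)
        (fun x hx => (hD x hx).trans (le_abs_self D))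
        (x := z) (y := z - σ) ⟨by linarith [hz.1], by linarith [hz.2]⟩
        ⟨by linarith [hz.1], by linarith [hz.2]⟩
      simpa using this
    have e2 : ∀ y ∈ Icc l r, |∫ x in y..y + σ, f x * (p j).eval (x - σ)| ≤ A * |P| * |σ| := by
      intro y hy
      refine abs_integral_mul_le_of_bound hA0 hA (fun z hz => ?_) (by simp)
      refine (hP (z - σ) ?_).trans (le_abs_self P)
      rcases le_total 0 σ with h0 | h0
      · rw [uIcc_of_le (by linarith)] at hz
        exact ⟨by linarith [hz.1, hy.1], by linarith [hz.2, hy.2]⟩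
      · rw [uIcc_of_ge (by linarith)] at hz
        exact ⟨by linarith [hz.1, hy.1], by linarith [hz.2, hy.2]⟩
    have e3 := e2 r ⟨hlr, le_rfl⟩
    have e4 := e2 l ⟨le_rfl, hlr⟩
    refine (abs_add_le _ _).trans ?_
    have := abs_sub (∫ x in r..r + σ, f x * (p j).eval (x - σ))
      (∫ x in l..l + σ, f x * (p j).eval (x - σ))
    have e5 : (A * |D| * (r - l) + A * |P| * 2) * |σ|
        = A * (|D| * |σ|) * (r - l) + 2 * (A * |P| * |σ|) := by ring
    linarith
  choose B hB0 hB using hB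
  refine ⟨∑ j, B j, Finset.sum_nonneg fun j _ => hB0 j, fun σ hσ => ?_⟩
  rw [integral_shift_sub_mul m hf (hv.perBdd hab) h, Finset.sum_mul]
  exact (Finset.abs_sum_le_sum_abs _ _).trans (Finset.sum_le_sum fun j _ => hB j σ hσ)

/-- Inverse estimate, on a neighbourhood of the interval. -/
theorem exists_inverse_const (k : ℕ) : ∃ C : ℝ, 0 ≤ C ∧ ∀ p : Polynomial ℝ, p.natDegree ≤ k →
    ∀ l r, l < r → ∀ x ∈ Icc (l - (r - l)) (r + (r - l)),
      p.eval x ^ 2 * (r - l) ≤ C * ∫ y in l..r, p.eval y ^ 2 := by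
  obtain ⟨e, he, ho, hexp⟩ := exists_orthonormal_polynomials (zero_lt_one' ℝ) k
  obtain ⟨C, hC⟩ := (isCompact_Icc (a := (-1 : ℝ)) (b := 2)).exists_bound_of_continuousOn
    (f := fun x => ∑ i, (e i).eval x ^ 2)
    (Continuous.continuousOn (by fun_prop))
  -- On the unit interval: expand in orthonormal polynomials and apply Cauchy–Schwarz to the sum.
  -- The interval [-1,2] is the unit cell with one cell length added on either side.
  have unit : ∀ p : Polynomial ℝ, p.natDegree ≤ k → ∀ x ∈ Icc (-1 : ℝ) 2,
      p.eval x ^ 2 ≤ |C| * ∫ y in (0 : ℝ)..1, p.eval y ^ 2 := by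
    intro p hp x hx
    set c : Fin (k + 1) → ℝ := fun i => ∫ x in (0 : ℝ)..1, p.eval x * (e i).eval x with hc
    have hpe : ∀ y, p.eval y = ∑ i, c i * (e i).eval y := by
      intro y
      conv_lhs => rw [hexp p hp, Polynomial.eval_finsetSum]
      simp [hc]
    have h1 : ∫ y in (0 : ℝ)..1, p.eval y ^ 2 = ∑ i, c i ^ 2 := by
      have : ∀ y, p.eval y ^ 2 = ∑ i, c i * (p.eval y * (e i).eval y) := by
        intro y
        rw [pow_two]
        conv_lhs => rw [hpe y, Finset.sum_mul, ← hpe y]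
        exact Finset.sum_congr rfl fun i _ => by ring
      simp only [this]
      have hint : ∀ i ∈ Finset.univ, IntervalIntegrable
          (fun y => c i * (p.eval y * (e i).eval y)) volume 0 1 := fun i _ =>
        (continuous_const.mul (p.continuous.mul (e i).continuous)).intervalIntegrable _ _
      rw [intervalIntegral.integral_finsetSum hint]
      exact Finset.sum_congr rfl fun i _ => by
        rw [intervalIntegral.integral_const_mul, pow_two]
    rw [h1, hpe x]
    refine (Finset.sum_mul_sq_le_sq_mul_sq _ _ _).trans ?_
    rw [mul_comm]
    gcongr
    exact (le_abs_self _).trans ((hC x hx).trans (le_abs_self C))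
  refine ⟨|C|, abs_nonneg _, fun p hp l r hlr x hx => ?_⟩
  have hd : 0 < r - l := sub_pos.2 hlr
  -- Pull-back of p by the affine map from [0,1] onto [l,r]; the factor r - l in the estimate is the
  -- Jacobian.
  set q : Polynomial ℝ := p.comp (Polynomial.C (r - l) * Polynomial.X + Polynomial.C l) with hq
  have hqd : q.natDegree ≤ k := by
    refine Polynomial.natDegree_comp_le.trans ?_
    calc _ ≤ p.natDegree * 1 := Nat.mul_le_mul le_rfl Polynomial.natDegree_linear_le
      _ ≤ k := by simpa using hp
  have hqe : ∀ y, q.eval y = p.eval ((r - l) * y + l) := fun y => by simp [hq]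
  have h := unit q hqd ((x - l) / (r - l))
    ⟨by rw [le_div_iff₀ hd]; linarith [hx.1], by rw [div_le_iff₀ hd]; linarith [hx.2]⟩
  simp only [hqe] at h
  rw [intervalIntegral.integral_comp_mul_add (fun y => p.eval y ^ 2) hd.ne' l,
    show (r - l) * ((x - l) / (r - l)) + l = x by field_simp; ring] at h
  simp only [mul_zero, zero_add, mul_one, sub_add_cancel, smul_eq_mul] at h
  calc p.eval x ^ 2 * (r - l) ≤ (|C| * ((r - l)⁻¹ * ∫ y in l..r, p.eval y ^ 2)) * (r - l) := by
        gcongr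
    _ = _ := by field_simp

/-- Variation of a `C¹` function on an interval. -/
theorem sq_sub_le_integral_deriv {f f' : ℝ → ℝ} (hf : ∀ x, HasDerivAt f (f' x) x)
    (hc : Continuous f') {l r x y : ℝ} (hx : x ∈ Icc l r) (hy : y ∈ Icc l r) :
    (f x - f y) ^ 2 ≤ (r - l) * ∫ z in l..r, f' z ^ 2 := by
  wlog hxy : y ≤ x generalizing x y
  · rw [← neg_sub, neg_sq]; exact this hy hx (le_of_not_ge hxy)
  have h0 : 0 ≤ ∫ z in y..x, f' z ^ 2 := intervalIntegral.integral_nonneg hxy fun _ _ => sq_nonneg _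
  rw [← intervalIntegral.integral_eq_sub_of_hasDerivAt (fun z _ => hf z) (hc.intervalIntegrable _ _)]
  calc _ ≤ _ := sq_integral_le hxy (hc.intervalIntegrable _ _) ((hc.pow 2).intervalIntegrable _ _)
    _ ≤ (r - l) * ∫ z in y..x, f' z ^ 2 := by gcongr; exacts [hx.2, hy.1]
    _ ≤ _ := by
      gcongr
      · linarith [hx.1, hx.2]
      · exact intervalIntegral.integral_mono_interval hy.1 hxy hx.2
          (.of_forall fun z => sq_nonneg _) ((hc.pow 2).intervalIntegrable _ _)

/-- Polynomial approximation on an interval. -/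
theorem exists_polynomial_approx (k : ℕ) {f : ℝ → ℝ} (hf : ContDiff ℝ (k + 1 : ℕ) f) {l r : ℝ}
    (hlr : l < r) : ∃ p : Polynomial ℝ, p.natDegree ≤ k ∧ ∀ x ∈ Icc l r,
      (f x - p.eval x) ^ 2 ≤
        (r - l) ^ (2 * k + 1) * ∫ y in l..r, iteratedDeriv (k + 1) f y ^ 2 := by
  induction k generalizing f with
  | zero =>
    refine ⟨Polynomial.C (f l), by simp, fun x hx => ?_⟩
    have h1 : ContDiff ℝ 1 f := by exact_mod_cast hf
    have hd : ∀ x, HasDerivAt f (deriv f x) x := fun x =>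
      (h1.differentiable one_ne_zero x).hasDerivAt
    have := sq_sub_le_integral_deriv hd (h1.continuous_deriv le_rfl) hx ⟨le_rfl, hlr.le⟩
    simpa [iteratedDeriv_one] using this
  | succ k ih =>
    have hd : ∀ x, HasDerivAt f (deriv f x) x := fun x =>
      (hf.differentiable (by norm_cast) x).hasDerivAt
    have hf' : ContDiff ℝ (k + 1 : ℕ) (deriv f) :=
      (contDiff_succ_iff_deriv.1 (by exact_mod_cast hf)).2.2
    obtain ⟨p, hp, hpe⟩ := ih hf'
    -- A primitive of the approximation of f'. Normalised to agree with f at l, its error is the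
    -- integral of the error for f', which gains a factor (r - l)² in the squared bound.
    obtain ⟨P, hP⟩ : ∃ P : Polynomial ℝ, P.derivative = p ∧ P.natDegree ≤ k + 1 := by
      refine ⟨∑ i ∈ Finset.range (k + 1), Polynomial.monomial (i + 1) (p.coeff i / (i + 1)), ?_,
        Polynomial.natDegree_sum_le_of_forall_le _ _ fun i hi =>
          (Polynomial.natDegree_monomial_le _).trans (Finset.mem_range.1 hi)⟩
      rw [Polynomial.derivative_sum]
      conv_rhs => rw [p.as_sum_range' (k + 1) (Nat.lt_succ_of_le hp)]
      refine Finset.sum_congr rfl fun i _ => ?_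
      have : (i : ℝ) + 1 ≠ 0 := by positivity
      rw [Polynomial.derivative_monomial]
      simp [this]
    refine ⟨P + Polynomial.C (f l - P.eval l), ?_, fun x hx => ?_⟩
    · rw [Polynomial.natDegree_add_C]; exact hP.2
    have h2 : ∀ z, HasDerivAt (fun z => f z - P.eval z) (deriv f z - p.eval z) z := fun z => by
      have := P.hasDerivAt z
      rw [hP.1] at this
      exact (hd z).sub this
    have hc : Continuous fun z => deriv f z - p.eval z := hf'.continuous.sub p.continuous
    have h3 := sq_sub_le_integral_deriv h2 hc hx ⟨le_rfl, hlr.le⟩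
    set D := ∫ y in l..r, iteratedDeriv (k + 1 + 1) f y ^ 2 with hD
    rw [← iteratedDeriv_succ'] at hpe
    have h4 : ∫ z in l..r, (deriv f z - p.eval z) ^ 2 ≤ ((r - l) ^ (2 * k + 1) * D) * (r - l) := by
      have := intervalIntegral.integral_mono_on hlr.le (μ := volume)
        ((hc.pow 2).intervalIntegrable l r) (intervalIntegrable_const (c := (r - l) ^ (2 * k + 1) * D)) hpe
      rw [intervalIntegral.integral_const, smul_eq_mul, mul_comm (r - l)] at this
      exact this
    have hpos := sub_pos.2 hlr
    calc _ = ((f x - P.eval x) - (f l - P.eval l)) ^ 2 := by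
          simp only [Polynomial.eval_add, Polynomial.eval_C]; ring
      _ ≤ _ := h3
      _ ≤ (r - l) * (((r - l) ^ (2 * k + 1) * D) * (r - l)) := by gcongr
      _ = _ := by ring

/-- Subtract any good approximation T of f: the polynomial π - T is the projection of f - T, hence
no larger in L², and the inverse estimate makes this bound pointwise. The constant 2C + 2 comes from
(x - y)² ≤ 2x² + 2y². -/
theorem exists_projection_const (k : ℕ) : ∃ K : ℝ, 0 ≤ K ∧ ∀ (l r : ℝ), l < r → ∀ (f : ℝ → ℝ),
    ContDiff ℝ (k + 1 : ℕ) f → ∀ π : Polynomial ℝ, π.natDegree ≤ k →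
    (∀ p : Polynomial ℝ, p.natDegree ≤ k → ∫ x in l..r, (π.eval x - f x) * p.eval x = 0) →
    ∀ x ∈ Icc l r, (π.eval x - f x) ^ 2 ≤
      K * (r - l) ^ (2 * k + 1) * ∫ y in l..r, iteratedDeriv (k + 1) f y ^ 2 := by
  obtain ⟨C, hC0, hC⟩ := exists_inverse_const k
  refine ⟨2 * C + 2, by positivity, fun l r hlr f hf π hπ horth x hx => ?_⟩
  obtain ⟨T, hT, hTf⟩ := exists_polynomial_approx k hf hlr
  set D := ∫ y in l..r, iteratedDeriv (k + 1) f y ^ 2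
  have hd : 0 < r - l := sub_pos.2 hlr
  set p := π - T with hp
  have hpd : p.natDegree ≤ k := (Polynomial.natDegree_sub_le _ _).trans (max_le hπ hT)
  have hcf : Continuous f := hf.continuous
  have hg : Continuous fun x => f x - T.eval x := hcf.sub T.continuous
  -- Orthogonality tested with p itself.
  have h1 : ∫ y in l..r, p.eval y ^ 2 = ∫ y in l..r, (f y - T.eval y) * p.eval y := by
    have h := horth p hpd
    have i1 : IntervalIntegrable (fun y => p.eval y ^ 2) volume l r :=
      (p.continuous.pow 2).intervalIntegrable _ _
    have i2 : IntervalIntegrable (fun y => (f y - T.eval y) * p.eval y) volume l r :=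
      (hg.mul p.continuous).intervalIntegrable _ _
    rw [← sub_eq_zero, ← h, ← intervalIntegral.integral_sub i1 i2]
    refine intervalIntegral.integral_congr fun y _ => ?_
    simp only [hp, Polynomial.eval_sub]
    ring
  have h2 : ∫ y in l..r, (f y - T.eval y) ^ 2 ≤ (r - l) * ((r - l) ^ (2 * k + 1) * D) := by
    have := intervalIntegral.integral_mono_on hlr.le (μ := volume)
      ((hg.pow 2).intervalIntegrable l r)
      (intervalIntegrable_const (c := (r - l) ^ (2 * k + 1) * D)) hTf
    rw [intervalIntegral.integral_const, smul_eq_mul] at this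
    exact this
  have h3 : ∫ y in l..r, p.eval y ^ 2 ≤ ∫ y in l..r, (f y - T.eval y) ^ 2 := by
    have h := sq_integral_mul_le hlr.le ((hg.pow 2).intervalIntegrable l r)
      ((p.continuous.pow 2).intervalIntegrable l r)
      ((hg.mul p.continuous).intervalIntegrable l r)
    change (∫ y in l..r, (f y - T.eval y) * p.eval y) ^ 2 ≤
      (∫ y in l..r, (f y - T.eval y) ^ 2) * ∫ y in l..r, p.eval y ^ 2 at h
    rw [← h1] at h
    have h0 : 0 ≤ ∫ y in l..r, p.eval y ^ 2 :=
      intervalIntegral.integral_nonneg hlr.le fun _ _ => sq_nonneg _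
    have h0' : 0 ≤ ∫ y in l..r, (f y - T.eval y) ^ 2 :=
      intervalIntegral.integral_nonneg hlr.le fun _ _ => sq_nonneg _
    rcases h0.eq_or_lt with h4 | h4
    · rw [← h4]; exact h0'
    · nlinarith
  have h5 := hC p hpd l r hlr x ⟨by linarith [hx.1], by linarith [hx.2]⟩
  have h6 : p.eval x ^ 2 ≤ C * ((r - l) ^ (2 * k + 1) * D) := by
    have : p.eval x ^ 2 * (r - l) ≤ C * ((r - l) ^ (2 * k + 1) * D) * (r - l) :=
      calc _ ≤ _ := h5
        _ ≤ C * ((r - l) * ((r - l) ^ (2 * k + 1) * D)) := by gcongr; exact h3.trans h2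
        _ = _ := by ring
    exact le_of_mul_le_mul_right this hd
  have h7 : π.eval x - f x = p.eval x - (f x - T.eval x) := by
    simp only [hp, Polynomial.eval_sub]; ring
  rw [h7]
  have h8 := hTf x hx
  nlinarith [sq_nonneg (p.eval x + (f x - T.eval x))]

namespace OrthoBasis

variable {a b : ℝ} {m : Mesh a b} {k : ℕ} {ι : Type} [Fintype ι] [DecidableEq ι]
  (φ : OrthoBasis m k ι)

/-- The projection error `P f - f`. -/
noncomputable def err (_φ : OrthoBasis m k ι) (f : ℝ → ℝ) (x : ℝ) : ℝ :=
  _φ.comb (_φ.coef f) x - f x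

theorem err_perBdd (hab : a < b) {f : ℝ → ℝ} (hf : PerBdd (b - a) f) :
    PerBdd (b - a) (φ.err f) := (φ.comb_perBdd hab _).sub hf

end OrthoBasis

/-- The projection error on a cell. -/
theorem exists_err_cell_const (k : ℕ) : ∃ K : ℝ, 0 ≤ K ∧ ∀ {a b : ℝ} (_ : a < b) {m : Mesh a b}
    {ι : Type} [Fintype ι] [DecidableEq ι] (φ : OrthoBasis m k ι) {f : ℝ → ℝ},
    Function.Periodic f (b - a) → ContDiff ℝ (k + 1 : ℕ) f → ∀ j, ∀ x ∈ m.cell j,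
      φ.err f x ^ 2 ≤ K * m.size ^ (2 * k + 1) *
        ∫ y in m.left j..m.right j, iteratedDeriv (k + 1) f y ^ 2 := by
  obtain ⟨K, hK0, hK⟩ := exists_projection_const k
  refine ⟨K, hK0, fun {a b} hab {m ι} _ _ φ {f} hp hf j x hx => ?_⟩
  have hPf : PerBdd (b - a) f := .of_continuous (sub_pos.2 hab) hp hf.continuous
  obtain ⟨π, hπ, hπe⟩ := (φ.comb_memVh (φ.coef f)).2 j
  have h := hK (m.left j) (m.right j) (m.left_lt_right j) f hf π hπ (fun p hp => by
    rw [← φ.integral_sub_mul_eval hab hPf j hp]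
    exact m.integral_cell_congr j fun y hy => by rw [hπe y hy]) x (Ioo_subset_Icc_self hx)
  rw [OrthoBasis.err, hπe x hx]
  refine h.trans ?_
  have h1 := m.length_le_size j
  have h2 := m.length_pos j
  rw [Mesh.length] at h1 h2
  have h3 : 0 ≤ ∫ y in m.left j..m.right j, iteratedDeriv (k + 1) f y ^ 2 :=
    intervalIntegral.integral_nonneg (m.left_lt_right j).le fun _ _ => sq_nonneg _
  gcongr

theorem Mesh.integral_sq_le {a b : ℝ} {m : Mesh a b} {f : ℝ → ℝ} (hf : PerBdd (b - a) f)
    (j : Fin m.N) {B : ℝ} (hB : ∀ x ∈ m.cell j, f x ^ 2 ≤ B) {x y : ℝ} (hxy : x ≤ y)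
    (hx : m.left j ≤ x) (hy : y ≤ m.right j) : ∫ z in x..y, f z ^ 2 ≤ (y - x) * B := by
  have := intervalIntegral.integral_mono_on_of_le_Ioo hxy (μ := volume)
    (hf.sq.intervalIntegrable x y) (intervalIntegrable_const (c := B))
    (fun z hz => hB z ⟨hx.trans_lt hz.1, hz.2.trans_le hy⟩)
  rwa [intervalIntegral.integral_const, smul_eq_mul] at this

theorem sum_integral_iteratedDeriv {a b : ℝ} (hab : a < b) (m : Mesh a b) {n : ℕ} {f : ℝ → ℝ}
    (hf : ContDiff ℝ n f) :
    ∑ j, ∫ y in m.left j..m.right j, iteratedDeriv n f y ^ 2 = hSeminorm a b n f ^ 2 := by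
  rw [hSeminorm, l2Norm_sq hab.le, m.sum_integral]
  exact fun x y => ((hf.continuous_iteratedDeriv n le_rfl).pow 2).intervalIntegrable _ _

/-- The projection error in `L²`. -/
theorem exists_err_const (k : ℕ) : ∃ K : ℝ, 0 ≤ K ∧ ∀ {a b : ℝ} (_ : a < b) {m : Mesh a b}
    {ι : Type} [Fintype ι] [DecidableEq ι] (φ : OrthoBasis m k ι) {f : ℝ → ℝ},
    Function.Periodic f (b - a) → ContDiff ℝ (k + 1 : ℕ) f →
      l2Norm a b (φ.err f) ≤ K * m.size ^ (k + 1) * hSeminorm a b (k + 1) f := by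
  obtain ⟨K, hK0, hK⟩ := exists_err_cell_const k
  refine ⟨Real.sqrt K, Real.sqrt_nonneg _, fun {a b} hab {m ι} _ _ φ {f} hp hf => ?_⟩
  have hPf : PerBdd (b - a) f := .of_continuous (sub_pos.2 hab) hp hf.continuous
  have hh := m.size_pos hab
  have hS0 : 0 ≤ hSeminorm a b (k + 1) f := l2Norm_nonneg _ _ _
  refine abs_le_of_sq_le_sq' ?_ (mul_nonneg (by positivity) hS0) |>.2
  rw [mul_pow, mul_pow, Real.sq_sqrt hK0, ← sum_integral_iteratedDeriv hab m hf, l2Norm_sq hab.le,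
    ← m.sum_integral (φ.err_perBdd hab hPf).sq.intervalIntegrable, Finset.mul_sum]
  refine Finset.sum_le_sum fun j _ => ?_
  refine (Mesh.integral_sq_le (φ.err_perBdd hab hPf) j (hK hab φ hp hf j)
    (m.left_lt_right j).le le_rfl le_rfl).trans ?_
  have h1 := m.length_le_size j
  have h3 : 0 ≤ ∫ y in m.left j..m.right j, iteratedDeriv (k + 1) f y ^ 2 :=
    intervalIntegral.integral_nonneg (m.left_lt_right j).le fun _ _ => sq_nonneg _
  calc _ ≤ m.size * (K * m.size ^ (2 * k + 1) *
        ∫ y in m.left j..m.right j, iteratedDeriv (k + 1) f y ^ 2) := by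
        gcongr; exact h1
    _ = _ := by ring

theorem l2Norm_sq_eq_sum {a b : ℝ} (hab : a < b) {m : Mesh a b} {v : ℝ → ℝ}
    (hv : PerBdd (b - a) v) {p : Fin m.N → Polynomial ℝ}
    (hp : ∀ j, ∀ x ∈ m.cell j, v x = (p j).eval x) :
    l2Norm a b v ^ 2 = ∑ j, ∫ x in m.left j..m.right j, (p j).eval x ^ 2 := by
  rw [l2Norm_sq hab.le, ← m.sum_integral hv.sq.intervalIntegrable]
  exact Finset.sum_congr rfl fun j _ => m.integral_cell_congr j fun x hx => by rw [hp j x hx]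

/-- Translations of the projection error, on regular meshes. -/
theorem exists_shiftBound_const (k : ℕ) {ν : ℝ} (hν : 0 < ν) : ∃ C : ℝ, 0 ≤ C ∧
    ∀ {a b : ℝ} (_ : a < b) {m : Mesh a b} (_ : m.IsRegular ν)
    {ι : Type} [Fintype ι] [DecidableEq ι] (φ : OrthoBasis m k ι) {f : ℝ → ℝ},
    Function.Periodic f (b - a) → ContDiff ℝ (k + 1 : ℕ) f →
      ShiftBound m k (φ.err f) (C * m.size ^ k * hSeminorm a b (k + 1) f) := by
  obtain ⟨K₁, hK₁0, hK₁⟩ := exists_err_cell_const k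
  obtain ⟨K₂, hK₂0, hK₂⟩ := exists_err_const k
  obtain ⟨C, hC0, hC⟩ := exists_inverse_const k
  -- The two summands are the constants of the regimes |σ| ≤ νh and |σ| > νh.
  refine ⟨Real.sqrt (4 * C * K₁ / ν) + 2 * K₂ / ν, by positivity,
    fun {a b} hab {m} hm {ι} _ _ φ {f} hp hf σ v hv => ?_⟩
  have hPf : PerBdd (b - a) f := .of_continuous (sub_pos.2 hab) hp hf.continuous
  have hη := φ.err_perBdd hab hPf
  have hvP := hv.perBdd hab
  set η := φ.err f with hηdef
  set h := m.size with hh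
  set S := hSeminorm a b (k + 1) f with hS
  have hS0 : 0 ≤ S := l2Norm_nonneg _ _ _
  have hv0 := l2Norm_nonneg a b v
  have hh0 : 0 < h := m.size_pos hab
  -- In the first regime |σ| is at most the length of every cell, so each boundary strip meets the
  -- interior of only one cell.
  rcases le_or_gt |σ| (ν * h) with hσ | hσ
  · choose p hpd hpe using hv.2
    set D : Fin m.N → ℝ := fun j => ∫ y in m.left j..m.right j, iteratedDeriv (k + 1) f y ^ 2
    have hD : ∑ j, D j = S ^ 2 := sum_integral_iteratedDeriv hab m hf
    have hD0 : ∀ j, 0 ≤ D j := fun j =>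
      intervalIntegral.integral_nonneg (m.left_lt_right j).le fun _ _ => sq_nonneg _
    set V : Fin m.N → ℝ := fun j => ∫ x in m.left j..m.right j, (p j).eval x ^ 2
    have hV : ∑ j, V j = l2Norm a b v ^ 2 := (l2Norm_sq_eq_sum hab hvP hpe).symm
    have hV0 : ∀ j, 0 ≤ V j := fun j =>
      intervalIntegral.integral_nonneg (m.left_lt_right j).le fun _ _ => sq_nonneg _
    have hlen : ∀ j, |σ| ≤ m.right j - m.left j := fun j => hσ.trans (hm j)
    -- Bound for the square of the j-th polynomial on its cell enlarged by |σ|: the inverse estimate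
    -- together with νh ≤ h_j.
    set β : Fin m.N → ℝ := fun j => C * V j / (ν * h)
    have hβ0 : ∀ j, 0 ≤ β j := fun j => div_nonneg (mul_nonneg hC0 (hV0 j)) (by positivity)
    have hβ : ∀ j, ∀ y ∈ Icc (m.left j - |σ|) (m.right j + |σ|),
        |(p j).eval y| ≤ Real.sqrt (β j) := by
      intro j y hy
      refine Real.abs_le_sqrt ?_
      have h1 := hC (p j) (hpd j) _ _ (m.left_lt_right j) y
        ⟨by linarith [hy.1, hlen j], by linarith [hy.2, hlen j]⟩
      rw [le_div_iff₀ (by positivity)]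
      refine le_trans ?_ h1
      gcongr
      exact hm j
    -- The mass of η² on the strip starting at y, of either orientation.
    set F : ℝ → ℝ := fun y => |∫ x in y..y + σ, η x ^ 2| with hF
    have hstrip : ∀ j, ∀ y ∈ Icc (m.left j) (m.right j),
        (∫ x in y..y + σ, η x * (p j).eval (x - σ)) ^ 2 ≤ β j * (|σ| * F y) := by
      intro j y hy
      have := sq_intervalIntegral_mul_le hη (g := fun x => (p j).eval (x - σ))
        ((p j).continuous.comp (continuous_sub_right σ)) (x := y) (y := y + σ)
        (B := Real.sqrt (β j)) (fun z hz => hβ j _ (by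
          have h1 := neg_abs_le σ
          have h2 := le_abs_self σ
          have h3 := abs_nonneg σ
          rcases le_total 0 σ with h0 | h0
          · rw [uIcc_of_le (by linarith)] at hz
            exact ⟨by linarith [hz.1, hy.1], by linarith [hz.2, hy.2]⟩
          · rw [uIcc_of_ge (by linarith)] at hz
            exact ⟨by linarith [hz.1, hy.1], by linarith [hz.2, hy.2]⟩))
      rw [Real.sq_sqrt (hβ0 j), add_sub_cancel_left, mul_assoc] at this
      exact this
    have hFper : F a = F b := by
      have hper : ∫ x in b..b + σ, η x ^ 2 = ∫ x in a..a + σ, η x ^ 2 := by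
        have h1 := intervalIntegral.integral_comp_add_right (a := a) (b := a + σ)
          (fun x => η x ^ 2) (b - a)
        rw [show a + (b - a) = b by ring, show a + σ + (b - a) = b + σ by ring] at h1
        rw [← h1]
        exact intervalIntegral.integral_congr fun x _ => hη.sq.periodic x
      simp only [hF, hper]
    have hFlr := m.sum_left_eq_sum_right F hFper
    set W := |σ| * (K₁ * h ^ (2 * k + 1) * S ^ 2) with hW
    have hFle : ∑ j, F (m.left j) ≤ W := by
      rw [hW, ← hD, Finset.mul_sum, Finset.mul_sum]
      -- For σ ≥ 0 the strip at a left node lies in the cell of that node. For σ ≤ 0 this is true at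
      -- right nodes instead, and periodicity makes the two sums equal.
      rcases le_total 0 σ with h0 | h0
      · refine Finset.sum_le_sum fun j _ => ?_
        have h1 : 0 ≤ ∫ x in m.left j..m.left j + σ, η x ^ 2 :=
          intervalIntegral.integral_nonneg (by linarith) fun _ _ => sq_nonneg _
        have h2 := Mesh.integral_sq_le hη j (hK₁ hab φ hp hf j)
          (x := m.left j) (y := m.left j + σ) (by linarith) le_rfl
          (by linarith [hlen j, le_abs_self σ])
        simp only [hF]
        rw [abs_of_nonneg h1, abs_of_nonneg h0]
        simpa using h2
      · rw [hFlr]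
        refine Finset.sum_le_sum fun j _ => ?_
        have h1 : 0 ≤ ∫ x in m.right j + σ..m.right j, η x ^ 2 :=
          intervalIntegral.integral_nonneg (by linarith) fun _ _ => sq_nonneg _
        have h2 := Mesh.integral_sq_le hη j (hK₁ hab φ hp hf j)
          (x := m.right j + σ) (y := m.right j) (by linarith)
          (by linarith [hlen j, neg_abs_le σ]) le_rfl
        simp only [hF]
        rw [intervalIntegral.integral_symm, abs_neg, abs_of_nonneg h1, abs_of_nonpos h0]
        simpa using h2
    have hF0 : ∀ y, 0 ≤ F y := fun y => abs_nonneg _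
    have e0 : ∫ x in a..b, (η (x + σ) - η x) * v x =
        (∑ j, ∫ x in m.right j..m.right j + σ, η x * (p j).eval (x - σ)) -
          ∑ j, ∫ x in m.left j..m.left j + σ, η x * (p j).eval (x - σ) := by
      rw [integral_shift_sub_mul m hη hvP hpe, ← Finset.sum_sub_distrib]
      refine Finset.sum_congr rfl fun j _ => ?_
      -- A translated polynomial keeps its degree, so the interior term is killed by orthogonality
      -- and only the strips survive.
      have hcd : ((p j).comp (Polynomial.X - Polynomial.C σ) - p j).natDegree ≤ k := by
        refine (Polynomial.natDegree_sub_le _ _).trans (max_le ?_ (hpd j))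
        refine Polynomial.natDegree_comp_le.trans ?_
        rw [Polynomial.natDegree_X_sub_C, mul_one]
        exact hpd j
      have h1 := φ.integral_sub_mul_eval hab hPf j hcd
      simp only [Polynomial.eval_sub, Polynomial.eval_comp, Polynomial.eval_X,
        Polynomial.eval_C] at h1
      rw [show (∫ x in m.left j..m.right j, η x * ((p j).eval (x - σ) - (p j).eval x)) = 0 from h1,
        zero_add]
    have hβs : ∑ j, β j = C * l2Norm a b v ^ 2 / (ν * h) := by
      simp only [β]
      rw [← Finset.sum_div, ← Finset.mul_sum, hV]
    have e1 := Finset.sum_sq_le_sum_mul_sum_of_sq_le_mul Finset.univ (fun j _ => hβ0 j)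
      (fun j _ => mul_nonneg (abs_nonneg σ) (hF0 _))
      (fun j _ => hstrip j (m.right j) ⟨(m.left_lt_right j).le, le_rfl⟩)
    have e2 := Finset.sum_sq_le_sum_mul_sum_of_sq_le_mul Finset.univ (fun j _ => hβ0 j)
      (fun j _ => mul_nonneg (abs_nonneg σ) (hF0 _))
      (fun j _ => hstrip j (m.left j) ⟨le_rfl, (m.left_lt_right j).le⟩)
    rw [← Finset.mul_sum, ← hFlr] at e1
    rw [← Finset.mul_sum] at e2
    have e3 : (∑ j, β j) * (|σ| * ∑ j, F (m.left j)) ≤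
        (C * l2Norm a b v ^ 2 / (ν * h)) * (|σ| * W) := by
      rw [hβs]
      gcongr
    rw [e0]
    set R := ∑ j, ∫ x in m.right j..m.right j + σ, η x * (p j).eval (x - σ)
    set Lf := ∑ j, ∫ x in m.left j..m.left j + σ, η x * (p j).eval (x - σ)
    have e4 : (R - Lf) ^ 2 ≤ (|σ| * (Real.sqrt (4 * C * K₁ / ν) * h ^ k * S) * l2Norm a b v) ^ 2 := by
      calc (R - Lf) ^ 2 ≤ 2 * R ^ 2 + 2 * Lf ^ 2 := by nlinarith [sq_nonneg (R + Lf)]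
        _ ≤ 4 * ((C * l2Norm a b v ^ 2 / (ν * h)) * (|σ| * W)) := by linarith
        _ = _ := by
          rw [mul_pow, mul_pow, mul_pow, mul_pow, Real.sq_sqrt (by positivity), hW]
          field_simp
          ring
    refine (abs_le_of_sq_le_sq e4 (by positivity)).trans ?_
    gcongr
    have : 0 ≤ 2 * K₂ / ν := by positivity
    linarith
  -- For large shifts no cancellation is needed: twice the norm of η is O(h^{k+1}), and one power of
  -- h is paid for by h < |σ|/ν.
  · have h1 := (((hη.translate σ).sub hη).abs_integral_mul_le hab.le hvP)
    have h2 := (hη.translate σ).l2Norm_sub_le hab.le hη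
    rw [hη.l2Norm_translate] at h2
    have h3 := hK₂ hab φ hp hf
    calc _ ≤ _ := h1
      _ ≤ (2 * (K₂ * h ^ (k + 1) * S)) * l2Norm a b v := by gcongr; linarith
      _ = (ν * h) * (2 * K₂ / ν * h ^ k * S) * l2Norm a b v := by field_simp; ring
      _ ≤ |σ| * ((Real.sqrt (4 * C * K₁ / ν) + 2 * K₂ / ν) * h ^ k * S) * l2Norm a b v := by
        gcongr
        have := Real.sqrt_nonneg (4 * C * K₁ / ν)
        linarith

/-! ### Uniform meshes and piecewise constants -/

theorem abs_integral_zero_eq_of_nonneg {f : ℝ → ℝ} (hf : ∀ x, 0 ≤ f x) (σ : ℝ) :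
    |∫ x in (0 : ℝ)..σ, f x| = ∫ x in uIoc 0 σ, f x := by
  rw [intervalIntegral.abs_intervalIntegral_eq,
    abs_of_nonneg (integral_nonneg fun x => hf x)]

namespace Mesh

variable {a b : ℝ} {m : Mesh a b}

theorem IsUniform.right_eq (hm : m.IsUniform) (j : Fin m.N) : m.right j = m.left j + m.size := by
  rw [← hm j, Mesh.length]; ring

/-- The second alternative is the last cell, whose successor is the first cell one period further.
-/
theorem exists_next (m : Mesh a b) (j : Fin m.N) :
    ∃ i, m.left i = m.right j ∨ m.left i = m.right j - (b - a) := by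
  by_cases h : (j : ℕ) + 1 < m.N
  · refine ⟨⟨j + 1, h⟩, Or.inl ?_⟩
    rw [left, right]
    congr 1
  · have hj : m.right j = b := by
      refine Eq.trans ?_ m.node_last
      rw [right]
      congr 1
      ext
      have := j.2
      simp only [Fin.val_succ, Fin.val_last]
      omega
    have h0 : 0 < m.N := j.pos
    refine ⟨⟨0, h0⟩, Or.inr ?_⟩
    rw [hj]
    refine Eq.trans ?_ (m.node_zero.trans (by ring))
    rw [left]
    congr 1

/-- A mesh with equal cells is invariant under translation by the cell length. -/
theorem IsUniform.exists_shift (hm : m.IsUniform) (j : Fin m.N) : ∃ (i : Fin m.N) (z : ℤ),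
    m.left i = m.left j + m.size + z * (b - a) ∧
      ∀ x ∈ m.cell j, x + m.size + z * (b - a) ∈ m.cell i := by
  obtain ⟨i, hi⟩ := m.exists_next j
  have key : ∀ z : ℤ, m.left i = m.left j + m.size + z * (b - a) →
      ∀ x ∈ m.cell j, x + m.size + z * (b - a) ∈ m.cell i := by
    intro z hz x hx
    have h1 := hm.right_eq i
    have h2 := hm.right_eq j
    exact ⟨by linarith [hx.1], by linarith [hx.2]⟩
  rcases hi with hi | hi
  · have : m.left i = m.left j + m.size + (0 : ℤ) * (b - a) := by
      rw [hi, hm.right_eq j]; simp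
    exact ⟨i, 0, this, key 0 this⟩
  · have : m.left i = m.left j + m.size + (-1 : ℤ) * (b - a) := by
      rw [hi, hm.right_eq j]; push_cast; ring
    exact ⟨i, -1, this, key (-1) this⟩

end Mesh

theorem Periodic.add_int {L : ℝ} {f : ℝ → ℝ} (hf : Function.Periodic f L) (z : ℤ) (x : ℝ) :
    f (x + z * L) = f x := (hf.int_mul z) x

/-- Sums of a periodic function over the translated left nodes of a uniform mesh. -/
theorem sum_left_add_le {a b : ℝ} (hab : a < b) {m : Mesh a b} (hm : m.IsUniform) {F : ℝ → ℝ}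
    (hF : Function.Periodic F (b - a)) {Z : Fin m.N → ℝ} (hZ : ∀ j, ∀ x ∈ m.cell j, F x ≤ Z j)
    {y : ℝ} (hy : ∀ z : ℤ, y ≠ z * m.size) : ∑ j, F (m.left j + y) ≤ ∑ j, Z j := by
  have hh := m.size_pos hab
  set S : ℝ → ℝ := fun y => ∑ j, F (m.left j + y) with hS
  -- By periodicity, replacing left nodes by right nodes does not change the sum; on a uniform mesh
  -- this is a translation of y by the mesh size. So y may be reduced to [0, h).
  have hper : Function.Periodic S m.size := by
    intro y
    have h1 := m.sum_left_eq_sum_right (fun x => F (x + y)) (by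
      rw [show b + y = a + y + (b - a) by ring, hF])
    simp only [hS]
    rw [h1]
    refine Finset.sum_congr rfl fun j _ => ?_
    rw [hm.right_eq j]
    congr 1
    ring
  set y₀ := y - ⌊y / m.size⌋ * m.size with hy₀d
  have hSy : S y = S y₀ := (hper.sub_int_mul_eq _).symm
  -- The bound `hZ` is available only in open cells; the excluded multiples of h are those for which
  -- the points would be nodes.
  have hne : y₀ ≠ 0 := fun h0 => hy ⌊y / m.size⌋ (sub_eq_zero.1 h0)
  have hy₀ : y₀ ∈ Ico 0 m.size := by
    have h1 := Int.floor_le (y / m.size)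
    have h2 := Int.lt_floor_add_one (y / m.size)
    rw [le_div_iff₀ hh] at h1
    rw [div_lt_iff₀ hh] at h2
    exact ⟨by linarith, by linarith⟩
  change S y ≤ _
  rw [hSy]
  refine Finset.sum_le_sum fun j _ => hZ j _ ⟨?_, ?_⟩
  · have := lt_of_le_of_ne hy₀.1 (Ne.symm hne)
    linarith
  · rw [hm.right_eq j]; linarith [hy₀.2]

/-- Translations of piecewise constant approximations, on uniform meshes. -/
theorem shiftBound_of_uniform {a b : ℝ} (hab : a < b) {m : Mesh a b} (hm : m.IsUniform)
    {η : ℝ → ℝ} (hη : PerBdd (b - a) η) {Z : Fin m.N → ℝ}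
    (hZ : ∀ j, ∀ x ∈ m.cell j, (η (x + m.size) - η x) ^ 2 ≤ Z j) {α : ℝ} (hα : 0 ≤ α)
    (hZα : ∑ j, Z j ≤ m.size * α ^ 2) : ShiftBound m 0 η α := by
  intro σ v hv
  have hh := m.size_pos hab
  have hvP := hv.perBdd hab
  choose p hpd hpe using hv.2
  have hpc : ∀ j, ∃ c : ℝ, p j = Polynomial.C c := fun j =>
    ⟨_, Polynomial.eq_C_of_natDegree_le_zero (hpd j)⟩
  choose c hc using hpc
  set ζ : ℝ → ℝ := fun x => η (x + m.size) - η x with hζ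
  have hζP : PerBdd (b - a) ζ := (hη.translate _).sub hη
  have hV : l2Norm a b v ^ 2 = ∑ j, m.size * c j ^ 2 := by
    rw [l2Norm_sq_eq_sum hab hvP hpe]
    refine Finset.sum_congr rfl fun j _ => ?_
    simp only [hc, Polynomial.eval_C]
    rw [intervalIntegral.integral_const, smul_eq_mul, hm.right_eq j, add_sub_cancel_left]
  -- For constants the interior term vanishes, and the strips at the two ends of a cell combine into
  -- the increment of η over one mesh step.
  have e0 : ∫ x in a..b, (η (x + σ) - η x) * v x =
      ∑ j, c j * ∫ x in (0 : ℝ)..σ, ζ (x + m.left j) := by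
    rw [integral_shift_sub_mul m hη hvP hpe]
    refine Finset.sum_congr rfl fun j _ => ?_
    simp only [hc, Polynomial.eval_C, sub_self, mul_zero, intervalIntegral.integral_zero, zero_add]
    rw [intervalIntegral.integral_mul_const, intervalIntegral.integral_mul_const, ← sub_mul,
      mul_comm]
    congr 1
    rw [intervalIntegral.integral_comp_add_right, zero_add, add_comm σ]
    simp only [hζ]
    rw [intervalIntegral.integral_sub ((hη.translate _).intervalIntegrable _ _)
      (hη.intervalIntegrable _ _), intervalIntegral.integral_comp_add_right, hm.right_eq j]
    congr 2
    ring
  have e1 : ∀ j, (∫ x in (0 : ℝ)..σ, ζ (x + m.left j)) ^ 2 ≤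
      |σ| * ∫ x in uIoc 0 σ, ζ (x + m.left j) ^ 2 := by
    intro j
    have := sq_intervalIntegral_mul_le (hζP.translate (m.left j)) (g := fun _ => 1)
      continuous_const (x := 0) (y := σ) (B := 1) (by simp)
    rw [abs_integral_zero_eq_of_nonneg fun x => sq_nonneg _] at this
    simpa using this
  have e2 : ∑ j, ∫ x in uIoc 0 σ, ζ (x + m.left j) ^ 2 ≤ |σ| * ∑ j, Z j := by
    have hint : ∀ j ∈ Finset.univ,
        IntegrableOn (fun x => ζ (x + m.left j) ^ 2) (uIoc 0 σ) volume := fun j _ =>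
      intervalIntegrable_iff.1 ((hζP.translate (m.left j)).sq.intervalIntegrable 0 σ)
    rw [← integral_finsetSum _ hint]
    have hvol : volume.real (uIoc 0 σ) = |σ| := by
      rw [uIoc, Real.volume_real_Ioc_of_le min_le_max, max_sub_min_eq_abs, sub_zero]
    -- Shifts that take nodes to nodes form a null set.
    have hcount : ∀ᵐ y : ℝ, ∀ z : ℤ, y ≠ z * m.size := by
      rw [ae_all_iff]
      intro z
      exact Measure.ae_ne volume _
    have hle : ∫ x in uIoc 0 σ, ∑ j, ζ (x + m.left j) ^ 2 ≤ ∫ _ in uIoc 0 σ, ∑ j, Z j := by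
      refine integral_mono_ae (integrable_finsetSum _ hint)
        (intervalIntegrable_iff.1 intervalIntegrable_const) ?_
      refine ae_restrict_of_ae (hcount.mono fun y hy => ?_)
      simpa only [add_comm y] using sum_left_add_le hab hm hζP.sq.periodic hZ hy
    rwa [setIntegral_const, hvol, smul_eq_mul] at hle
  have e3 : (∑ j, c j * ∫ x in (0 : ℝ)..σ, ζ (x + m.left j)) ^ 2 ≤
      (|σ| * α * l2Norm a b v) ^ 2 := by
    calc _ ≤ _ := Finset.sum_mul_sq_le_sq_mul_sq _ _ _
      _ ≤ (∑ j, c j ^ 2) * (|σ| * (|σ| * (m.size * α ^ 2))) := by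
        have : 0 ≤ ∑ j, c j ^ 2 := Finset.sum_nonneg fun _ _ => sq_nonneg _
        gcongr
        calc _ ≤ ∑ j, |σ| * ∫ x in uIoc 0 σ, ζ (x + m.left j) ^ 2 :=
              Finset.sum_le_sum fun j _ => e1 j
          _ = |σ| * ∑ j, ∫ x in uIoc 0 σ, ζ (x + m.left j) ^ 2 := by rw [Finset.mul_sum]
          _ ≤ |σ| * (|σ| * ∑ j, Z j) := by gcongr
          _ ≤ _ := by gcongr
      _ = _ := by
        rw [mul_pow, mul_pow, hV, ← Finset.mul_sum]
        ring
  rw [e0]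
  exact abs_le_of_sq_le_sq e3 (mul_nonneg (mul_nonneg (abs_nonneg _) hα) (l2Norm_nonneg _ _ _))

/-- Piecewise constant approximations that commute with one step of the mesh up to evaluation of
the increment of `f` somewhere in the cell. -/
theorem shiftBound_sub_of_uniform {a b : ℝ} (hab : a < b) {m : Mesh a b} (hm : m.IsUniform)
    {f P g' : ℝ → ℝ} (hf : PerBdd (b - a) f) (hP : PerBdd (b - a) P)
    (hg : ∀ x, HasDerivAt (fun x => f (x + m.size) - f x) (g' x) x) (hg' : Continuous g')
    (hPf : ∀ j, ∃ y ∈ Icc (m.left j) (m.right j), ∀ x ∈ m.cell j,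
      P (x + m.size) - P x = f (y + m.size) - f y) :
    ShiftBound m 0 (fun x => P x - f x) (l2Norm a b g') := by
  -- On a cell, the increment of P - f is a difference of two values of the increment of f, both
  -- taken in that closed cell. Its square is at most the cell length times the local integral of
  -- g'², and these sum to h‖g'‖².
  refine shiftBound_of_uniform hab hm (hP.sub hf)
    (Z := fun j => m.size * ∫ z in m.left j..m.right j, g' z ^ 2) (fun j x hx => ?_)
    (l2Norm_nonneg _ _ _) ?_
  · obtain ⟨y, hy, hPy⟩ := hPf j
    have h1 := sq_sub_le_integral_deriv hg hg' hy (Ioo_subset_Icc_self hx)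
    rw [← hPy x hx, hm.right_eq j, add_sub_cancel_left] at h1
    rw [hm.right_eq j]
    calc _ = _ := by ring
      _ ≤ _ := h1
  · have hint : ∀ x y, IntervalIntegrable (fun z => g' z ^ 2) volume x y := fun x y =>
      (hg'.pow 2).intervalIntegrable x y
    rw [← Finset.mul_sum, m.sum_integral hint, l2Norm_sq hab.le]

theorem MemVh.exists_const {a b : ℝ} {m : Mesh a b} {v : ℝ → ℝ} (hv : MemVh m 0 v)
    (j : Fin m.N) : ∃ c, ∀ x ∈ m.cell j, v x = c := by
  obtain ⟨p, hp, h⟩ := hv.2 j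
  rw [Polynomial.eq_C_of_natDegree_le_zero hp] at h
  exact ⟨_, fun x hx => by rw [h x hx, Polynomial.eval_C]⟩

/-- For k = 0 the projection takes cell averages. On a uniform mesh the increment of the averages
over one step is the average of the increment of f, and this average is attained at a point of the
cell. -/
theorem shiftBound_err_of_uniform {a b : ℝ} (hab : a < b) {m : Mesh a b} (hm : m.IsUniform)
    {ι : Type} [Fintype ι] [DecidableEq ι] (φ : OrthoBasis m 0 ι) {f g' : ℝ → ℝ}
    (hp : Function.Periodic f (b - a)) (hf : Continuous f)
    (hg : ∀ x, HasDerivAt (fun x => f (x + m.size) - f x) (g' x) x) (hg' : Continuous g') :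
    ShiftBound m 0 (φ.err f) (l2Norm a b g') := by
  have hh := m.size_pos hab
  have hfP : PerBdd (b - a) f := .of_continuous (sub_pos.2 hab) hp hf
  have hVh := φ.comb_memVh (φ.coef f)
  have havg : ∀ j, ∀ c, (∀ x ∈ m.cell j, φ.comb (φ.coef f) x = c) →
      m.size * c = ∫ x in m.left j..m.right j, f x := by
    intro j c hcj
    have h1 := φ.integral_sub_mul_eval hab hfP j (p := 1) (by simp)
    simp only [Polynomial.eval_one, mul_one] at h1
    rw [intervalIntegral.integral_sub ((hVh.perBdd hab).intervalIntegrable _ _)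
      (hfP.intervalIntegrable _ _), m.integral_cell_congr j hcj, intervalIntegral.integral_const,
      hm.right_eq j, add_sub_cancel_left, smul_eq_mul, sub_eq_zero] at h1
    rwa [hm.right_eq j]
  refine shiftBound_sub_of_uniform hab hm hfP (hVh.perBdd hab) hg hg' fun j => ?_
  obtain ⟨i, z, hiz, hsh⟩ := hm.exists_shift j
  obtain ⟨c, hc⟩ := hVh.exists_const j
  obtain ⟨d, hd⟩ := hVh.exists_const i
  have hcont : Continuous fun x => f (x + m.size) - f x := by fun_prop
  -- The mean value theorem for this primitive provides the point at which the average is attained.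
  set G : ℝ → ℝ := fun y => ∫ x in m.left j..y, (f (x + m.size) - f x) with hG
  have hGd : ∀ y, HasDerivAt G (f (y + m.size) - f y) y := fun y =>
    intervalIntegral.integral_hasDerivAt_right (hcont.intervalIntegrable _ _)
      (hcont.stronglyMeasurableAtFilter _ _) hcont.continuousAt
  obtain ⟨y, hy, hys⟩ := exists_hasDerivAt_eq_slope G _ (m.left_lt_right j)
    (fun y _ => (hGd y).continuousAt.continuousWithinAt) (fun y _ => hGd y)
  refine ⟨y, Ioo_subset_Icc_self hy, fun x hx => ?_⟩
  have e1 : φ.comb (φ.coef f) (x + m.size) = d := by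
    rw [← hd _ (hsh x hx), Periodic.add_int hVh.1]
  rw [e1, hc x hx, hys, hm.right_eq j, add_sub_cancel_left, eq_div_iff hh.ne', sub_mul,
    mul_comm d, mul_comm c, havg i d hd, havg j c hc]
  simp only [hG, intervalIntegral.integral_same, sub_zero]
  rw [intervalIntegral.integral_sub ((hfP.translate _).intervalIntegrable _ _)
    (hfP.intervalIntegrable _ _), hm.right_eq j]
  congr 1
  -- Adding z periods makes the shifted cell literally cell i, including the wrap-around at the end
  -- of the interval.
  have e2 : ∀ x, f (x + m.size) = f (x + (m.size + z * (b - a))) := fun x => by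
    rw [← add_assoc, Periodic.add_int hp]
  simp only [e2]
  rw [intervalIntegral.integral_comp_add_right, hm.right_eq i, hiz]
  congr 1 <;> ring

/-! ### Grönwall's inequality and the abstract energy estimate -/

/-- The function e^{-κt}E(t) - βt is nonincreasing. Derivatives are needed only in the open
interval, with continuity up to its ends. -/
theorem le_exp_mul_of_hasDerivAt {T β κ : ℝ} (hβ : 0 ≤ β) (hκ : 0 ≤ κ) {E E' : ℝ → ℝ}
    (hc : ContinuousOn E (Icc 0 T)) (hd : ∀ t ∈ Ioo 0 T, HasDerivAt E (E' t) t)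
    (hE : ∀ t ∈ Ioo 0 T, E' t ≤ κ * E t + β) (hE0 : 0 ≤ E 0) :
    ∀ t ∈ Icc 0 T, E t ≤ Real.exp (κ * T) * (E 0 + β * T) := by
  intro t ht
  have hT : 0 ≤ T := ht.1.trans ht.2
  set G : ℝ → ℝ := fun t => Real.exp (-(κ * t)) * E t - β * t with hG
  have hGd : ∀ t ∈ Ioo 0 T, HasDerivAt G
      ((Real.exp (-(κ * t)) * (-κ)) * E t + Real.exp (-(κ * t)) * E' t - β) t := by
    intro t ht
    have h1 : HasDerivAt (fun t => Real.exp (-(κ * t))) (Real.exp (-(κ * t)) * (-κ)) t := by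
      have := ((hasDerivAt_id t).const_mul κ).neg.exp
      simpa using this
    have h2 : HasDerivAt (fun t => β * t) β t := by simpa using (hasDerivAt_id t).const_mul β
    exact (h1.mul (hd t ht)).sub h2
  have hanti : AntitoneOn G (Icc 0 T) := by
    refine antitoneOn_of_deriv_nonpos (convex_Icc _ _) ?_ ?_ ?_
    · exact (((by fun_prop : Continuous fun t : ℝ => Real.exp (-(κ * t))).continuousOn).mul hc).sub
        (by fun_prop)
    · rw [interior_Icc]
      exact fun t ht => (hGd t ht).differentiableAt.differentiableWithinAt
    · rw [interior_Icc]
      intro t ht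
      rw [(hGd t ht).deriv]
      have h1 := hE t ht
      have h2 := Real.exp_pos (-(κ * t))
      have h3 : Real.exp (-(κ * t)) ≤ 1 := Real.exp_le_one_iff.2 (by
        have := mul_nonneg hκ ht.1.le
        linarith)
      nlinarith
  have h1 := hanti ⟨le_rfl, hT⟩ ht ht.1
  simp only [hG, mul_zero, neg_zero, Real.exp_zero, one_mul, sub_zero] at h1
  have h2 : Real.exp (κ * t) * Real.exp (-(κ * t)) = 1 := by rw [← Real.exp_add]; simp
  have h3 := Real.exp_pos (κ * t)
  calc E t = Real.exp (κ * t) * (Real.exp (-(κ * t)) * E t) := by rw [← mul_assoc, h2, one_mul]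
    _ ≤ Real.exp (κ * t) * (E 0 + β * t) := by gcongr; linarith
    _ ≤ _ := by
      have := mul_nonneg hβ ht.1
      have := ht.2
      gcongr

theorem intervalIntegrable_weight_mul {δ B : ℝ} {ω g : ℝ → ℝ} (hδ : 0 ≤ δ)
    (hω : IntervalIntegrable ω volume 0 δ)
    (hm : AEStronglyMeasurable g (volume.restrict (Ioc 0 δ))) (hB : ∀ s ∈ Ioc 0 δ, |g s| ≤ B) :
    IntervalIntegrable (fun s => ω s * g s) volume 0 δ := by
  have hωm : AEStronglyMeasurable ω (volume.restrict (Ioc 0 δ)) := by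
    rw [intervalIntegrable_iff_integrableOn_Ioc_of_le hδ] at hω; exact hω.aestronglyMeasurable
  refine (hω.abs.mul_const |B|).mono_fun ?_ ?_
  · rw [uIoc_of_le hδ]; exact hωm.mul hm
  · rw [uIoc_of_le hδ]
    refine (ae_restrict_iff' measurableSet_Ioc).2 (.of_forall fun s hs => ?_)
    simp only [norm_mul, Real.norm_eq_abs, abs_abs]
    exact mul_le_mul_of_nonneg_left ((hB s hs).trans (le_abs_self B)) (abs_nonneg _)

/-- Differentiation under a weighted integral. -/
theorem hasDerivAt_integral_weight {T δ B : ℝ} {ω : ℝ → ℝ} (hδ : 0 ≤ δ)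
    (hω : IntervalIntegrable ω volume 0 δ) {g g' : ℝ → ℝ → ℝ}
    (hm : ∀ t ∈ Icc 0 T, AEStronglyMeasurable (fun s => g s t) (volume.restrict (Ioc 0 δ)))
    (hm' : ∀ t ∈ Icc 0 T, AEStronglyMeasurable (fun s => g' s t) (volume.restrict (Ioc 0 δ)))
    (hB : ∀ s ∈ Ioc 0 δ, ∀ t ∈ Icc 0 T, |g s t| ≤ B)
    (hB' : ∀ s ∈ Ioc 0 δ, ∀ t ∈ Icc 0 T, |g' s t| ≤ B)
    (hd : ∀ s ∈ Ioc 0 δ, ∀ t ∈ Ioo 0 T, HasDerivAt (g s) (g' s t) t) :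
    ∀ t ∈ Ioo 0 T, HasDerivAt (fun t => ∫ s in (0 : ℝ)..δ, ω s * g s t)
      (∫ s in (0 : ℝ)..δ, ω s * g' s t) t := by
  intro t ht
  have hωm : AEStronglyMeasurable ω (volume.restrict (Ioc 0 δ)) := by
    rw [intervalIntegrable_iff_integrableOn_Ioc_of_le hδ] at hω; exact hω.aestronglyMeasurable
  refine (intervalIntegral.hasDerivAt_integral_of_dominated_loc_of_deriv_le (μ := volume)
    (F := fun t s => ω s * g s t) (F' := fun t s => ω s * g' s t)
    (bound := fun s => |ω s| * B) (Ioo_mem_nhds ht.1 ht.2) ?_ ?_ ?_ ?_ ?_ ?_).2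
  · filter_upwards [Ioo_mem_nhds ht.1 ht.2] with τ hτ
    rw [uIoc_of_le hδ]
    exact hωm.mul (hm τ (Ioo_subset_Icc_self hτ))
  · exact intervalIntegrable_weight_mul hδ hω (hm t (Ioo_subset_Icc_self ht))
      fun s hs => hB s hs t (Ioo_subset_Icc_self ht)
  · rw [uIoc_of_le hδ]; exact hωm.mul (hm' t (Ioo_subset_Icc_self ht))
  · rw [uIoc_of_le hδ]
    refine .of_forall fun s hs τ hτ => ?_
    rw [norm_mul, Real.norm_eq_abs, Real.norm_eq_abs]
    exact mul_le_mul_of_nonneg_left (hB' s hs τ (Ioo_subset_Icc_self hτ)) (abs_nonneg _)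
  · exact hω.abs.mul_const B
  · rw [uIoc_of_le hδ]
    exact .of_forall fun s hs τ hτ => (hd s hs τ hτ).const_mul _

theorem continuousOn_integral_weight {T δ B : ℝ} {ω : ℝ → ℝ} (hδ : 0 ≤ δ)
    (hω : IntervalIntegrable ω volume 0 δ) {g : ℝ → ℝ → ℝ}
    (hm : ∀ t ∈ Icc 0 T, AEStronglyMeasurable (fun s => g s t) (volume.restrict (Ioc 0 δ)))
    (hB : ∀ s ∈ Ioc 0 δ, ∀ t ∈ Icc 0 T, |g s t| ≤ B)
    (hc : ∀ s ∈ Ioc 0 δ, ContinuousOn (g s) (Icc 0 T)) :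
    ContinuousOn (fun t => ∫ s in (0 : ℝ)..δ, ω s * g s t) (Icc 0 T) := by
  intro t ht
  have hωm : AEStronglyMeasurable ω (volume.restrict (Ioc 0 δ)) := by
    rw [intervalIntegrable_iff_integrableOn_Ioc_of_le hδ] at hω; exact hω.aestronglyMeasurable
  refine intervalIntegral.continuousWithinAt_of_dominated_interval (bound := fun s => |ω s| * B)
    ?_ ?_ (hω.abs.mul_const B) ?_
  · filter_upwards [self_mem_nhdsWithin] with τ hτ
    rw [uIoc_of_le hδ]
    exact hωm.mul (hm τ hτ)
  · filter_upwards [self_mem_nhdsWithin] with τ hτ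
    rw [uIoc_of_le hδ]
    refine .of_forall fun s hs => ?_
    rw [norm_mul, Real.norm_eq_abs, Real.norm_eq_abs]
    exact mul_le_mul_of_nonneg_left (hB s hs τ hτ) (abs_nonneg _)
  · rw [uIoc_of_le hδ]
    exact .of_forall fun s hs => (hc s hs t ht).const_mul _

/-- Energy estimate for `E = ½Y + ½X + ∫ ω Z`, in the form shared by the continuous and the
semi-discrete problem. -/
theorem energy_estimate {T δ M α ρ B : ℝ} {ω : ℝ → ℝ} (hδ : 0 ≤ δ)
    (hω : IntervalIntegrable ω volume 0 δ) (hω0 : ∀ s, 0 ≤ ω s)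
    (hωM : 2 * ∫ s in (0 : ℝ)..δ, ω s ≤ M)
    {Y Y' X X' : ℝ → ℝ} {Z Z' : ℝ → ℝ → ℝ}
    (hY0 : ∀ t, 0 ≤ Y t) (hX0 : ∀ t, 0 ≤ X t) (hZ0 : ∀ s t, 0 ≤ Z s t)
    (hYc : ContinuousOn Y (Icc 0 T)) (hXc : ContinuousOn X (Icc 0 T))
    (hZc : ∀ s ∈ Ioc 0 δ, ContinuousOn (Z s) (Icc 0 T))
    (hYd : ∀ t ∈ Ioo 0 T, HasDerivAt Y (Y' t) t) (hXd : ∀ t ∈ Ioo 0 T, HasDerivAt X (X' t) t)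
    (hZd : ∀ s ∈ Ioc 0 δ, ∀ t ∈ Ioo 0 T, HasDerivAt (Z s) (Z' s t) t)
    (hZm : ∀ t ∈ Icc 0 T, AEStronglyMeasurable (fun s => Z s t) (volume.restrict (Ioc 0 δ)))
    (hZm' : ∀ t ∈ Icc 0 T, AEStronglyMeasurable (fun s => Z' s t) (volume.restrict (Ioc 0 δ)))
    (hZB : ∀ s ∈ Ioc 0 δ, ∀ t ∈ Icc 0 T, |Z s t| ≤ B)
    (hZB' : ∀ s ∈ Ioc 0 δ, ∀ t ∈ Icc 0 T, |Z' s t| ≤ B)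
    (hY : ∀ t ∈ Ioo 0 T, Y' t ≤ Y t + X t)
    (hXZ : ∀ t ∈ Ioo 0 T, ∃ p : ℝ → ℝ, IntervalIntegrable (fun s => ω s * p s) volume 0 δ ∧
      X' t / 2 ≤ 2 * (∫ s in (0 : ℝ)..δ, ω s * p s) + ρ * Real.sqrt (X t) ∧
      ∀ s ∈ Ioc 0 δ, p s + Z' s t / 2 ≤ α * Real.sqrt (X t) + α * Real.sqrt (Z s t))
    (hα : 0 ≤ α) :
    ∀ t ∈ Icc 0 T, Y t / 2 + X t / 2 + ∫ s in (0 : ℝ)..δ, ω s * Z s t ≤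
      Real.exp (3 * T) * (Y 0 / 2 + X 0 / 2 + (∫ s in (0 : ℝ)..δ, ω s * Z s 0) +
        (ρ ^ 2 + α ^ 2 * (M ^ 2 + M)) / 2 * T) := by
  have hM : 0 ≤ M := le_trans (mul_nonneg zero_le_two
    (intervalIntegral.integral_nonneg hδ fun s _ => hω0 s)) hωM
  have hint : ∀ t ∈ Icc 0 T, IntervalIntegrable (fun s => ω s * Z s t) volume 0 δ := fun t ht =>
    intervalIntegrable_weight_mul hδ hω (hZm t ht) fun s hs => hZB s hs t ht
  have hint' : ∀ t ∈ Icc 0 T, IntervalIntegrable (fun s => ω s * Z' s t) volume 0 δ := fun t ht =>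
    intervalIntegrable_weight_mul hδ hω (hZm' t ht) fun s hs => hZB' s hs t ht
  -- The rate 3: the term X/2 arises once from Y'/2 and once from each of the Young inequalities for
  -- ρ√X and αM√X. The leftover squares form the forcing constant.
  refine le_exp_mul_of_hasDerivAt (E' := fun t => Y' t / 2 + X' t / 2 +
    ∫ s in (0 : ℝ)..δ, ω s * Z' s t) (by positivity) (by norm_num) ?_ ?_ ?_ ?_
  · exact ((hYc.div_const 2).add (hXc.div_const 2)).add (continuousOn_integral_weight hδ hω hZm hZB hZc)
  · intro t ht
    exact (((hYd t ht).div_const 2).add ((hXd t ht).div_const 2)).add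
      (hasDerivAt_integral_weight hδ hω hZm hZm' hZB hZB' hZd t ht)
  · intro t ht
    have ht' := Ioo_subset_Icc_self ht
    obtain ⟨p, hp, hXp, hpZ⟩ := hXZ t ht
    have h1 := hY t ht
    have hsX := Real.sq_sqrt (hX0 t)
    set r := Real.sqrt (X t) with hr
    have hr0 : 0 ≤ r := Real.sqrt_nonneg _
    -- The part of X' driven by p is combined with Z' for each fixed s, before integration, since
    -- only the sum is small. The term 2α√Z is split into α² + Z.
    have h2 : 2 * (∫ s in (0 : ℝ)..δ, ω s * p s) + ∫ s in (0 : ℝ)..δ, ω s * Z' s t ≤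
        (2 * (α * r) + α ^ 2) * (∫ s in (0 : ℝ)..δ, ω s) + ∫ s in (0 : ℝ)..δ, ω s * Z s t := by
      rw [← intervalIntegral.integral_const_mul, ← intervalIntegral.integral_const_mul,
        ← intervalIntegral.integral_add (hp.const_mul 2) (hint' t ht'),
        ← intervalIntegral.integral_add (hω.const_mul _) (hint t ht')]
      refine intervalIntegral.integral_mono_on_of_le_Ioo hδ
        ((hp.const_mul 2).add (hint' t ht')) ((hω.const_mul _).add (hint t ht')) fun s hs => ?_
      have h3 := hpZ s ⟨hs.1, hs.2.le⟩
      have h4 := Real.sq_sqrt (hZ0 s t)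
      have h5 : 2 * p s + Z' s t ≤ 2 * (α * r) + α ^ 2 + Z s t := by
        nlinarith [sq_nonneg (α - Real.sqrt (Z s t))]
      have h6 := mul_le_mul_of_nonneg_left h5 (hω0 s)
      linarith
    have h7 : (2 * (α * r) + α ^ 2) * (∫ s in (0 : ℝ)..δ, ω s) ≤
        (2 * (α * r) + α ^ 2) * (M / 2) := by
      gcongr
      linarith
    have h8 : 0 ≤ ∫ s in (0 : ℝ)..δ, ω s * Z s t :=
      intervalIntegral.integral_nonneg hδ fun s _ => mul_nonneg (hω0 s) (hZ0 s t)
    have h9 := hY0 t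
    have h10 := hX0 t
    have h11 : ρ * r ≤ ρ ^ 2 / 2 + X t / 2 := by nlinarith [sq_nonneg (ρ - r)]
    have h12 : α * r * M ≤ α ^ 2 * M ^ 2 / 2 + X t / 2 := by nlinarith [sq_nonneg (α * M - r)]
    nlinarith
  · have := hY0 0
    have := hX0 0
    have h8 : 0 ≤ ∫ s in (0 : ℝ)..δ, ω s * Z s 0 :=
      intervalIntegral.integral_nonneg hδ fun s _ => mul_nonneg (hω0 s) (hZ0 s 0)
    positivity

/-! ### Time derivatives of integrals in space -/

theorem IsSmoothOfOrder.exists_bound_on {T : ℝ} {n : ℕ} {f : ℝ → ℝ → ℝ}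
    (hf : IsSmoothOfOrder T n f) (a b : ℝ) :
    ∃ B, 0 ≤ B ∧ ∀ x ∈ Icc a b, ∀ t ∈ Icc 0 T, |f x t| ≤ B := by
  have hc : IsCompact (Icc a b ×ˢ Icc 0 T : Set (ℝ × ℝ)) := isCompact_Icc.prod isCompact_Icc
  obtain ⟨B, hB⟩ := hc.exists_bound_of_continuousOn
    (hf.continuousOn.mono (prod_mono (subset_univ _) le_rfl))
  exact ⟨max B 0, le_max_right _ _, fun x hx t ht => (hB (x, t) ⟨hx, ht⟩).trans (le_max_left _ _)⟩

theorem IsSmoothOfOrder.continuousOn_time {T : ℝ} {n : ℕ} {f : ℝ → ℝ → ℝ}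
    (hf : IsSmoothOfOrder T n f) (x : ℝ) : ContinuousOn (fun t => f x t) (Icc 0 T) :=
  hf.continuousOn.comp (f := fun t : ℝ => (x, t)) (by fun_prop) fun t ht => ⟨mem_univ _, ht⟩

theorem continuousOn_integral_mul {T a b : ℝ} {n : ℕ} (hab : a ≤ b) {f : ℝ → ℝ → ℝ}
    (hf : IsSmoothOfOrder T n f) {w : ℝ → ℝ} (hw : IntervalIntegrable w volume a b) :
    ContinuousOn (fun t => ∫ x in a..b, f x t * w x) (Icc 0 T) := by
  intro t ht
  obtain ⟨B, hB0, hB⟩ := hf.exists_bound_on a b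
  have hwm : AEStronglyMeasurable w (volume.restrict (uIoc a b)) :=
    (intervalIntegrable_iff.1 hw).aestronglyMeasurable
  refine intervalIntegral.continuousWithinAt_of_dominated_interval (bound := fun x => B * |w x|)
    ?_ ?_ (hw.abs.const_mul B) ?_
  · filter_upwards [self_mem_nhdsWithin] with τ hτ
    exact (hf.continuous_slice hτ).aestronglyMeasurable.mul hwm
  · filter_upwards [self_mem_nhdsWithin] with τ hτ
    refine .of_forall fun x hx => ?_
    rw [uIoc_of_le hab] at hx
    rw [norm_mul, Real.norm_eq_abs, Real.norm_eq_abs]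
    exact mul_le_mul_of_nonneg_right (hB x (Ioc_subset_Icc_self hx) τ hτ) (abs_nonneg _)
  · exact .of_forall fun x _ => ((hf.continuousOn_time x) t ht).mul_const _

theorem hasDerivAt_integral_mul {T a b : ℝ} {n : ℕ} (hT : 0 < T) (hab : a ≤ b) {f : ℝ → ℝ → ℝ}
    (hf : IsSmoothOfOrder T (n + 1) f) {w : ℝ → ℝ} (hw : IntervalIntegrable w volume a b) {t : ℝ}
    (ht : t ∈ Ioo 0 T) :
    HasDerivAt (fun t => ∫ x in a..b, f x t * w x) (∫ x in a..b, timeDeriv T f x t * w x) t := by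
  obtain ⟨B, hB0, hB⟩ := (hf.time hT).exists_bound_on a b
  have hwm : AEStronglyMeasurable w (volume.restrict (uIoc a b)) :=
    (intervalIntegrable_iff.1 hw).aestronglyMeasurable
  have ht' := Ioo_subset_Icc_self ht
  refine (intervalIntegral.hasDerivAt_integral_of_dominated_loc_of_deriv_le (μ := volume)
    (F := fun t x => f x t * w x) (F' := fun t x => timeDeriv T f x t * w x)
    (bound := fun x => B * |w x|) (Ioo_mem_nhds ht.1 ht.2) ?_ ?_ ?_ ?_ ?_ ?_).2
  · filter_upwards [Ioo_mem_nhds ht.1 ht.2] with τ hτ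
    exact (hf.continuous_slice (Ioo_subset_Icc_self hτ)).aestronglyMeasurable.mul hwm
  · simpa only [mul_comm] using hw.mul_continuousOn (hf.continuous_slice ht').continuousOn
  · exact ((hf.time hT).continuous_slice ht').aestronglyMeasurable.mul hwm
  · refine .of_forall fun x hx τ hτ => ?_
    rw [uIoc_of_le hab] at hx
    rw [norm_mul, Real.norm_eq_abs, Real.norm_eq_abs]
    exact mul_le_mul_of_nonneg_right (hB x (Ioc_subset_Icc_self hx) τ (Ioo_subset_Icc_self hτ))
      (abs_nonneg _)
  · exact hw.abs.const_mul B
  · refine .of_forall fun x _ τ hτ => ?_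
    exact ((hf.hasDerivWithinAt_time hT n.succ_ne_zero x (Ioo_subset_Icc_self hτ)).hasDerivAt
      (Icc_mem_nhds hτ.1 hτ.2)).mul_const _

theorem measurable_integral_shift_mul {g w : ℝ → ℝ} (hg : Measurable g) (hw : Measurable w)
    {a b : ℝ} (hab : a ≤ b) : Measurable fun s => ∫ x in a..b, g (x + s) * w x := by
  simp only [intervalIntegral.integral_of_le hab]
  have h : StronglyMeasurable (Function.uncurry fun s x => g (x + s) * w x) :=
    ((hg.comp (measurable_snd.add measurable_fst)).mul (hw.comp measurable_snd)).stronglyMeasurable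
  exact (h.integral_prod_right (ν := volume.restrict (Ioc a b))).measurable

/-! ### Difference quotients and their matrices on V_h^k -/

/-- The difference quotient `(f(x+s) - f(x)) / s`. -/
noncomputable def diffQuot (s : ℝ) (f : ℝ → ℝ) (x : ℝ) : ℝ := (f (x + s) - f x) / s

theorem PerBdd.diffQuot {L : ℝ} {f : ℝ → ℝ} (hf : PerBdd L f) (s : ℝ) :
    PerBdd L (diffQuot s f) := ((hf.translate s).sub hf).div_const s

/-- Summation by parts: translating the product f(x)w(x-s) by s does not change its integral over a
period. -/
theorem integral_diffQuot_mul {a b : ℝ} {f w : ℝ → ℝ} (hf : PerBdd (b - a) f)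
    (hw : PerBdd (b - a) w) (s : ℝ) :
    ∫ x in a..b, diffQuot s f x * w x = -∫ x in a..b, f x * diffQuot (-s) w x := by
  have h1 := (hf.mul (hw.translate (-s))).integral_translate s
  simp only [add_neg_cancel_right] at h1
  have i1 := ((hf.translate s).mul hw).intervalIntegrable a b
  have i2 := (hf.mul hw).intervalIntegrable a b
  have i3 := (hf.mul (hw.translate (-s))).intervalIntegrable a b
  have e1 : ∫ x in a..b, diffQuot s f x * w x =
      s⁻¹ * ((∫ x in a..b, f (x + s) * w x) - ∫ x in a..b, f x * w x) := by
    rw [← intervalIntegral.integral_sub i1 i2, ← intervalIntegral.integral_const_mul]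
    exact intervalIntegral.integral_congr fun x _ => by simp only [diffQuot]; ring
  have e2 : ∫ x in a..b, f x * diffQuot (-s) w x =
      -s⁻¹ * ((∫ x in a..b, f x * w (x + -s)) - ∫ x in a..b, f x * w x) := by
    rw [← intervalIntegral.integral_sub i3 i2, ← intervalIntegral.integral_const_mul]
    exact intervalIntegral.integral_congr fun x _ => by
      simp only [diffQuot]; rw [div_neg, div_eq_mul_inv]; ring
  rw [e1, e2, h1]
  ring

theorem diffQuot_congr_ae {f g : ℝ → ℝ} (h : f =ᵐ[volume] g) (s : ℝ) :
    diffQuot s f =ᵐ[volume] diffQuot s g := by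
  filter_upwards [h, ae_translate h s] with x h1 h2
  simp only [diffQuot, h1, h2]

theorem abs_integral_diffQuot_mul_le {a b : ℝ} {f w : ℝ → ℝ} {s α : ℝ}
    (h : |∫ x in a..b, (f (x + s) - f x) * w x| ≤ |s| * α) (hs : s ≠ 0) :
    |∫ x in a..b, diffQuot s f x * w x| ≤ α := by
  have e : ∫ x in a..b, diffQuot s f x * w x = s⁻¹ * ∫ x in a..b, (f (x + s) - f x) * w x := by
    rw [← intervalIntegral.integral_const_mul]
    exact intervalIntegral.integral_congr fun x _ => by simp only [diffQuot]; ring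
  rw [e, abs_mul, abs_inv]
  have := abs_pos.2 hs
  rw [inv_mul_le_iff₀ this]
  exact h

theorem ShiftBound.abs_integral_diffQuot_le {a b : ℝ} {m : Mesh a b} {k : ℕ} {η : ℝ → ℝ} {α : ℝ}
    (h : ShiftBound m k η α) {v : ℝ → ℝ} (hv : MemVh m k v) {s : ℝ} (hs : s ≠ 0) :
    |∫ x in a..b, diffQuot s η x * v x| ≤ α * l2Norm a b v :=
  abs_integral_diffQuot_mul_le (by rw [← mul_assoc]; exact h s v hv) hs

namespace OrthoBasis

variable {a b : ℝ} {m : Mesh a b} {k : ℕ} {ι : Type} [Fintype ι] [DecidableEq ι]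
  (φ : OrthoBasis m k ι)

/-- The matrix of the difference quotient on `V_h^k`. -/
noncomputable def stiff (_φ : OrthoBasis m k ι) (s : ℝ) (i j : ι) : ℝ :=
  _φ.coef (diffQuot s (_φ.fn i)) j

theorem diffQuot_comb (c : ι → ℝ) (s x : ℝ) :
    diffQuot s (φ.comb c) x = ∑ i, c i * diffQuot s (φ.fn i) x := by
  simp only [diffQuot, comb, ← Finset.sum_sub_distrib, Finset.sum_div]
  exact Finset.sum_congr rfl fun i _ => by ring

theorem coef_diffQuot_comb (hab : a < b) (c : ι → ℝ) (s : ℝ) (j : ι) :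
    φ.coef (diffQuot s (φ.comb c)) j = ∑ i, c i * φ.stiff s i j := by
  simp only [coef, stiff, φ.diffQuot_comb c s, Finset.sum_mul]
  rw [intervalIntegral.integral_finsetSum fun i _ =>
    ((((φ.perBdd hab i).diffQuot s).const_mul (c i)).mul (φ.perBdd hab j)).intervalIntegrable _ _]
  refine Finset.sum_congr rfl fun i _ => ?_
  rw [← intervalIntegral.integral_const_mul]
  exact intervalIntegral.integral_congr fun x _ => by ring

/-- Measurability in s comes from joint measurability in (s,x), for which a.e. classes are not
enough; this is why `OrthoBasis` carries Borel functions. -/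
theorem measurable_coef_diffQuot (hab : a < b) {f : ℝ → ℝ} (hf : PerBdd (b - a) f)
    (hfm : Measurable f) (j : ι) : Measurable fun s => φ.coef (diffQuot s f) j := by
  have h := measurable_integral_shift_mul hfm (φ.measurable j) hab.le
  have e : (fun s => φ.coef (diffQuot s f) j) = fun s =>
      s⁻¹ * ((∫ x in a..b, f (x + s) * φ.fn j x) - ∫ x in a..b, f x * φ.fn j x) := by
    funext s
    rw [← intervalIntegral.integral_sub
      ((hf.translate s).mul (φ.perBdd hab j) |>.intervalIntegrable _ _)
      (hf.mul (φ.perBdd hab j) |>.intervalIntegrable _ _),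
      ← intervalIntegral.integral_const_mul]
    exact intervalIntegral.integral_congr fun x _ => by simp only [diffQuot]; ring
  rw [e]
  exact measurable_inv.mul (h.sub_const _)

theorem measurable_stiff (hab : a < b) (i j : ι) : Measurable fun s => φ.stiff s i j :=
  φ.measurable_coef_diffQuot hab (φ.perBdd hab i) (φ.measurable i) j

/-- Although basis functions jump, the strips on which a shift crosses a jump have width s, which
the division by s compensates. With this bound, integrability of s²γ suffices and γ itself may be
singular. -/
theorem exists_stiff_bound (hab : a < b) (δ : ℝ) :
    ∃ B, 0 ≤ B ∧ ∀ s ∈ Ioc 0 δ, ∀ i j, |φ.stiff s i j| ≤ B := by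
  choose C hC0 hC using fun i j => (φ.memVh j).exists_shift_bound hab (φ.perBdd hab i) δ
  refine ⟨∑ i, ∑ j, C i j, Finset.sum_nonneg fun i _ => Finset.sum_nonneg fun j _ => hC0 i j,
    fun s hs i j => ?_⟩
  have h := hC i j s (by rw [abs_of_pos hs.1]; exact hs.2)
  refine (abs_integral_diffQuot_mul_le (by rwa [mul_comm |s|])
    hs.1.ne').trans ?_
  exact (Finset.single_le_sum (f := fun j => C i j) (fun j _ => hC0 i j) (Finset.mem_univ j)).trans
    (Finset.single_le_sum (f := fun i => ∑ j, C i j)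
      (fun i _ => Finset.sum_nonneg fun j _ => hC0 i j) (Finset.mem_univ i))

end OrthoBasis

theorem derivWithin_contDiffOn {T : ℝ} (hT : 0 < T) {n : ℕ} {c : ℝ → ℝ}
    (hc : ContDiffOn ℝ (n + 1 : ℕ) c (Icc 0 T)) :
    ContDiffOn ℝ n (derivWithin c (Icc 0 T)) (Icc 0 T) :=
  hc.derivWithin (uniqueDiffOn_Icc hT) (by norm_cast)

theorem timeDeriv_comb {a b T : ℝ} {m : Mesh a b} {k : ℕ} {ι : Type} [Fintype ι] [DecidableEq ι]
    (φ : OrthoBasis m k ι) {v : ℝ → ℝ → ℝ} {c : ι → ℝ → ℝ}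
    (hc : ∀ i, DifferentiableOn ℝ (c i) (Icc 0 T))
    (hv : ∀ t ∈ Icc 0 T, ∀ j, ∀ x ∈ m.cell j, v x t = φ.comb (fun i => c i t) x) :
    ∀ t ∈ Icc 0 T, ∀ j, ∀ x ∈ m.cell j,
      timeDeriv T v x t = φ.comb (fun i => derivWithin (c i) (Icc 0 T) t) x := by
  intro t ht j x hx
  have h1 : timeDeriv T v x t = derivWithin (fun τ => ∑ i, c i τ * φ.fn i x) (Icc 0 T) t :=
    derivWithin_congr (fun τ hτ => hv τ hτ j x hx) (hv t ht j x hx)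
  rw [h1, derivWithin_fun_sum fun i _ => ((hc i) t ht).mul_const _]
  refine Finset.sum_congr rfl fun i _ => ?_
  rw [derivWithin_mul_const (hc i t ht)]

/-! ### The scheme in coordinates -/

namespace IsDGSolution

variable {a b T δ : ℝ} {γ : ℝ → ℝ} {m : Mesh a b} {k : ℕ} {uh : ℝ → ℝ → ℝ} {qh : ℝ → ℝ → ℝ → ℝ}
  {ι : Type} [Fintype ι] [DecidableEq ι]

/-- Smoothness in t is given only for each fixed x. A polynomial of degree at most k is determined
by its values at k + 1 points of the cell, so by Lagrange interpolation each coefficient is a fixed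
linear combination of finitely many values of u_h. -/
theorem contDiffOn_coef (hab : a < b) (h : IsDGSolution T δ γ m k uh qh) (φ : OrthoBasis m k ι)
    (i : ι) : ContDiffOn ℝ (2 : ℕ) (fun t => φ.coef (fun x => uh x t) i) (Icc 0 T) := by
  have hcell : ∀ j, ContDiffOn ℝ (2 : ℕ)
      (fun t => ∫ x in m.left j..m.right j, uh x t * φ.fn i x) (Icc 0 T) := by
    intro j
    obtain ⟨p, -, hp⟩ := (φ.memVh i).2 j
    obtain ⟨S, hS, hSc⟩ := (Ioo_infinite (m.left_lt_right j)).exists_subset_card_eq (k + 1)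
    have hrep : ∀ t ∈ Icc 0 T, ∫ x in m.left j..m.right j, uh x t * φ.fn i x =
        ∑ n ∈ S, uh n t * ∫ x in m.left j..m.right j, (Lagrange.basis S id n).eval x * p.eval x := by
      intro t ht
      obtain ⟨r, hr, hur⟩ := (h.mem_u t ht).2 j
      replace hur : ∀ x ∈ m.cell j, uh x t = r.eval x := hur
      have hint : r = Lagrange.interpolate S id fun n => r.eval (id n) :=
        Lagrange.eq_interpolate Function.injective_id.injOn (by
          rw [hSc]
          exact (Polynomial.natDegree_le_iff_degree_le.1 hr).trans_lt (by exact_mod_cast k.lt_succ_self))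
      have hre : ∀ x, r.eval x = ∑ n ∈ S, uh n t * (Lagrange.basis S id n).eval x := by
        intro x
        conv_lhs => rw [hint]
        rw [Lagrange.interpolate_apply, Polynomial.eval_finsetSum]
        refine Finset.sum_congr rfl fun n hn => ?_
        rw [Polynomial.eval_mul, Polynomial.eval_C, id, hur n (hS hn)]
      rw [m.integral_cell_congr j (g := fun x => ∑ n ∈ S,
        uh n t * ((Lagrange.basis S id n).eval x * p.eval x)) fun x hx => by
          rw [hur x hx, hp x hx, hre, Finset.sum_mul]
          exact Finset.sum_congr rfl fun n _ => by ring]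
      have hii : ∀ n ∈ S, IntervalIntegrable
          (fun x => uh n t * ((Lagrange.basis S id n).eval x * p.eval x)) volume
          (m.left j) (m.right j) := fun n _ => (continuous_const.mul
            ((Lagrange.basis S id n).continuous.mul p.continuous)).intervalIntegrable _ _
      rw [intervalIntegral.integral_finsetSum hii]
      simp only [intervalIntegral.integral_const_mul]
    refine ContDiffOn.congr ?_ hrep
    exact ContDiffOn.sum fun n hn => (h.smooth j n (hS hn)).mul contDiffOn_const
  refine (ContDiffOn.sum (s := Finset.univ) fun j _ => hcell j).congr fun t ht => ?_
  rw [OrthoBasis.coef, m.sum_integral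
    (((h.mem_u t ht).perBdd hab).mul (φ.perBdd hab i)).intervalIntegrable]

/-- First and second time derivatives of `u_h` in terms of coefficients. -/
theorem timeDeriv_eq (hab : a < b) (hT : 0 < T) (h : IsDGSolution T δ γ m k uh qh)
    (φ : OrthoBasis m k ι) (n : ℕ) (hn : n ≤ 2) :
    (∀ t ∈ Icc 0 T, MemVh m k (fun x => ((timeDeriv T)^[n] uh) x t)) ∧
    (∀ i, ContDiffOn ℝ (2 - n : ℕ) (fun t => φ.coef (fun x => ((timeDeriv T)^[n] uh) x t) i)
      (Icc 0 T)) ∧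
    (n < 2 → ∀ i, ∀ t ∈ Icc 0 T,
      HasDerivWithinAt (fun t => φ.coef (fun x => ((timeDeriv T)^[n] uh) x t) i)
        (φ.coef (fun x => ((timeDeriv T)^[n + 1] uh) x t) i) (Icc 0 T) t) := by
  have step : ∀ v : ℝ → ℝ → ℝ, ∀ l : ℕ, (∀ t ∈ Icc 0 T, MemVh m k (fun x => v x t)) →
      (∀ i, ContDiffOn ℝ (l + 1 : ℕ) (fun t => φ.coef (fun x => v x t) i) (Icc 0 T)) →
      (∀ t ∈ Icc 0 T, MemVh m k (fun x => timeDeriv T v x t)) ∧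
      (∀ i, ∀ t ∈ Icc 0 T, φ.coef (fun x => timeDeriv T v x t) i =
        derivWithin (fun t => φ.coef (fun x => v x t) i) (Icc 0 T) t) := by
    intro v l hv hc
    have hd := timeDeriv_comb φ (fun i => (hc i).differentiableOn (by norm_cast))
      (fun t ht j x hx => φ.eq_comb_coef (hv t ht) j hx)
    have hper : ∀ t ∈ Icc 0 T, Function.Periodic (fun x => timeDeriv T v x t) (b - a) :=
      fun t ht => timeDeriv_periodic (fun τ hτ => (hv τ hτ).1) ht
    refine ⟨fun t ht => ⟨hper t ht, fun j => ?_⟩, fun i t ht => ?_⟩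
    · obtain ⟨p, hp, hpe⟩ := (φ.comb_memVh
        (fun i => derivWithin (fun t => φ.coef (fun x => v x t) i) (Icc 0 T) t)).2 j
      exact ⟨p, hp, fun x hx => (hd t ht j x hx).trans (hpe x hx)⟩
    · rw [φ.coef_congr_ae (m.ae_eq hab (hper t ht) (φ.comb_memVh _).1 (hd t ht)),
        φ.coef_comb hab]
  have key : ∀ n ≤ 2, (∀ t ∈ Icc 0 T, MemVh m k (fun x => ((timeDeriv T)^[n] uh) x t)) ∧
      (∀ i, ContDiffOn ℝ (2 - n : ℕ) (fun t => φ.coef (fun x => ((timeDeriv T)^[n] uh) x t) i)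
      (Icc 0 T)) := by
    intro n
    induction n with
    | zero => exact fun _ => ⟨h.mem_u, h.contDiffOn_coef hab φ⟩
    | succ n ih =>
      intro hn
      obtain ⟨h1, h2⟩ := ih (by omega)
      -- Truncated subtraction: the two exponents agree because n < 2 here.
      have h2' : ∀ i, ContDiffOn ℝ (2 - (n + 1) + 1 : ℕ)
          (fun t => φ.coef (fun x => ((timeDeriv T)^[n] uh) x t) i) (Icc 0 T) := by
        rwa [show 2 - (n + 1) + 1 = 2 - n by omega]
      obtain ⟨h3, h4⟩ := step _ _ h1 h2'
      rw [Function.iterate_succ_apply']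
      refine ⟨h3, fun i => ?_⟩
      exact (derivWithin_contDiffOn hT (h2' i)).congr (h4 i)
  refine ⟨(key n hn).1, (key n hn).2, fun hn2 i t ht => ?_⟩
  obtain ⟨h1, h2⟩ := key n hn
  have h2' : ∀ i, ContDiffOn ℝ (2 - (n + 1) + 1 : ℕ)
      (fun t => φ.coef (fun x => ((timeDeriv T)^[n] uh) x t) i) (Icc 0 T) := by
    rwa [show 2 - (n + 1) + 1 = 2 - n by omega]
  rw [Function.iterate_succ_apply', (step _ _ h1 h2').2 i t ht]
  exact ((h2' i).differentiableOn (by norm_cast) t ht).hasDerivWithinAt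

theorem coef_flux (hab : a < b) (h : IsDGSolution T δ γ m k uh qh) (φ : OrthoBasis m k ι) {t s : ℝ}
    (ht : t ∈ Icc 0 T) (hs : s ∈ Ioc 0 δ) (i : ι) :
    φ.coef (fun x => qh x t s) i = φ.coef (diffQuot s (fun x => uh x t)) i := by
  have hu := (h.mem_u t ht).perBdd hab
  have hq := (h.mem_q t ht s hs).perBdd hab
  rw [OrthoBasis.coef, OrthoBasis.coef,
    ← m.sum_integral (hq.mul (φ.perBdd hab i)).intervalIntegrable,
    ← m.sum_integral ((hu.diffQuot s).mul (φ.perBdd hab i)).intervalIntegrable]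
  exact Finset.sum_congr rfl fun j _ => sub_eq_zero.1 (h.flux t ht s hs _ (φ.memVh i) j)

/-- This eliminates q_h in favour of u_h. It also provides measurability and boundedness in s, which
`IsDGSolution` does not state. -/
theorem coef_flux_eq_sum (hab : a < b) (h : IsDGSolution T δ γ m k uh qh) (φ : OrthoBasis m k ι)
    {t s : ℝ} (ht : t ∈ Icc 0 T) (hs : s ∈ Ioc 0 δ) (i : ι) :
    φ.coef (fun x => qh x t s) i = ∑ l, φ.coef (fun x => uh x t) l * φ.stiff s l i := by
  rw [h.coef_flux hab φ ht hs, φ.coef_congr_ae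
    (diffQuot_congr_ae (φ.ae_eq_comb_coef hab (h.mem_u t ht)) s), φ.coef_diffQuot_comb hab]

/-- The quotient of q_h in the scheme is D_{-s}; summation by parts moves it to the test function as
-D_s, so the same matrix appears here, transposed, as in the flux equation. -/
theorem wave_coef (hab : a < b) (hδ : 0 < δ)
    (hω : IntervalIntegrable (fun s => s ^ 2 * γ s) volume 0 δ)
    (h : IsDGSolution T δ γ m k uh qh) (φ : OrthoBasis m k ι) {t : ℝ} (ht : t ∈ Icc 0 T) (i : ι)
    (htt : PerBdd (b - a) (fun x => timeDeriv T (timeDeriv T uh) x t)) :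
    φ.coef (fun x => timeDeriv T (timeDeriv T uh) x t) i =
      -2 * ∫ s in (0 : ℝ)..δ, s ^ 2 * γ s *
        ∑ l, φ.coef (fun x => qh x t s) l * φ.stiff s i l := by
  obtain ⟨A, hA0, hA⟩ := φ.exists_stiff_bound hab δ
  set d : ι → ℝ → ℝ := fun l s => ∑ n, φ.coef (fun x => uh x t) n * φ.stiff s n l with hd
  have hdq : ∀ s ∈ Ioc 0 δ, ∀ l, φ.coef (fun x => qh x t s) l = d l s :=
    fun s hs l => h.coef_flux_eq_sum hab φ ht hs l
  have hdm : ∀ l, Measurable (d l) := fun l =>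
    Finset.measurable_sum _ fun n _ => (φ.measurable_stiff hab n l).const_mul _
  have hdB : ∃ D, 0 ≤ D ∧ ∀ s ∈ Ioc 0 δ, ∀ l, |d l s| ≤ D := by
    refine ⟨∑ n, |φ.coef (fun x => uh x t) n| * A,
      Finset.sum_nonneg fun n _ => mul_nonneg (abs_nonneg _) hA0, fun s hs l => ?_⟩
    refine (Finset.abs_sum_le_sum_abs _ _).trans (Finset.sum_le_sum fun n _ => ?_)
    rw [abs_mul]
    exact mul_le_mul_of_nonneg_left (hA s hs n l) (abs_nonneg _)
  obtain ⟨D, hD0, hD⟩ := hdB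
  -- the flux term on one cell
  set κ : Fin m.N → ι → ℝ → ℝ := fun j l s =>
    ∫ x in m.left j..m.right j, (φ.fn l x - φ.fn l (x - s)) / s * φ.fn i x with hκ
  have hKper : ∀ l s, PerBdd (b - a) fun x => (φ.fn l x - φ.fn l (x - s)) / s := fun l s => by
    have := (φ.perBdd hab l).sub ((φ.perBdd hab l).translate (-s))
    simpa only [← sub_eq_add_neg] using this.div_const s
  have hopK : ∀ j, ∀ s ∈ Ioc 0 δ, opK m j (fun x => qh x t s) (φ.fn i) s = ∑ l, d l s * κ j l s := by
    intro j s hs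
    have hae := φ.ae_eq_comb_coef hab (h.mem_q t ht s hs)
    have hae' := ae_translate hae (-s)
    rw [opK, intervalIntegral.integral_congr_ae (g := fun x => ∑ l, d l s *
      ((φ.fn l x - φ.fn l (x - s)) / s * φ.fn i x))]
    · rw [intervalIntegral.integral_finsetSum fun l _ =>
        (((hKper l s).mul (φ.perBdd hab i)).const_mul (d l s)).intervalIntegrable _ _]
      simp only [hκ, intervalIntegral.integral_const_mul]
    · filter_upwards [hae, hae'] with x h1 h2 _
      rw [← sub_eq_add_neg] at h2
      rw [h1, h2]
      simp only [OrthoBasis.comb, hdq s hs, ← Finset.sum_sub_distrib, Finset.sum_div,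
        Finset.sum_mul]
      exact Finset.sum_congr rfl fun l _ => by ring
  have hκm : ∀ j l, Measurable (κ j l) := by
    intro j l
    have hjm : Measurable fun p : ℝ × ℝ => (φ.fn l p.2 - φ.fn l (p.2 - p.1)) / p.1 * φ.fn i p.2 :=
      ((((φ.measurable l).comp measurable_snd).sub ((φ.measurable l).comp
        (measurable_snd.sub measurable_fst))).div measurable_fst).mul
        ((φ.measurable i).comp measurable_snd)
    simp only [hκ, intervalIntegral.integral_of_le (m.left_lt_right j).le]
    exact (StronglyMeasurable.integral_prod_right
      (f := fun s x => (φ.fn l x - φ.fn l (x - s)) / s * φ.fn i x)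
      (ν := volume.restrict (Ioc (m.left j) (m.right j))) hjm.stronglyMeasurable).measurable
  have hκB : ∀ j l, ∃ B, 0 ≤ B ∧ ∀ s ∈ Ioc 0 δ, |κ j l s| ≤ B := by
    intro j l
    obtain ⟨p, hp, hpe⟩ := (φ.memVh i).2 j
    -- Cutting the test function off to one cell stays in V_h^k, so the global uniform bound also
    -- applies to the integral over a single cell.
    obtain ⟨C, hC0, hC⟩ := (m.cellFun_memVh hab j hp).exists_shift_bound hab (φ.perBdd hab l) δ
    refine ⟨C, hC0, fun s hs => ?_⟩
    have h1 := hC (-s) (by rw [abs_neg, abs_of_pos hs.1]; exact hs.2)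
    rw [abs_neg, mul_comm] at h1
    have e1 : κ j l s = ∫ x in a..b, (fun x => (φ.fn l x - φ.fn l (x - s)) / s) x *
        m.cellFun j p x := by
      rw [m.integral_mul_cellFun hab (hKper l s)]
      exact m.integral_cell_congr j fun x hx => by rw [hpe x hx]
    have e2 : κ j l s = -s⁻¹ * ∫ x in a..b, (φ.fn l (x + -s) - φ.fn l x) * m.cellFun j p x := by
      rw [e1, ← intervalIntegral.integral_const_mul]
      refine intervalIntegral.integral_congr fun x _ => ?_
      simp only [← sub_eq_add_neg]
      ring
    rw [e2, abs_mul, abs_neg, abs_inv, inv_mul_le_iff₀ (abs_pos.2 hs.1.ne')]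
    exact h1
  -- The scheme is stated cell by cell; only with integrability on every cell may the sum over cells
  -- be taken inside the s-integral, where summation by parts over a full period applies.
  have hint : ∀ j, IntervalIntegrable
      (fun s => s ^ 2 * γ s * opK m j (fun x => qh x t s) (φ.fn i) s) volume 0 δ := by
    intro j
    choose B hB0 hB using fun l => hκB j l
    have h1 : IntervalIntegrable (fun s => s ^ 2 * γ s * ∑ l, d l s * κ j l s) volume 0 δ := by
      refine intervalIntegrable_weight_mul (B := ∑ l, D * B l) hδ.le hω
        (Finset.measurable_sum _ fun l _ => (hdm l).mul (hκm j l)).aestronglyMeasurable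
        fun s hs => ?_
      refine (Finset.abs_sum_le_sum_abs _ _).trans (Finset.sum_le_sum fun l _ => ?_)
      rw [abs_mul]
      exact mul_le_mul (hD s hs l) (hB l s hs) (abs_nonneg _) hD0
    refine h1.congr fun s hs => ?_
    rw [uIoc_of_le hδ.le] at hs
    simp only [hopK j s hs]
  have hcoef : φ.coef (fun x => timeDeriv T (timeDeriv T uh) x t) i =
      ∑ j, 2 * ∫ s in (0 : ℝ)..δ, s ^ 2 * γ s * opK m j (fun x => qh x t s) (φ.fn i) s := by
    rw [OrthoBasis.coef, ← m.sum_integral (htt.mul (φ.perBdd hab i)).intervalIntegrable]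
    exact Finset.sum_congr rfl fun j _ => sub_eq_zero.1 (h.wave t ht _ (φ.memVh i) j)
  rw [hcoef, ← Finset.mul_sum, ← intervalIntegral.integral_finsetSum fun j _ => hint j, neg_mul,
    ← mul_neg, ← intervalIntegral.integral_neg]
  congr 1
  refine intervalIntegral.integral_congr_ae (.of_forall fun s hs => ?_)
  rw [uIoc_of_le hδ.le] at hs
  rw [← Finset.mul_sum, ← mul_neg]
  congr 1
  have hq := (h.mem_q t ht s hs).perBdd hab
  have hqs : PerBdd (b - a) fun x => (qh x t s - qh (x - s) t s) / s := by
    have := hq.sub (hq.translate (-s))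
    simpa only [← sub_eq_add_neg] using this.div_const s
  have h1 : ∑ j, opK m j (fun x => qh x t s) (φ.fn i) s =
      ∫ x in a..b, diffQuot (-s) (fun x => qh x t s) x * φ.fn i x := by
    simp only [opK]
    rw [m.sum_integral (hqs.mul (φ.perBdd hab i)).intervalIntegrable]
    refine intervalIntegral.integral_congr fun x _ => ?_
    simp only [diffQuot, ← sub_eq_add_neg]
    rw [div_neg, ← neg_div, neg_sub]
  rw [h1, integral_diffQuot_mul hq (φ.perBdd hab i), neg_neg]
  congr 1
  have h2 : ∫ x in a..b, qh x t s * diffQuot s (φ.fn i) x =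
      ∫ x in a..b, diffQuot s (φ.fn i) x * φ.comb (φ.coef fun x => qh x t s) x := by
    refine intervalIntegral.integral_congr_ae ?_
    filter_upwards [φ.ae_eq_comb_coef hab (h.mem_q t ht s hs)] with x hx _
    rw [hx, mul_comm]
  rw [h2, φ.integral_mul_comb hab ((φ.perBdd hab i).diffQuot s)]
  rfl

end IsDGSolution

/-! ### The nonlocal operator -/

/-- The mean value inequality; at s = 0 the quotient is zero by convention, so no case is excluded.
-/
theorem abs_diffQuot_le {f f' : ℝ → ℝ} {B : ℝ} (hf : ∀ x, HasDerivAt f (f' x) x)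
    (hB : ∀ x, |f' x| ≤ B) (s x : ℝ) : |diffQuot s f x| ≤ B := by
  have h := convex_univ.norm_image_sub_le_of_norm_hasDerivWithin_le (f := f) (f' := f') (C := B)
    (fun x _ => (hf x).hasDerivWithinAt) (fun x _ => hB x) (mem_univ x) (mem_univ (x + s))
  rw [add_sub_cancel_left, Real.norm_eq_abs, Real.norm_eq_abs] at h
  rw [diffQuot, abs_div]
  exact div_le_of_le_mul₀ (abs_nonneg _) ((abs_nonneg _).trans (hB 0)) h

theorem hasDerivAt_diffQuot {f f' : ℝ → ℝ} (hf : ∀ x, HasDerivAt f (f' x) x) (s x : ℝ) :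
    HasDerivAt (diffQuot s f) (diffQuot s f' x) x :=
  (((hf (x + s)).comp_add_const x s).sub (hf x)).div_const s

theorem abs_diffQuot_diffQuot_le {f f' f'' : ℝ → ℝ} {B : ℝ} (hf : ∀ x, HasDerivAt f (f' x) x)
    (hf' : ∀ x, HasDerivAt f' (f'' x) x) (hB : ∀ x, |f'' x| ≤ B) (r s x : ℝ) :
    |diffQuot r (diffQuot s f) x| ≤ B :=
  abs_diffQuot_le (hasDerivAt_diffQuot hf s) (fun y => abs_diffQuot_le hf' hB s y) r x

theorem diffQuot_continuous {f : ℝ → ℝ} (hf : Continuous f) (s : ℝ) :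
    Continuous (diffQuot s f) := by unfold diffQuot; fun_prop

/-- The nonlocal operator `2 ∫_0^δ ω(s) (f(x+s) - 2 f(x) + f(x-s)) / s² ds`. -/
noncomputable def nonlocalLap (δ : ℝ) (ω f : ℝ → ℝ) (x : ℝ) : ℝ :=
  2 * ∫ s in (0 : ℝ)..δ, ω s * diffQuot (-s) (diffQuot s f) x

section nonlocalLap

variable {δ B : ℝ} {ω f f' f'' : ℝ → ℝ}

theorem measurable_diffQuot_diffQuot (hf : Measurable f) :
    Measurable fun p : ℝ × ℝ => diffQuot (-p.2) (diffQuot p.2 f) p.1 := by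
  unfold diffQuot
  fun_prop

theorem intervalIntegrable_lap (hδ : 0 ≤ δ) (hω : IntervalIntegrable ω volume 0 δ)
    (hf : ∀ x, HasDerivAt f (f' x) x) (hf' : ∀ x, HasDerivAt f' (f'' x) x)
    (hB : ∀ x, |f'' x| ≤ B) (x : ℝ) :
    IntervalIntegrable (fun s => ω s * diffQuot (-s) (diffQuot s f) x) volume 0 δ := by
  have hc : Continuous f := continuous_iff_continuousAt.2 fun x => (hf x).continuousAt
  exact intervalIntegrable_weight_mul hδ hω (((measurable_diffQuot_diffQuot hc.measurable).comp
    measurable_prodMk_left).aestronglyMeasurable)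
    fun s _ => abs_diffQuot_diffQuot_le hf hf' hB (-s) s x

theorem continuous_lap (hδ : 0 ≤ δ) (hω : IntervalIntegrable ω volume 0 δ)
    (hf : ∀ x, HasDerivAt f (f' x) x) (hf' : ∀ x, HasDerivAt f' (f'' x) x)
    (hB : ∀ x, |f'' x| ≤ B) : Continuous (nonlocalLap δ ω f) := by
  have hc : Continuous f := continuous_iff_continuousAt.2 fun x => (hf x).continuousAt
  refine continuous_const.mul (continuous_iff_continuousAt.2 fun x => ?_)
  refine intervalIntegral.continuousAt_of_dominated_interval (bound := fun s => |ω s| * B)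
    ?_ ?_ (hω.abs.mul_const B) ?_
  · refine .of_forall fun y => ?_
    rw [uIoc_of_le hδ]
    exact ((intervalIntegrable_iff_integrableOn_Ioc_of_le hδ).1
      (intervalIntegrable_lap hδ hω hf hf' hB y)).aestronglyMeasurable
  · refine .of_forall fun y => .of_forall fun s _ => ?_
    rw [norm_mul, Real.norm_eq_abs, Real.norm_eq_abs]
    exact mul_le_mul_of_nonneg_left (abs_diffQuot_diffQuot_le hf hf' hB (-s) s y) (abs_nonneg _)
  · exact .of_forall fun s _ => (continuous_const.mul
      (diffQuot_continuous (diffQuot_continuous hc s) (-s))).continuousAt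

theorem hasDerivAt_lap {f''' : ℝ → ℝ} {B' : ℝ} (hδ : 0 ≤ δ) (hω : IntervalIntegrable ω volume 0 δ)
    (hf : ∀ x, HasDerivAt f (f' x) x) (hf' : ∀ x, HasDerivAt f' (f'' x) x)
    (hf'' : ∀ x, HasDerivAt f'' (f''' x) x)
    (hB : ∀ x, |f'' x| ≤ B) (hB' : ∀ x, |f''' x| ≤ B') (x : ℝ) :
    HasDerivAt (nonlocalLap δ ω f) (nonlocalLap δ ω f' x) x := by
  have h1 := fun y => intervalIntegrable_lap hδ hω hf hf' hB y
  have h2 := fun y => intervalIntegrable_lap hδ hω hf' hf'' hB' y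
  refine HasDerivAt.const_mul 2 ?_
  refine (intervalIntegral.hasDerivAt_integral_of_dominated_loc_of_deriv_le (μ := volume)
    (F := fun x s => ω s * diffQuot (-s) (diffQuot s f) x)
    (F' := fun x s => ω s * diffQuot (-s) (diffQuot s f') x)
    (bound := fun s => |ω s| * B') (s := univ) univ_mem ?_ (h1 x) ?_ ?_
    (hω.abs.mul_const B') ?_).2
  · refine .of_forall fun y => ?_
    rw [uIoc_of_le hδ]
    exact ((intervalIntegrable_iff_integrableOn_Ioc_of_le hδ).1 (h1 y)).aestronglyMeasurable
  · rw [uIoc_of_le hδ]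
    exact ((intervalIntegrable_iff_integrableOn_Ioc_of_le hδ).1 (h2 x)).aestronglyMeasurable
  · refine .of_forall fun s _ y _ => ?_
    rw [norm_mul, Real.norm_eq_abs, Real.norm_eq_abs]
    exact mul_le_mul_of_nonneg_left (abs_diffQuot_diffQuot_le hf' hf'' hB' (-s) s y) (abs_nonneg _)
  · exact .of_forall fun s _ y _ =>
      (hasDerivAt_diffQuot (hasDerivAt_diffQuot hf s) (-s) y).const_mul _

theorem nonlocalLap_translate (y x : ℝ) :
    nonlocalLap δ ω (fun x => f (x + y)) x = nonlocalLap δ ω f (x + y) := by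
  simp only [nonlocalLap, diffQuot, add_right_comm _ _ y]

theorem nonlocalLap_const_mul (c x : ℝ) :
    nonlocalLap δ ω (fun x => c * f x) x = c * nonlocalLap δ ω f x := by
  rw [nonlocalLap, nonlocalLap, mul_left_comm, ← intervalIntegral.integral_const_mul c]
  congr 1
  exact intervalIntegral.integral_congr fun s _ => by simp only [diffQuot]; ring

theorem nonlocalLap_sub {g : ℝ → ℝ} {x : ℝ}
    (hf : IntervalIntegrable (fun s => ω s * diffQuot (-s) (diffQuot s f) x) volume 0 δ)
    (hg : IntervalIntegrable (fun s => ω s * diffQuot (-s) (diffQuot s g) x) volume 0 δ) :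
    nonlocalLap δ ω (fun x => f x - g x) x = nonlocalLap δ ω f x - nonlocalLap δ ω g x := by
  rw [nonlocalLap, nonlocalLap, nonlocalLap, ← mul_sub, ← intervalIntegral.integral_sub hf hg]
  congr 1
  exact intervalIntegral.integral_congr fun s _ => by simp only [diffQuot]; ring

theorem nonlocalLap_sum {ι : Type*} (I : Finset ι) {F : ι → ℝ → ℝ} {x : ℝ}
    (hF : ∀ i ∈ I, IntervalIntegrable (fun s => ω s * diffQuot (-s) (diffQuot s (F i)) x)
      volume 0 δ) :
    nonlocalLap δ ω (fun x => ∑ i ∈ I, F i x) x = ∑ i ∈ I, nonlocalLap δ ω (F i) x := by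
  simp only [nonlocalLap]
  rw [← Finset.mul_sum, ← intervalIntegral.integral_finsetSum hF]
  congr 1
  refine intervalIntegral.integral_congr fun s _ => ?_
  simp only [diffQuot, ← Finset.sum_sub_distrib, Finset.sum_div, Finset.mul_sum]

/-- Summation by parts for the nonlocal operator. -/
theorem integral_nonlocalLap_mul {a b : ℝ} (hab : a < b) (hδ : 0 ≤ δ)
    (hω : IntervalIntegrable ω volume 0 δ) (hp : Function.Periodic f (b - a))
    (hf : ∀ x, HasDerivAt f (f' x) x) (hf' : ∀ x, HasDerivAt f' (f'' x) x)
    (hB : ∀ x, |f'' x| ≤ B) {w : ℝ → ℝ} (hw : PerBdd (b - a) w) :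
    IntervalIntegrable (fun s => ω s * ∫ x in a..b, diffQuot s f x * diffQuot s w x) volume 0 δ ∧
    ∫ x in a..b, nonlocalLap δ ω f x * w x =
      -2 * ∫ s in (0 : ℝ)..δ, ω s * ∫ x in a..b, diffQuot s f x * diffQuot s w x := by
  have hc : Continuous f := continuous_iff_continuousAt.2 fun x => (hf x).continuousAt
  have hL : 0 < b - a := sub_pos.2 hab
  have hfP : PerBdd (b - a) f := .of_continuous hL hp hc
  have hparts : ∀ s, ∫ x in a..b, diffQuot (-s) (diffQuot s f) x * w x =
      -∫ x in a..b, diffQuot s f x * diffQuot s w x := fun s => by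
    rw [integral_diffQuot_mul (hfP.diffQuot s) hw (-s), neg_neg]
  set G : ℝ × ℝ → ℝ := fun p => diffQuot (-p.2) (diffQuot p.2 f) p.1 with hG
  have hω1 := (intervalIntegrable_iff_integrableOn_Ioc_of_le hδ).1 hω
  have hw1 := (intervalIntegrable_iff_integrableOn_Ioc_of_le hab.le).1 (hw.intervalIntegrable a b)
  -- Fubini applies because the second difference quotient is bounded by sup |f''| and w(x)ω(s) is
  -- integrable on the product.
  have hprod : IntegrableOn (fun p : ℝ × ℝ => G p * (w p.1 * ω p.2)) (Ioc a b ×ˢ Ioc 0 δ)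
      (volume.prod volume) := by
    rw [IntegrableOn, ← Measure.prod_restrict]
    refine (hw1.mul_prod hω1).bdd_mul (c := B) ?_ ?_
    · exact (measurable_diffQuot_diffQuot hc.measurable).aestronglyMeasurable
    · exact .of_forall fun p => abs_diffQuot_diffQuot_le hf hf' hB _ _ _
  have hprod2 : IntegrableOn (Function.uncurry fun x s => ω s * G (x, s) * w x)
      (Ioc a b ×ˢ Ioc 0 δ) (volume.prod volume) :=
    hprod.congr_fun (fun p _ => by simp only [Function.uncurry]; ring)
      (measurableSet_Ioc.prod measurableSet_Ioc)
  have hinner : ∀ s, ∫ x in a..b, ω s * G (x, s) * w x =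
      -(ω s * ∫ x in a..b, diffQuot s f x * diffQuot s w x) := fun s => by
    simp only [mul_assoc, intervalIntegral.integral_const_mul]
    rw [hparts s, mul_neg]
  constructor
  · have h1 : IntegrableOn (fun s => ∫ x in Ioc a b, ω s * G (x, s) * w x) (Ioc 0 δ) := by
      rw [IntegrableOn, ← Measure.prod_restrict] at hprod2
      exact hprod2.integral_prod_right
    rw [intervalIntegrable_iff_integrableOn_Ioc_of_le hδ]
    refine h1.neg.congr_fun (fun s _ => ?_) measurableSet_Ioc
    simp only [Pi.neg_apply, ← intervalIntegral.integral_of_le hab.le]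
    rw [hinner s, neg_neg]
  · have h1 : ∫ x in a..b, nonlocalLap δ ω f x * w x =
        2 * ∫ x in a..b, ∫ s in (0 : ℝ)..δ, ω s * G (x, s) * w x := by
      rw [← intervalIntegral.integral_const_mul]
      refine intervalIntegral.integral_congr fun x _ => ?_
      simp only [nonlocalLap, hG]
      rw [intervalIntegral.integral_mul_const, mul_assoc]
    rw [h1, intervalIntegral_swap hab.le hδ hprod2]
    simp only [hinner]
    rw [intervalIntegral.integral_neg]
    ring

end nonlocalLap

/-! ### Smooth solutions of the nonlocal wave equation -/

/-- `U` is an `L`-periodic solution of the nonlocal wave equation with forcing `F`. -/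
structure SolvesWave (L T δ : ℝ) (ω : ℝ → ℝ) (U F : ℝ → ℝ → ℝ) : Prop where
  periodic : ∀ t ∈ Icc 0 T, Function.Periodic (fun x => U x t) L
  wave : ∀ x, ∀ t ∈ Ioo 0 T, timeDeriv T (timeDeriv T U) x t =
    nonlocalLap δ ω (fun y => U y t) x + F x t

namespace IsSmoothOfOrder

variable {L T : ℝ} {n : ℕ} {U : ℝ → ℝ → ℝ}

/-- The first two space derivatives of `U` and a bound for the second one. -/
theorem exists_space_bound (hL : 0 < L) (hT : 0 < T) (hU : IsSmoothOfOrder T (n + 2) U)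
    (hp : ∀ t ∈ Icc 0 T, Function.Periodic (fun x => U x t) L) :
    (∀ t ∈ Icc 0 T, ∀ x, HasDerivAt (fun x => U x t) (spaceDeriv U x t) x) ∧
    (∀ t ∈ Icc 0 T, ∀ x, HasDerivAt (fun x => spaceDeriv U x t)
      (spaceDeriv (spaceDeriv U) x t) x) ∧
    (∃ B, 0 ≤ B ∧ ∀ t ∈ Icc 0 T, ∀ x, |spaceDeriv U x t| ≤ B) ∧
    ∃ B, 0 ≤ B ∧ ∀ t ∈ Icc 0 T, ∀ x, |spaceDeriv (spaceDeriv U) x t| ≤ B := by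
  have h1 : IsSmoothOfOrder T (n + 1) (spaceDeriv U) := IsSmoothOfOrder.space hT hU
  have h2 : IsSmoothOfOrder T n (spaceDeriv (spaceDeriv U)) := h1.space hT
  have hp1 := fun t ht => spaceDeriv_periodic (hp t ht)
  obtain ⟨B1, h10, h11⟩ := h1.exists_bound hL hp1
  obtain ⟨B2, h20, h21⟩ := h2.exists_bound hL fun t ht => spaceDeriv_periodic (hp1 t ht)
  exact ⟨fun t ht x => hU.hasDerivAt_space (by omega) x ht,
    fun t ht x => h1.hasDerivAt_space (by omega) x ht,
    ⟨B1, h10, fun t ht x => h11 x t ht⟩, ⟨B2, h20, fun t ht x => h21 x t ht⟩⟩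

end IsSmoothOfOrder

/-- The equation is given on (a,b) only. Both sides are continuous in x, which adds the end points,
and periodic, which gives the whole line. -/
theorem IsExactSolution.solvesWave {a b T δ : ℝ} {γ : ℝ → ℝ} {u : ℝ → ℝ → ℝ}
    {q : ℝ → ℝ → ℝ → ℝ} (hab : a < b) (hT : 0 < T) (hδ : 0 < δ)
    (hω : IntervalIntegrable (fun s => s ^ 2 * γ s) volume 0 δ)
    (h : IsExactSolution a b T δ γ u q) {n : ℕ} (hu : IsSmoothOfOrder T (n + 2) u) :
    SolvesWave (b - a) T δ (fun s => s ^ 2 * γ s) u (fun _ _ => 0) := by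
  refine ⟨h.periodic, fun x t ht => ?_⟩
  have ht' := Ioo_subset_Icc_self ht
  obtain ⟨h1, h2, -, B, -, hB⟩ := hu.exists_space_bound (sub_pos.2 hab) hT h.periodic
  have h1 := h1 t ht'
  have h2 := h2 t ht'
  have hB := hB t ht'
  rw [add_zero]
  have hu1 : IsSmoothOfOrder T (n + 1) (timeDeriv T u) := IsSmoothOfOrder.time hT hu
  have hu2 : IsSmoothOfOrder T n (timeDeriv T (timeDeriv T u)) := hu1.time hT
  have hper2 : Function.Periodic (fun x => timeDeriv T (timeDeriv T u) x t) (b - a) :=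
    timeDeriv_periodic (fun τ hτ => timeDeriv_periodic h.periodic hτ) ht'
  have hIoo : EqOn (fun x => timeDeriv T (timeDeriv T u) x t)
      (nonlocalLap δ (fun s => s ^ 2 * γ s) (fun y => u y t)) (Ioo a b) := by
    intro x hx
    have := h.wave x hx t ht
    rw [sub_eq_zero] at this
    simp only [this, nonlocalLap]
    congr 1
    refine intervalIntegral.integral_congr_ae (.of_forall fun s hs => ?_)
    rw [uIoc_of_le hδ.le] at hs
    have e1 := sub_eq_zero.1 (h.flux x t ht' s hs)
    have e2 := sub_eq_zero.1 (h.flux (x - s) t ht' s hs)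
    rw [e1, e2, diffQuot, diffQuot, diffQuot, div_neg, ← neg_div, neg_sub, ← sub_eq_add_neg]
  have hIcc := hIoo.closure (hu2.continuous_slice ht') (continuous_lap hδ.le hω h1 h2 hB)
  rw [closure_Ioo hab.ne] at hIcc
  have hperR : Function.Periodic (nonlocalLap δ (fun s => s ^ 2 * γ s) (fun y => u y t))
      (b - a) := fun x => by
    rw [← nonlocalLap_translate]
    congr 1
    exact funext (h.periodic t ht')
  have := hIcc (Ico_subset_Icc_self (wrap_mem hab x))
  rw [Function.Periodic.wrap_eq hab hperR x] at this
  exact (Function.Periodic.wrap_eq hab hper2 x).symm.trans this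

namespace SolvesWave

variable {a b L T δ : ℝ} {ω : ℝ → ℝ} {U F : ℝ → ℝ → ℝ} {n : ℕ}

theorem weak (hab : a < b) (hT : 0 < T) (hδ : 0 ≤ δ) (hω : IntervalIntegrable ω volume 0 δ)
    (h : SolvesWave (b - a) T δ ω U F) (hU : IsSmoothOfOrder T (n + 2) U) {t : ℝ}
    (ht : t ∈ Ioo 0 T) {w : ℝ → ℝ} (hw : PerBdd (b - a) w) :
    IntervalIntegrable (fun s => ω s * ∫ x in a..b, diffQuot s (fun y => U y t) x * diffQuot s w x)
      volume 0 δ ∧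
    ∫ x in a..b, timeDeriv T (timeDeriv T U) x t * w x =
      -2 * (∫ s in (0 : ℝ)..δ, ω s * ∫ x in a..b, diffQuot s (fun y => U y t) x * diffQuot s w x) +
        ∫ x in a..b, F x t * w x := by
  have ht' := Ioo_subset_Icc_self ht
  have hL := sub_pos.2 hab
  obtain ⟨h1, h2, -, B, -, hB⟩ := hU.exists_space_bound hL hT h.periodic
  have hlap := integral_nonlocalLap_mul hab hδ hω (h.periodic t ht') (h1 t ht') (h2 t ht')
    (hB t ht') hw
  refine ⟨hlap.1, ?_⟩
  have hlapP : PerBdd (b - a) (nonlocalLap δ ω fun y => U y t) := by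
    refine .of_continuous hL (fun x => ?_) (continuous_lap hδ hω (h1 t ht') (h2 t ht') (hB t ht'))
    rw [← nonlocalLap_translate]
    congr 1
    exact funext (h.periodic t ht')
  have hU2 : IsSmoothOfOrder T n (timeDeriv T (timeDeriv T U)) :=
    IsSmoothOfOrder.time hT (IsSmoothOfOrder.time hT hU)
  have hUP : PerBdd (b - a) fun x => timeDeriv T (timeDeriv T U) x t :=
    .of_continuous hL (timeDeriv_periodic (fun τ hτ => timeDeriv_periodic h.periodic hτ) ht')
      (hU2.continuous_slice ht')
  -- The forcing carries no regularity of its own here; its pairing is read off as a difference of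
  -- two integrable ones.
  have hFP : ∫ x in a..b, F x t * w x = (∫ x in a..b, timeDeriv T (timeDeriv T U) x t * w x) -
      ∫ x in a..b, nonlocalLap δ ω (fun y => U y t) x * w x := by
    rw [← intervalIntegral.integral_sub ((hUP.mul hw).intervalIntegrable _ _)
      ((hlapP.mul hw).intervalIntegrable _ _)]
    refine intervalIntegral.integral_congr fun x _ => ?_
    simp only [h.wave x t ht]
    ring
  rw [hFP, hlap.2]
  ring

/-- Translation invariance and linearity are what make averages and difference quotients of
solutions solutions again. -/
theorem translate (h : SolvesWave L T δ ω U F) (y : ℝ) :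
    SolvesWave L T δ ω (fun x t => U (x + y) t) (fun x t => F (x + y) t) := by
  refine ⟨fun t ht x => ?_, fun x t ht => ?_⟩
  · have := h.periodic t ht (x + y)
    simpa only [add_right_comm x L y] using this
  · rw [nonlocalLap_translate (f := fun x => U x t), ← h.wave (x + y) t ht]
    rfl

theorem timeDeriv_const_mul (c : ℝ) (V : ℝ → ℝ → ℝ) :
    timeDeriv T (fun x t => c * V x t) = fun x t => c * timeDeriv T V x t := by
  funext x t
  exact derivWithin_const_mul_field _

theorem const_mul (h : SolvesWave L T δ ω U F) (c : ℝ) :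
    SolvesWave L T δ ω (fun x t => c * U x t) (fun x t => c * F x t) := by
  refine ⟨fun t ht x => ?_, fun x t ht => ?_⟩
  · exact congrArg (c * ·) (h.periodic t ht x)
  · rw [timeDeriv_const_mul, timeDeriv_const_mul, nonlocalLap_const_mul, ← mul_add, ← h.wave x t ht]

theorem timeDeriv_sum (hT : 0 < T) {ι : Type*} (I : Finset ι) {V : ι → ℝ → ℝ → ℝ}
    (hV : ∀ i ∈ I, IsSmoothOfOrder T (n + 1) (V i)) (x : ℝ) {t : ℝ} (ht : t ∈ Icc 0 T) :
    timeDeriv T (fun x t => ∑ i ∈ I, V i x t) x t = ∑ i ∈ I, timeDeriv T (V i) x t :=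
  (HasDerivWithinAt.fun_sum fun i hi =>
    (hV i hi).hasDerivWithinAt_time hT n.succ_ne_zero x ht).derivWithin (uniqueDiffOn_Icc hT t ht)

theorem timeDeriv_sub (hT : 0 < T) {V W : ℝ → ℝ → ℝ} (hV : IsSmoothOfOrder T (n + 1) V)
    (hW : IsSmoothOfOrder T (n + 1) W) (x : ℝ) {t : ℝ} (ht : t ∈ Icc 0 T) :
    timeDeriv T (fun x t => V x t - W x t) x t = timeDeriv T V x t - timeDeriv T W x t :=
  ((hV.hasDerivWithinAt_time hT n.succ_ne_zero x ht).sub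
    (hW.hasDerivWithinAt_time hT n.succ_ne_zero x ht)).derivWithin (uniqueDiffOn_Icc hT t ht)

theorem sum (hL : 0 < L) (hT : 0 < T) (hδ : 0 ≤ δ) (hω : IntervalIntegrable ω volume 0 δ)
    {ι : Type*} (I : Finset ι) {V : ι → ℝ → ℝ → ℝ} {G : ι → ℝ → ℝ → ℝ}
    (hV : ∀ i ∈ I, IsSmoothOfOrder T (n + 2) (V i))
    (h : ∀ i ∈ I, SolvesWave L T δ ω (V i) (G i)) :
    SolvesWave L T δ ω (fun x t => ∑ i ∈ I, V i x t) (fun x t => ∑ i ∈ I, G i x t) := by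
  refine ⟨fun t ht x => Finset.sum_congr rfl fun i hi => (h i hi).periodic t ht x,
    fun x t ht => ?_⟩
  have ht' := Ioo_subset_Icc_self ht
  rw [timeDeriv_congr (v := fun x t => ∑ i ∈ I, timeDeriv T (V i) x t)
      (fun τ hτ => timeDeriv_sum hT I hV x hτ) ht',
    timeDeriv_sum hT I (fun i hi => IsSmoothOfOrder.time hT (hV i hi)) x ht', nonlocalLap_sum,
    ← Finset.sum_add_distrib]
  · exact Finset.sum_congr rfl fun i hi => (h i hi).wave x t ht
  · intro i hi
    obtain ⟨h1, h2, -, B, -, hB⟩ := (hV i hi).exists_space_bound hL hT (h i hi).periodic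
    exact intervalIntegrable_lap hδ hω (h1 t ht') (h2 t ht') (hB t ht') x

theorem sub (hL : 0 < L) (hT : 0 < T) (hδ : 0 ≤ δ) (hω : IntervalIntegrable ω volume 0 δ)
    {V G : ℝ → ℝ → ℝ} (hU : IsSmoothOfOrder T (n + 2) U) (hV : IsSmoothOfOrder T (n + 2) V)
    (h : SolvesWave L T δ ω U F) (h' : SolvesWave L T δ ω V G) :
    SolvesWave L T δ ω (fun x t => U x t - V x t) (fun x t => F x t - G x t) := by
  refine ⟨fun t ht => (h.periodic t ht).sub (h'.periodic t ht), fun x t ht => ?_⟩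
  have ht' := Ioo_subset_Icc_self ht
  obtain ⟨h1, h2, -, B, -, hB⟩ := hU.exists_space_bound hL hT h.periodic
  obtain ⟨h1', h2', -, B', -, hB'⟩ := hV.exists_space_bound hL hT h'.periodic
  rw [timeDeriv_congr (v := fun x t => timeDeriv T U x t - timeDeriv T V x t)
      (fun τ hτ => timeDeriv_sub hT hU hV x hτ) ht',
    timeDeriv_sub hT (IsSmoothOfOrder.time hT hU) (IsSmoothOfOrder.time hT hV) x ht',
    nonlocalLap_sub (intervalIntegrable_lap hδ hω (h1 t ht') (h2 t ht') (hB t ht') x)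
      (intervalIntegrable_lap hδ hω (h1' t ht') (h2' t ht') (hB' t ht') x),
    h.wave x t ht, h'.wave x t ht]
  ring

/-- Difference quotients of solutions are solutions. -/
theorem diffQuot (hL : 0 < L) (hT : 0 < T) (hδ : 0 ≤ δ) (hω : IntervalIntegrable ω volume 0 δ)
    (hU : IsSmoothOfOrder T (n + 2) U) (h : SolvesWave L T δ ω U (fun _ _ => 0)) (y : ℝ) :
    SolvesWave L T δ ω (fun x t => diffQuot y (fun x => U x t) x) (fun _ _ => 0) := by
  have := ((h.translate y).sub hL hT hδ hω (hU.translate y) hU h).const_mul y⁻¹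
  simpa only [NonlocalDG.diffQuot, div_eq_inv_mul, sub_self, mul_zero] using this

/-- Space derivatives of solutions are solutions. -/
theorem spaceDeriv (hL : 0 < L) (hT : 0 < T) (hδ : 0 ≤ δ) (hω : IntervalIntegrable ω volume 0 δ)
    (hU : IsSmoothOfOrder T (n + 3) U) (h : SolvesWave L T δ ω U (fun _ _ => 0)) :
    SolvesWave L T δ ω (spaceDeriv U) (fun _ _ => 0) := by
  refine ⟨fun t ht => spaceDeriv_periodic (h.periodic t ht), fun x t ht => ?_⟩
  have ht' := Ioo_subset_Icc_self ht
  have hU1 : IsSmoothOfOrder T (n + 2) (NonlocalDG.spaceDeriv U) := hU.space hT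
  obtain ⟨h1, h2, -, B, -, hB⟩ :=
    IsSmoothOfOrder.exists_space_bound (n := n + 1) hL hT hU h.periodic
  obtain ⟨-, h3, -, B', -, hB'⟩ :=
    hU1.exists_space_bound hL hT fun t ht => spaceDeriv_periodic (h.periodic t ht)
  have hUt : IsSmoothOfOrder T (n + 2) (timeDeriv T U) := hU.time hT
  have hUtt : IsSmoothOfOrder T (n + 1) (timeDeriv T (timeDeriv T U)) := hUt.time hT
  have hlap := hasDerivAt_lap hδ hω (h1 t ht') (h2 t ht') (h3 t ht') (hB t ht') (hB' t ht') x
  have hcomm : timeDeriv T (timeDeriv T (NonlocalDG.spaceDeriv U)) x t =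
      NonlocalDG.spaceDeriv (timeDeriv T (timeDeriv T U)) x t := by
    rw [← hUt.timeDeriv_spaceDeriv hT x ht']
    exact timeDeriv_congr (fun τ hτ => hU.timeDeriv_spaceDeriv hT x hτ) ht'
  rw [hcomm, add_zero]
  have h4 := hUtt.hasDerivAt_space n.succ_ne_zero x ht'
  -- Both sides differentiate the same function of x, since the equation for U holds on the whole
  -- line.
  refine h4.unique (hlap.congr_of_eventuallyEq (.of_forall fun y => ?_))
  simpa only [add_zero] using h.wave y t ht

end SolvesWave

/-! ### The discrete energy argument -/

namespace OrthoBasis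

variable {a b : ℝ} {m : Mesh a b} {k : ℕ} {ι : Type} [Fintype ι] [DecidableEq ι]
  (φ : OrthoBasis m k ι)

/-- The squared `L²`-distance of the projections of `f` and `g` onto `V_h^k`. -/
noncomputable def dist2 (_φ : OrthoBasis m k ι) (f g : ℝ → ℝ) : ℝ :=
  ∑ i, (_φ.coef f i - _φ.coef g i) ^ 2

theorem dist2_nonneg (f g : ℝ → ℝ) : 0 ≤ φ.dist2 f g := Finset.sum_nonneg fun _ _ => sq_nonneg _

theorem exists_coef_bound (hab : a < b) : ∃ K, 0 ≤ K ∧ ∀ i, ∀ f : ℝ → ℝ, ∀ B, 0 ≤ B →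
    PerBdd (b - a) f → (∀ x, |f x| ≤ B) → |φ.coef f i| ≤ K * B := by
  refine ⟨Real.sqrt (b - a), Real.sqrt_nonneg _, fun i f B hB0 hf hB => ?_⟩
  have hn : ∑ i, φ.coef f i ^ 2 ≤ l2Norm a b f ^ 2 := φ.sum_coef_sq_le hab hf
  have h1 : φ.coef f i ^ 2 ≤ ∑ i, φ.coef f i ^ 2 :=
    Finset.single_le_sum (f := fun i => φ.coef f i ^ 2) (fun i _ => sq_nonneg _)
      (Finset.mem_univ i)
  have h2 : ∫ x in a..b, f x ^ 2 ≤ ∫ _ in a..b, B ^ 2 :=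
    intervalIntegral.integral_mono_on (μ := volume) hab.le (hf.sq.intervalIntegrable _ _)
      intervalIntegrable_const fun x _ => sq_le_sq' (neg_le_of_abs_le (hB x)) (le_of_abs_le (hB x))
  rw [intervalIntegral.integral_const, smul_eq_mul, ← l2Norm_sq hab.le] at h2
  refine abs_le_of_sq_le_sq (h1.trans (hn.trans (h2.trans ?_))) (by positivity)
  rw [mul_pow, Real.sq_sqrt (sub_pos.2 hab).le]

/-- The consistency identity behind the energy estimate: with `ξ = ∑ X_i φ_i` and
`ζ = ∑ z_l φ_l`, where `c' = X + coef V` and `z = d - coef Q`. -/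
theorem energy_identity_le (hab : a < b) {Q V : ℝ → ℝ} (hQ : PerBdd (b - a) Q)
    (hV : PerBdd (b - a) V) {α s : ℝ} (hs : s ≠ 0) (hαQ : ShiftBound m k (φ.err Q) α)
    (hαV : ShiftBound m k (φ.err V) α) (c' d : ι → ℝ) :
    -(∑ i, (c' i - φ.coef V i) * (∑ l, d l * φ.stiff s i l -
        ∫ x in a..b, Q x * diffQuot s (φ.fn i) x)) +
      ∑ l, (d l - φ.coef Q l) * ((∑ i, c' i * φ.stiff s i l) - φ.coef (diffQuot s V) l) ≤
      α * Real.sqrt (∑ i, (c' i - φ.coef V i) ^ 2) +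
        α * Real.sqrt (∑ l, (d l - φ.coef Q l) ^ 2) := by
  set X : ι → ℝ := fun i => c' i - φ.coef V i with hX
  set z : ι → ℝ := fun l => d l - φ.coef Q l with hz
  have hn : ∀ c : ι → ℝ, l2Norm a b (φ.comb c) = Real.sqrt (∑ i, c i ^ 2) := fun c => by
    rw [← φ.l2Norm_comb_sq hab, Real.sqrt_sq (l2Norm_nonneg _ _ _)]
  have hξ := φ.comb_perBdd hab X
  have hξs := hξ.diffQuot s
  -- the term with the projection error of `Q`
  have b1 : |∫ x in a..b, φ.err Q x * diffQuot s (φ.comb X) x| ≤ α * Real.sqrt (∑ i, X i ^ 2) := by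
    have h := hαQ.abs_integral_diffQuot_le (φ.comb_memVh X) (neg_ne_zero.2 hs)
    rw [integral_diffQuot_mul (φ.err_perBdd hab hQ) hξ, neg_neg, abs_neg, hn] at h
    exact h
  have b2 : |∫ x in a..b, diffQuot s (φ.err V) x * φ.comb z x| ≤
      α * Real.sqrt (∑ l, z l ^ 2) := by
    have h := hαV.abs_integral_diffQuot_le (φ.comb_memVh z) hs
    rwa [hn] at h
  have e1 : ∫ x in a..b, φ.err Q x * diffQuot s (φ.comb X) x =
      (∑ l, φ.coef Q l * ∑ i, X i * φ.stiff s i l) -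
        ∑ i, X i * ∫ x in a..b, Q x * diffQuot s (φ.fn i) x := by
    have h1 : ∫ x in a..b, φ.err Q x * diffQuot s (φ.comb X) x =
        (∫ x in a..b, diffQuot s (φ.comb X) x * φ.comb (φ.coef Q) x) -
          ∫ x in a..b, Q x * diffQuot s (φ.comb X) x := by
      rw [← intervalIntegral.integral_sub
        ((hξs.mul (φ.comb_perBdd hab _)).intervalIntegrable _ _)
        ((hQ.mul hξs).intervalIntegrable _ _)]
      exact intervalIntegral.integral_congr fun x _ => by simp only [err]; ring
    rw [h1, φ.integral_mul_comb hab hξs]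
    simp only [φ.coef_diffQuot_comb hab]
    congr 1
    simp only [φ.diffQuot_comb, Finset.mul_sum]
    rw [intervalIntegral.integral_finsetSum fun i _ =>
      ((hQ.mul (((φ.perBdd hab i).diffQuot s).const_mul (X i))).intervalIntegrable _ _)]
    refine Finset.sum_congr rfl fun i _ => ?_
    rw [← intervalIntegral.integral_const_mul]
    exact intervalIntegral.integral_congr fun x _ => by ring
  have e2 : ∫ x in a..b, diffQuot s (φ.err V) x * φ.comb z x =
      ∑ l, z l * ((∑ i, φ.coef V i * φ.stiff s i l) - φ.coef (diffQuot s V) l) := by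
    rw [φ.integral_mul_comb hab ((φ.err_perBdd hab hV).diffQuot s)]
    refine Finset.sum_congr rfl fun l _ => ?_
    rw [← φ.coef_diffQuot_comb hab, ← φ.coef_sub hab ((φ.comb_perBdd hab _).diffQuot s)
      (hV.diffQuot s)]
    congr 2
    funext x
    simp only [diffQuot, err]
    ring
  -- The product of the flux error z with the difference quotient of the velocity error X occurs
  -- here and in `e4`, and enters the claim with opposite signs. After it cancels, only the two
  -- projection errors bounded above remain.
  have e3 : ∑ i, X i * ∑ l, d l * φ.stiff s i l =
      (∑ l, z l * ∑ i, X i * φ.stiff s i l) + ∑ l, φ.coef Q l * ∑ i, X i * φ.stiff s i l := by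
    rw [← Finset.sum_add_distrib]
    simp only [Finset.mul_sum]
    rw [Finset.sum_comm]
    refine Finset.sum_congr rfl fun l _ => ?_
    rw [← Finset.sum_add_distrib]
    exact Finset.sum_congr rfl fun i _ => by simp only [hz]; ring
  have e4 : ∑ l, z l * ((∑ i, c' i * φ.stiff s i l) - φ.coef (diffQuot s V) l) =
      (∑ l, z l * ∑ i, X i * φ.stiff s i l) +
        ∑ l, z l * ((∑ i, φ.coef V i * φ.stiff s i l) - φ.coef (diffQuot s V) l) := by
    rw [← Finset.sum_add_distrib]
    refine Finset.sum_congr rfl fun l _ => ?_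
    rw [← mul_add]
    congr 1
    rw [← add_sub_assoc, ← Finset.sum_add_distrib]
    congr 1
    exact Finset.sum_congr rfl fun i _ => by simp only [hX]; ring
  have e5 : ∑ i, X i * (∑ l, d l * φ.stiff s i l - ∫ x in a..b, Q x * diffQuot s (φ.fn i) x) =
      (∑ i, X i * ∑ l, d l * φ.stiff s i l) -
        ∑ i, X i * ∫ x in a..b, Q x * diffQuot s (φ.fn i) x := by
    rw [← Finset.sum_sub_distrib]
    exact Finset.sum_congr rfl fun i _ => mul_sub _ _ _
  have h1 := neg_le_of_abs_le b1
  have h2 := le_of_abs_le b2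
  rw [e1] at h1
  rw [e2] at h2
  rw [e5, e3, e4]
  linarith

end OrthoBasis

theorem abs_sum_two_mul_le {ι : Type} [Fintype ι] {x y : ι → ℝ} {D : ℝ} (hx : ∀ i, |x i| ≤ D)
    (hy : ∀ i, |y i| ≤ D) : |∑ i, 2 * x i * y i| ≤ Fintype.card ι * (2 * D * D) := by
  refine (Finset.abs_sum_le_sum_abs _ _).trans ?_
  rw [← nsmul_eq_mul, ← Finset.card_univ]
  refine Finset.sum_le_card_nsmul _ _ _ fun i _ => ?_
  have := (abs_nonneg _).trans (hx i)
  rw [abs_mul, abs_mul, abs_two]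
  have := hx i
  have := hy i
  gcongr

/-- Energy estimate for the difference between the discrete solution and a smooth solution `U` of
the nonlocal wave equation, in terms of consistency bounds for the projections of `U_t` and of the
difference quotients of `U`. -/
theorem IsDGSolution.energy {a b T δ M α : ℝ} {γ : ℝ → ℝ} {m : Mesh a b} {k n : ℕ}
    {uh : ℝ → ℝ → ℝ} {qh : ℝ → ℝ → ℝ → ℝ} {U : ℝ → ℝ → ℝ} {ι : Type} [Fintype ι] [DecidableEq ι]
    (φ : OrthoBasis m k ι) (hab : a < b) (hT : 0 < T) (hδ : 0 < δ)
    (hω : IntervalIntegrable (fun s => s ^ 2 * γ s) volume 0 δ) (hγ : ∀ s, 0 ≤ γ s)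
    (hωM : 2 * ∫ s in (0 : ℝ)..δ, s ^ 2 * γ s ≤ M)
    (h : IsDGSolution T δ γ m k uh qh) (hU : IsSmoothOfOrder T (n + 3) U)
    (hwave : SolvesWave (b - a) T δ (fun s => s ^ 2 * γ s) U (fun _ _ => 0)) (hα : 0 ≤ α)
    (hα1 : ∀ t ∈ Ioo 0 T, ShiftBound m k (φ.err fun x => timeDeriv T U x t) α)
    (hα2 : ∀ t ∈ Ioo 0 T, ∀ s ∈ Ioc 0 δ, ShiftBound m k (φ.err (diffQuot s fun x => U x t)) α) :
    ∀ t ∈ Icc 0 T,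
      φ.dist2 (fun x => uh x t) (fun x => U x t) / 2 +
        φ.dist2 (fun x => timeDeriv T uh x t) (fun x => timeDeriv T U x t) / 2 +
        ∫ s in (0 : ℝ)..δ, s ^ 2 * γ s *
          φ.dist2 (diffQuot s fun x => uh x t) (diffQuot s fun x => U x t) ≤
      Real.exp (3 * T) * (φ.dist2 (fun x => uh x 0) (fun x => U x 0) / 2 +
        φ.dist2 (fun x => timeDeriv T uh x 0) (fun x => timeDeriv T U x 0) / 2 +
        (∫ s in (0 : ℝ)..δ, s ^ 2 * γ s *
          φ.dist2 (diffQuot s fun x => uh x 0) (diffQuot s fun x => U x 0)) +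
        α ^ 2 * (M ^ 2 + M) / 2 * T) := by
  have hL := sub_pos.2 hab
  have hU1 : IsSmoothOfOrder T (n + 2) (timeDeriv T U) := hU.time hT
  have hU2 : IsSmoothOfOrder T (n + 1) (timeDeriv T (timeDeriv T U)) := hU1.time hT
  have hper := hwave.periodic
  have hper1 : ∀ t ∈ Icc 0 T, Function.Periodic (fun x => timeDeriv T U x t) (b - a) :=
    fun t ht => timeDeriv_periodic hper ht
  have hUP : ∀ t ∈ Icc 0 T, PerBdd (b - a) fun x => U x t := fun t ht =>
    .of_continuous hL (hper t ht) (hU.continuous_slice ht)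
  have hU1P : ∀ t ∈ Icc 0 T, PerBdd (b - a) fun x => timeDeriv T U x t := fun t ht =>
    .of_continuous hL (hper1 t ht) (hU1.continuous_slice ht)
  obtain ⟨hs1, -, ⟨B1, hB10, hB1⟩, -⟩ :=
    IsSmoothOfOrder.exists_space_bound (n := n + 1) hL hT hU hper
  obtain ⟨hs2, -, ⟨B2, hB20, hB2⟩, -⟩ := hU1.exists_space_bound hL hT hper1
  obtain ⟨A, hA0, hA⟩ := φ.exists_stiff_bound hab δ
  obtain ⟨K, hK0, hK⟩ := φ.exists_coef_bound hab
  -- the coefficients and their time derivatives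
  set c : ι → ℝ → ℝ := fun i t => φ.coef (fun x => uh x t) i with hc
  set c1 : ι → ℝ → ℝ := fun i t => φ.coef (fun x => timeDeriv T uh x t) i with hc1
  set c2 : ι → ℝ → ℝ := fun i t => φ.coef (fun x => timeDeriv T (timeDeriv T uh) x t) i with hc2
  set g : ι → ℝ → ℝ := fun i t => φ.coef (fun x => U x t) i with hg
  set g1 : ι → ℝ → ℝ := fun i t => φ.coef (fun x => timeDeriv T U x t) i with hg1
  set g2 : ι → ℝ → ℝ := fun i t => φ.coef (fun x => timeDeriv T (timeDeriv T U) x t) i with hg2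
  obtain ⟨-, hcC, hcd⟩ := h.timeDeriv_eq hab hT φ 0 (by norm_num)
  obtain ⟨-, hc1C, hc1d⟩ := h.timeDeriv_eq hab hT φ 1 (by norm_num)
  obtain ⟨hc2V, -, -⟩ := h.timeDeriv_eq hab hT φ 2 (by norm_num)
  have hcc : ∀ i, ContinuousOn (c i) (Icc 0 T) := fun i => (hcC i).continuousOn
  have hc1c : ∀ i, ContinuousOn (c1 i) (Icc 0 T) := fun i => (hc1C i).continuousOn
  have hcd' : ∀ i, ∀ t ∈ Ioo 0 T, HasDerivAt (c i) (c1 i t) t := fun i t ht =>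
    (hcd (by norm_num) i t (Ioo_subset_Icc_self ht)).hasDerivAt (Icc_mem_nhds ht.1 ht.2)
  have hc1d' : ∀ i, ∀ t ∈ Ioo 0 T, HasDerivAt (c1 i) (c2 i t) t := fun i t ht =>
    (hc1d (by norm_num) i t (Ioo_subset_Icc_self ht)).hasDerivAt (Icc_mem_nhds ht.1 ht.2)
  have hφi : ∀ i, IntervalIntegrable (φ.fn i) volume a b := fun i =>
    (φ.perBdd hab i).intervalIntegrable _ _
  have hgc : ∀ i, ContinuousOn (g i) (Icc 0 T) := fun i =>
    continuousOn_integral_mul hab.le hU (hφi i)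
  have hg1c : ∀ i, ContinuousOn (g1 i) (Icc 0 T) := fun i =>
    continuousOn_integral_mul hab.le hU1 (hφi i)
  have hgd : ∀ i, ∀ t ∈ Ioo 0 T, HasDerivAt (g i) (g1 i t) t := fun i t ht =>
    hasDerivAt_integral_mul (n := n + 2) hT hab.le hU (hφi i) ht
  have hg1d : ∀ i, ∀ t ∈ Ioo 0 T, HasDerivAt (g1 i) (g2 i t) t := fun i t ht =>
    hasDerivAt_integral_mul (n := n + 1) hT hab.le hU1 (hφi i) ht
  -- the fluxes
  set G : ι → ℝ → ℝ → ℝ := fun l s t => φ.coef (diffQuot s fun x => U x t) l with hG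
  set G1 : ι → ℝ → ℝ → ℝ := fun l s t => φ.coef (diffQuot s fun x => timeDeriv T U x t) l with hG1
  -- With the quotient moved to the basis function, the coefficient is an integral of U against a
  -- weight independent of t, and can be differentiated under the integral.
  have hGeq : ∀ l s, ∀ t ∈ Icc 0 T,
      G l s t = -∫ x in a..b, U x t * diffQuot (-s) (φ.fn l) x := fun l s t ht =>
    integral_diffQuot_mul (hUP t ht) (φ.perBdd hab l) s
  have hG1eq : ∀ l s, ∀ t ∈ Icc 0 T,
      G1 l s t = -∫ x in a..b, timeDeriv T U x t * diffQuot (-s) (φ.fn l) x := fun l s t ht =>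
    integral_diffQuot_mul (hU1P t ht) (φ.perBdd hab l) s
  have hφs : ∀ l s, IntervalIntegrable (diffQuot (-s) (φ.fn l)) volume a b := fun l s =>
    ((φ.perBdd hab l).diffQuot (-s)).intervalIntegrable _ _
  have hGc : ∀ l s, ContinuousOn (G l s) (Icc 0 T) := fun l s =>
    (continuousOn_integral_mul hab.le hU (hφs l s)).neg.congr (hGeq l s)
  have hGd : ∀ l s, ∀ t ∈ Ioo 0 T, HasDerivAt (G l s) (G1 l s t) t := fun l s t ht => by
    rw [hG1eq l s t (Ioo_subset_Icc_self ht)]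
    refine (hasDerivAt_integral_mul (n := n + 2) hT hab.le hU (hφs l s) ht).neg.congr_of_eventuallyEq
      ?_
    filter_upwards [Ioo_mem_nhds ht.1 ht.2] with τ hτ using hGeq l s τ (Ioo_subset_Icc_self hτ)
  have hGB : ∀ l s, ∀ t ∈ Icc 0 T, |G l s t| ≤ K * B1 := fun l s t ht =>
    hK l _ B1 hB10 ((hUP t ht).diffQuot s) (abs_diffQuot_le (hs1 t ht) (hB1 t ht) s)
  have hG1B : ∀ l s, ∀ t ∈ Icc 0 T, |G1 l s t| ≤ K * B2 := fun l s t ht =>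
    hK l _ B2 hB20 ((hU1P t ht).diffQuot s) (abs_diffQuot_le (hs2 t ht) (hB2 t ht) s)
  have hGm : ∀ l, ∀ t ∈ Icc 0 T, Measurable fun s => G l s t := fun l t ht =>
    φ.measurable_coef_diffQuot hab (hUP t ht) (hU.continuous_slice ht).measurable l
  have hG1m : ∀ l, ∀ t ∈ Icc 0 T, Measurable fun s => G1 l s t := fun l t ht =>
    φ.measurable_coef_diffQuot hab (hU1P t ht) (hU1.continuous_slice ht).measurable l
  set d : ι → ℝ → ℝ → ℝ := fun l s t => ∑ i, c i t * φ.stiff s i l with hd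
  set d1 : ι → ℝ → ℝ → ℝ := fun l s t => ∑ i, c1 i t * φ.stiff s i l with hd1
  have hdm : ∀ l t, Measurable fun s => d l s t := fun l t =>
    Finset.measurable_sum _ fun n _ => (φ.measurable_stiff hab n l).const_mul _
  have hd1m : ∀ l t, Measurable fun s => d1 l s t := fun l t =>
    Finset.measurable_sum _ fun n _ => (φ.measurable_stiff hab n l).const_mul _
  have hdc : ∀ l s, ContinuousOn (d l s) (Icc 0 T) := fun l s =>
    continuousOn_finsetSum _ fun i _ => (hcc i).mul_const _
  have hdd : ∀ l s, ∀ t ∈ Ioo 0 T, HasDerivAt (d l s) (d1 l s t) t := fun l s t ht =>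
    HasDerivAt.fun_sum fun i _ => (hcd' i t ht).mul_const _
  have hcb : ∀ e : ι → ℝ → ℝ, (∀ i, ContinuousOn (e i) (Icc 0 T)) →
      ∃ D, 0 ≤ D ∧ ∀ l, ∀ s ∈ Ioc 0 δ, ∀ t ∈ Icc 0 T, |∑ i, e i t * φ.stiff s i l| ≤ D := by
    intro e he
    choose C hC using fun i => isCompact_Icc.exists_bound_of_continuousOn (f := e i) (he i)
    refine ⟨∑ i, |C i| * A, Finset.sum_nonneg fun i _ => by positivity, fun l s hs t ht => ?_⟩
    refine (Finset.abs_sum_le_sum_abs _ _).trans (Finset.sum_le_sum fun i _ => ?_)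
    rw [abs_mul]
    exact mul_le_mul ((hC i t ht).trans (le_abs_self _)) (hA s hs i l) (abs_nonneg _)
      (abs_nonneg _)
  obtain ⟨D0, hD00, hD0⟩ := hcb c hcc
  obtain ⟨D1, hD10, hD1⟩ := hcb c1 hc1c
  -- A crude bound, depending on the basis. It only justifies differentiation under the s-integral
  -- and does not enter the final estimate.
  set D : ℝ := max (D0 + K * B1) (D1 + K * B2) with hD
  have hDz : ∀ s ∈ Ioc 0 δ, ∀ t ∈ Icc 0 T, ∀ l, |d l s t - G l s t| ≤ D := fun s hs t ht l =>
    (abs_sub _ _).trans ((add_le_add (hD0 l s hs t ht) (hGB l s t ht)).trans (le_max_left _ _))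
  have hDz1 : ∀ s ∈ Ioc 0 δ, ∀ t ∈ Icc 0 T, ∀ l, |d1 l s t - G1 l s t| ≤ D := fun s hs t ht l =>
    (abs_sub _ _).trans ((add_le_add (hD1 l s hs t ht) (hG1B l s t ht)).trans (le_max_right _ _))
  have hdist : ∀ t ∈ Icc 0 T, ∀ s,
      φ.dist2 (diffQuot s fun x => uh x t) (diffQuot s fun x => U x t) =
        ∑ l, (d l s t - G l s t) ^ 2 := fun t ht s => by
    refine Finset.sum_congr rfl fun l _ => ?_
    rw [φ.coef_congr_ae (diffQuot_congr_ae (φ.ae_eq_comb_coef hab (h.mem_u t ht)) s),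
      φ.coef_diffQuot_comb hab]
  have h0T : (0 : ℝ) ∈ Icc 0 T := ⟨le_rfl, hT.le⟩
  have hω0 : ∀ s, 0 ≤ s ^ 2 * γ s := fun s => mul_nonneg (sq_nonneg s) (hγ s)
  -- Y, X and Z are squared norms of coefficient vectors: u_h - U, its time derivative, and its
  -- difference quotient, all projected to V_h^k.
  have hest := energy_estimate (T := T) (δ := δ) (M := M) (α := α) (ρ := 0)
    (B := Fintype.card ι * (2 * D * D)) hδ.le hω hω0 hωM
    (Y := fun t => ∑ i, (c i t - g i t) ^ 2)
    (Y' := fun t => ∑ i, 2 * (c i t - g i t) * (c1 i t - g1 i t))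
    (X := fun t => ∑ i, (c1 i t - g1 i t) ^ 2)
    (X' := fun t => ∑ i, 2 * (c1 i t - g1 i t) * (c2 i t - g2 i t))
    (Z := fun s t => ∑ l, (d l s t - G l s t) ^ 2)
    (Z' := fun s t => ∑ l, 2 * (d l s t - G l s t) * (d1 l s t - G1 l s t))
    (fun t => Finset.sum_nonneg fun _ _ => sq_nonneg _)
    (fun t => Finset.sum_nonneg fun _ _ => sq_nonneg _)
    (fun s t => Finset.sum_nonneg fun _ _ => sq_nonneg _)
    (continuousOn_finsetSum _ fun i _ => ((hcc i).sub (hgc i)).pow 2)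
    (continuousOn_finsetSum _ fun i _ => ((hc1c i).sub (hg1c i)).pow 2)
    (fun s _ => continuousOn_finsetSum _ fun l _ => ((hdc l s).sub (hGc l s)).pow 2)
    (fun t ht => HasDerivAt.fun_sum fun i _ => by
      simpa using ((hcd' i t ht).fun_sub (hgd i t ht)).fun_pow 2)
    (fun t ht => HasDerivAt.fun_sum fun i _ => by
      simpa using ((hc1d' i t ht).fun_sub (hg1d i t ht)).fun_pow 2)
    (fun s _ t ht => HasDerivAt.fun_sum fun l _ => by
      simpa using ((hdd l s t ht).fun_sub (hGd l s t ht)).fun_pow 2)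
    (fun t ht => (Finset.measurable_sum _ fun l _ =>
      ((hdm l t).sub (hGm l t ht)).pow_const 2).aestronglyMeasurable)
    (fun t ht => (Finset.measurable_sum _ fun l _ =>
      (((hdm l t).sub (hGm l t ht)).const_mul 2).mul
        ((hd1m l t).sub (hG1m l t ht))).aestronglyMeasurable)
    (fun s hs t ht => by
      have h1 := abs_sum_two_mul_le (hDz s hs t ht) (hDz s hs t ht)
      refine le_trans ?_ h1
      have h2 : ∑ l, 2 * (d l s t - G l s t) * (d l s t - G l s t) =
          2 * ∑ l, (d l s t - G l s t) ^ 2 := by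
        rw [Finset.mul_sum]; exact Finset.sum_congr rfl fun l _ => by ring
      rw [h2, abs_mul, abs_two]
      linarith [abs_nonneg (∑ l, (d l s t - G l s t) ^ 2)])
    (fun s hs t ht => abs_sum_two_mul_le (hDz s hs t ht) (hDz1 s hs t ht))
    (fun t ht => by
      rw [← Finset.sum_add_distrib]
      exact Finset.sum_le_sum fun i _ => two_mul_le_add_sq _ _)
    ?_ hα
  · intro t ht
    have := hest t ht
    simp only [hdist t ht, hdist 0 h0T]
    rw [zero_pow two_ne_zero, zero_add] at this
    exact this
  · intro t ht
    have ht' := Ioo_subset_Icc_self ht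
    set I : ι → ℝ → ℝ := fun i s =>
      ∫ x in a..b, diffQuot s (fun x => U x t) x * diffQuot s (φ.fn i) x with hI
    have hw := fun i => hwave.weak (n := n + 1) hab hT hδ.le hω hU ht (φ.perBdd hab i)
    have hdi : ∀ i, IntervalIntegrable
        (fun s => s ^ 2 * γ s * ∑ l, d l s t * φ.stiff s i l) volume 0 δ := fun i => by
      refine intervalIntegrable_weight_mul (B := Fintype.card ι * (D0 * A)) hδ.le hω
        (Finset.measurable_sum _ fun l _ =>
          (hdm l t).mul (φ.measurable_stiff hab i l)).aestronglyMeasurable fun s hs => ?_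
      refine (Finset.abs_sum_le_sum_abs _ _).trans ?_
      rw [← nsmul_eq_mul, ← Finset.card_univ]
      refine Finset.sum_le_card_nsmul _ _ _ fun l _ => ?_
      rw [abs_mul]
      exact mul_le_mul (hD0 l s hs t ht') (hA s hs i l) (abs_nonneg _) hD00
    have hc2e : ∀ i, c2 i t = -2 * ∫ s in (0 : ℝ)..δ, s ^ 2 * γ s * ∑ l, d l s t * φ.stiff s i l := by
      intro i
      have := h.wave_coef hab hδ hω φ ht' i ((hc2V t ht').perBdd hab)
      simp only [hc2]
      rw [this]
      congr 1
      refine intervalIntegral.integral_congr_ae (.of_forall fun s hs => ?_)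
      rw [uIoc_of_le hδ.le] at hs
      simp only [h.coef_flux_eq_sum hab φ ht' hs, hd, hc]
    have hg2e : ∀ i, g2 i t = -2 * ∫ s in (0 : ℝ)..δ, s ^ 2 * γ s * I i s := by
      intro i
      have := (hw i).2
      simp only [zero_mul, intervalIntegral.integral_zero, add_zero] at this
      exact this
    have hp : ∀ s, s ^ 2 * γ s * -∑ i, (c1 i t - g1 i t) * (∑ l, d l s t * φ.stiff s i l - I i s) =
        ∑ i, -(c1 i t - g1 i t) *
          (s ^ 2 * γ s * ∑ l, d l s t * φ.stiff s i l - s ^ 2 * γ s * I i s) := fun s => by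
      rw [mul_neg, Finset.mul_sum, ← Finset.sum_neg_distrib]
      exact Finset.sum_congr rfl fun i _ => by ring
    have hpi : ∀ i, IntervalIntegrable (fun s => -(c1 i t - g1 i t) *
        (s ^ 2 * γ s * ∑ l, d l s t * φ.stiff s i l - s ^ 2 * γ s * I i s)) volume 0 δ :=
      fun i => ((hdi i).sub (hw i).1).const_mul _
    -- The choice of p: minus the velocity error paired with the flux residual. Then X'/2 equals
    -- 2∫ωp exactly, and the consistency identity bounds p + Z'/2.
    refine ⟨fun s => -∑ i, (c1 i t - g1 i t) * (∑ l, d l s t * φ.stiff s i l - I i s), ?_, ?_, ?_⟩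
    · simp only [hp]
      rw [intervalIntegrable_iff]
      exact integrable_finsetSum _ fun i _ => intervalIntegrable_iff.1 (hpi i)
    · rw [zero_mul, add_zero]
      simp only [hp]
      rw [intervalIntegral.integral_finsetSum fun i _ => hpi i, Finset.mul_sum, Finset.sum_div]
      refine Finset.sum_le_sum fun i _ => le_of_eq ?_
      rw [intervalIntegral.integral_const_mul, intervalIntegral.integral_sub (hdi i) (hw i).1,
        hc2e, hg2e]
      ring
    · intro s hs
      have h1 := φ.energy_identity_le hab ((hUP t ht').diffQuot s) (hU1P t ht') hs.1.ne'
        (hα2 t ht s hs) (hα1 t ht) (fun i => c1 i t) (fun l => d l s t)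
      refine le_trans (le_of_eq ?_) h1
      congr 1
      rw [Finset.sum_div]
      exact Finset.sum_congr rfl fun l _ => by simp only [hd1, hG, hG1]; ring

/-! ### Kernels, initial data and passage from the energy to the errors -/

namespace IsKernel

variable {δ : ℝ} {γ : ℝ → ℝ}

theorem intervalIntegrable (hδ : 0 < δ) (h : IsKernel δ γ) :
    IntervalIntegrable (fun s => s ^ 2 * γ s) volume 0 δ :=
  h.integrable.mono_set (by
    rw [uIcc_of_le hδ.le, uIcc_of_le (by linarith)]
    exact Icc_subset_Icc (by linarith) le_rfl)

theorem two_mul_integral (hδ : 0 < δ) (h : IsKernel δ γ) :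
    2 * ∫ s in (0 : ℝ)..δ, s ^ 2 * γ s = kernelMass δ γ := by
  have h1 : IntervalIntegrable (fun s => s ^ 2 * γ s) volume (-δ) 0 :=
    h.integrable.mono_set (by
      rw [uIcc_of_le (by linarith), uIcc_of_le (by linarith)]
      exact Icc_subset_Icc le_rfl hδ.le)
  rw [kernelMass, ← intervalIntegral.integral_add_adjacent_intervals h1 (h.intervalIntegrable hδ)]
  have h2 := intervalIntegral.integral_comp_neg (a := 0) (b := δ) (fun s => s ^ 2 * γ s)
  simp only [neg_sq, h.radial, neg_zero] at h2
  rw [h2]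
  ring

end IsKernel

theorem ShiftBound.mono {a b : ℝ} {m : Mesh a b} {k : ℕ} {η : ℝ → ℝ} {α β : ℝ}
    (h : ShiftBound m k η α) (hαβ : α ≤ β) : ShiftBound m k η β := fun σ v hv =>
  (h σ v hv).trans (by
    have := l2Norm_nonneg a b v
    gcongr)

theorem ShiftBound.congr_ae {a b : ℝ} {m : Mesh a b} {k : ℕ} {η ζ : ℝ → ℝ} {α : ℝ}
    (h : ShiftBound m k η α) (e : ∀ᵐ x, ζ x = η x) : ShiftBound m k ζ α := fun σ v hv => by
  refine le_of_eq_of_le ?_ (h σ v hv)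
  congr 1
  refine intervalIntegral.integral_congr_ae ?_
  filter_upwards [e, ae_translate e σ] with x h1 h2 _
  rw [h1, h2]

theorem l2Norm_le_of_abs_le {a b B : ℝ} (hab : a < b) {f : ℝ → ℝ} (hf : PerBdd (b - a) f)
    (hB0 : 0 ≤ B) (hB : ∀ x, |f x| ≤ B) : l2Norm a b f ≤ Real.sqrt (b - a) * B := by
  have h2 : ∫ x in a..b, f x ^ 2 ≤ ∫ _ in a..b, B ^ 2 :=
    intervalIntegral.integral_mono_on (μ := volume) hab.le (hf.sq.intervalIntegrable _ _)
      intervalIntegrable_const fun x _ => sq_le_sq' (neg_le_of_abs_le (hB x)) (le_of_abs_le (hB x))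
  rw [intervalIntegral.integral_const, smul_eq_mul] at h2
  rw [l2Norm]
  refine (Real.sqrt_le_sqrt h2).trans (le_of_eq ?_)
  rw [Real.sqrt_mul (sub_pos.2 hab).le, Real.sqrt_sq hB0]

namespace OrthoBasis

variable {a b : ℝ} {m : Mesh a b} {k : ℕ} {ι : Type} [Fintype ι] [DecidableEq ι]
  (φ : OrthoBasis m k ι)

theorem dist2_le (hab : a < b) {f g : ℝ → ℝ} (hf : PerBdd (b - a) f) (hg : PerBdd (b - a) g) :
    φ.dist2 f g ≤ l2Norm a b (fun x => f x - g x) ^ 2 := by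
  simp only [dist2, ← φ.coef_sub hab hf hg]
  exact φ.sum_coef_sq_le hab (hf.sub hg)

theorem dist2_triangle (f g r : ℝ → ℝ) :
    φ.dist2 f r ≤ 2 * φ.dist2 f g + 2 * φ.dist2 g r := by
  simp only [dist2, Finset.mul_sum, ← Finset.sum_add_distrib]
  refine Finset.sum_le_sum fun i _ => ?_
  nlinarith [sq_nonneg (φ.coef f i - φ.coef g i - (φ.coef g i - φ.coef r i))]

theorem l2Norm_comb (hab : a < b) (c : ι → ℝ) :
    l2Norm a b (φ.comb c) = Real.sqrt (∑ i, c i ^ 2) := by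
  rw [← φ.l2Norm_comb_sq hab, Real.sqrt_sq (l2Norm_nonneg _ _ _)]

/-- Test the shift bound with the projection of the difference quotient itself: its squared norm S
satisfies S ≤ α√S. -/
theorem dist2_diffQuot_le (hab : a < b) {f g : ℝ → ℝ} (hf : PerBdd (b - a) f)
    (hg : PerBdd (b - a) g) {α s : ℝ} (hs : s ≠ 0)
    (h : ShiftBound m k (fun x => f x - g x) α) :
    φ.dist2 (diffQuot s f) (diffQuot s g) ≤ α ^ 2 := by
  set z : ι → ℝ := φ.coef (diffQuot s fun x => f x - g x) with hz
  have e : φ.dist2 (diffQuot s f) (diffQuot s g) = ∑ i, z i ^ 2 := by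
    refine Finset.sum_congr rfl fun i _ => ?_
    rw [← φ.coef_sub hab (hf.diffQuot s) (hg.diffQuot s), hz]
    congr 2
    funext x
    simp only [diffQuot]
    ring
  have h1 := h.abs_integral_diffQuot_le (φ.comb_memVh z) hs
  rw [φ.integral_mul_comb hab ((hf.sub hg).diffQuot s), φ.l2Norm_comb hab] at h1
  have h2 : ∑ i, z i * φ.coef (diffQuot s fun x => f x - g x) i = ∑ i, z i ^ 2 :=
    Finset.sum_congr rfl fun i _ => (sq (z i)).symm
  have h0 : 0 ≤ ∑ i, z i ^ 2 := Finset.sum_nonneg fun _ _ => sq_nonneg _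
  rw [h2, abs_of_nonneg h0] at h1
  rw [e]
  have h3 := Real.sq_sqrt h0
  nlinarith [sq_nonneg (α - Real.sqrt (∑ i, z i ^ 2))]

/-- With P the projection, v - f = P(v - g) + P(g - f) + (Pf - f) almost everywhere, and P is a
contraction. -/
theorem l2Norm_sub_le (hab : a < b) {v f g : ℝ → ℝ} (hv : MemVh m k v) (hf : PerBdd (b - a) f)
    (hg : PerBdd (b - a) g) :
    l2Norm a b (fun x => v x - f x) ≤
      Real.sqrt (φ.dist2 v g) + l2Norm a b (fun x => g x - f x) + l2Norm a b (φ.err f) := by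
  have e : ∀ᵐ x, v x - f x = φ.comb (fun i => φ.coef v i - φ.coef g i) x +
      φ.comb (φ.coef fun x => g x - f x) x + φ.err f x := by
    filter_upwards [φ.ae_eq_comb_coef hab hv] with x hx
    rw [hx]
    simp only [err, comb, φ.coef_sub hab hg hf, ← Finset.sum_add_distrib, ← add_sub_assoc]
    congr 1
    exact Finset.sum_congr rfl fun i _ => by ring
  rw [l2Norm_congr_ae e]
  refine (PerBdd.l2Norm_add_le hab.le ((φ.comb_perBdd hab _).add (φ.comb_perBdd hab _))
    (φ.err_perBdd hab hf)).trans (add_le_add_left ?_ _)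
  refine (PerBdd.l2Norm_add_le hab.le (φ.comb_perBdd hab _) (φ.comb_perBdd hab _)).trans
    (add_le_add (φ.l2Norm_comb hab _).le ?_)
  rw [φ.l2Norm_comb hab]
  exact (Real.sqrt_le_sqrt (φ.sum_coef_sq_le hab (hg.sub hf))).trans_eq
    (Real.sqrt_sq (l2Norm_nonneg _ _ _))

theorem intervalIntegrable_dist2 (hab : a < b) {δ B : ℝ} {ω : ℝ → ℝ} (hδ : 0 ≤ δ)
    (hω : IntervalIntegrable ω volume 0 δ) {v f f' : ℝ → ℝ} (hv : MemVh m k v)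
    (hp : Function.Periodic f (b - a)) (hf : ∀ x, HasDerivAt f (f' x) x) (hB0 : 0 ≤ B)
    (hB : ∀ x, |f' x| ≤ B) :
    IntervalIntegrable (fun s => ω s * φ.dist2 (diffQuot s v) (diffQuot s f)) volume 0 δ := by
  have hc : Continuous f := continuous_iff_continuousAt.2 fun x => (hf x).continuousAt
  have hfP : PerBdd (b - a) f := .of_continuous (sub_pos.2 hab) hp hc
  obtain ⟨A, hA0, hA⟩ := φ.exists_stiff_bound hab δ
  obtain ⟨K, hK0, hK⟩ := φ.exists_coef_bound hab
  have hd : ∀ s i, φ.coef (diffQuot s v) i = ∑ l, φ.coef v l * φ.stiff s l i := fun s i => by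
    rw [φ.coef_congr_ae (diffQuot_congr_ae (φ.ae_eq_comb_coef hab hv) s), φ.coef_diffQuot_comb hab]
  simp only [dist2, hd]
  refine intervalIntegrable_weight_mul
    (B := Fintype.card ι * ((∑ l, |φ.coef v l| * A) + K * B) ^ 2) hδ hω ?_ fun s hs => ?_
  · refine (Finset.measurable_sum _ fun i _ => Measurable.pow_const (Measurable.sub ?_ ?_)
      2).aestronglyMeasurable
    · exact Finset.measurable_sum _ fun l _ => (φ.measurable_stiff hab l i).const_mul _
    · exact φ.measurable_coef_diffQuot hab hfP hc.measurable i
  · refine (Finset.abs_sum_le_sum_abs _ _).trans ?_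
    rw [← nsmul_eq_mul, ← Finset.card_univ]
    refine Finset.sum_le_card_nsmul _ _ _ fun i _ => ?_
    rw [abs_pow]
    refine pow_le_pow_left₀ (abs_nonneg _) ((abs_sub _ _).trans (add_le_add ?_ ?_)) 2
    · refine (Finset.abs_sum_le_sum_abs _ _).trans (Finset.sum_le_sum fun l _ => ?_)
      rw [abs_mul]
      exact mul_le_mul_of_nonneg_left (hA s hs l i) (abs_nonneg _)
    · exact hK i _ B hB0 (hfP.diffQuot s) (abs_diffQuot_le hf hB s)

end OrthoBasis

theorem sq_add_three_le (x y z : ℝ) : (x + y + z) ^ 2 ≤ 3 * (x ^ 2 + y ^ 2 + z ^ 2) := by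
  nlinarith [sq_nonneg (x - y), sq_nonneg (y - z), sq_nonneg (x - z)]

/-- Error bounds at a fixed time from a bound for the discrete energy. -/
theorem IsDGSolution.errors_le {a b T δ M : ℝ} {γ : ℝ → ℝ} {m : Mesh a b} {k n : ℕ}
    {uh : ℝ → ℝ → ℝ} {qh q : ℝ → ℝ → ℝ → ℝ} {u U : ℝ → ℝ → ℝ} {ι : Type} [Fintype ι]
    [DecidableEq ι] (φ : OrthoBasis m k ι) (hab : a < b) (hT : 0 < T) (hδ : 0 < δ)
    (hω : IntervalIntegrable (fun s => s ^ 2 * γ s) volume 0 δ) (hγ : ∀ s, 0 ≤ γ s)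
    (hωM : 2 * ∫ s in (0 : ℝ)..δ, s ^ 2 * γ s ≤ M)
    (h : IsDGSolution T δ γ m k uh qh) (hu : IsSmoothOfOrder T (n + 2) u)
    (hex : IsExactSolution a b T δ γ u q)
    (hU : IsSmoothOfOrder T (n + 2) U)
    (hUp : ∀ t ∈ Icc 0 T, Function.Periodic (fun x => U x t) (b - a)) {t E η₀ η₁ : ℝ}
    (ht : t ∈ Icc 0 T)
    (hE : φ.dist2 (fun x => uh x t) (fun x => U x t) / 2 +
        φ.dist2 (fun x => timeDeriv T uh x t) (fun x => timeDeriv T U x t) / 2 +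
        ∫ s in (0 : ℝ)..δ, s ^ 2 * γ s *
          φ.dist2 (diffQuot s fun x => uh x t) (diffQuot s fun x => U x t) ≤ E)
    (h0 : l2Norm a b (fun x => U x t - u x t) ≤ η₀) (h1 : l2Norm a b (φ.err fun x => u x t) ≤ η₁)
    (h2 : ∀ s ∈ Ioc 0 δ, l2Norm a b
      (fun x => diffQuot s (fun x => U x t) x - diffQuot s (fun x => u x t) x) ≤ η₀)
    (h3 : ∀ s ∈ Ioc 0 δ, l2Norm a b (φ.err (diffQuot s fun x => u x t)) ≤ η₁) :
    l2Norm a b (fun x => uh x t - u x t) ^ 2 ≤ 3 * (2 * E + η₀ ^ 2 + η₁ ^ 2) ∧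
    IntervalIntegrable
      (fun s => s ^ 2 * γ s * l2Norm a b (fun x => qh x t s - q x t s) ^ 2) volume 0 δ ∧
    ∫ s in (0 : ℝ)..δ, s ^ 2 * γ s * l2Norm a b (fun x => qh x t s - q x t s) ^ 2 ≤
      3 * (E + (η₀ ^ 2 + η₁ ^ 2) * (M / 2)) := by
  have hL := sub_pos.2 hab
  have hω0 : ∀ s, 0 ≤ s ^ 2 * γ s := fun s => mul_nonneg (sq_nonneg s) (hγ s)
  have huP : PerBdd (b - a) fun x => u x t :=
    .of_continuous hL (hex.periodic t ht) (hu.continuous_slice ht)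
  have hUP : PerBdd (b - a) fun x => U x t :=
    .of_continuous hL (hUp t ht) (hU.continuous_slice ht)
  obtain ⟨hu1, -, ⟨B, hB0, hB⟩, -⟩ := hu.exists_space_bound hL hT hex.periodic
  obtain ⟨hU1, -, ⟨B', hB0', hB'⟩, -⟩ := hU.exists_space_bound hL hT hUp
  have hη₀ : 0 ≤ η₀ := (l2Norm_nonneg _ _ _).trans h0
  have hη₁ : 0 ≤ η₁ := (l2Norm_nonneg _ _ _).trans h1
  have hdi := φ.intervalIntegrable_dist2 hab hδ.le hω (h.mem_u t ht) (hUp t ht) (hU1 t ht) hB0'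
    (hB' t ht)
  have hd0 := φ.dist2_nonneg (fun x => uh x t) (fun x => U x t)
  have hd1 := φ.dist2_nonneg (fun x => timeDeriv T uh x t) (fun x => timeDeriv T U x t)
  have hdI : 0 ≤ ∫ s in (0 : ℝ)..δ, s ^ 2 * γ s *
      φ.dist2 (diffQuot s fun x => uh x t) (diffQuot s fun x => U x t) :=
    intervalIntegral.integral_nonneg hδ.le fun s _ => mul_nonneg (hω0 s) (φ.dist2_nonneg _ _)
  have hqe : ∀ s ∈ Ioc 0 δ, (fun x => q x t s) = diffQuot s fun x => u x t := fun s hs =>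
    funext fun x => sub_eq_zero.1 (hex.flux x t ht s hs)
  have hqb : ∀ s ∈ Ioc 0 δ, l2Norm a b (fun x => qh x t s - q x t s) ^ 2 ≤
      3 * (φ.dist2 (diffQuot s fun x => uh x t) (diffQuot s fun x => U x t) + η₀ ^ 2 +
        η₁ ^ 2) := by
    intro s hs
    have h4 := φ.l2Norm_sub_le hab (h.mem_q t ht s hs) (huP.diffQuot s) (hUP.diffQuot s)
    -- The flux equation says that q_h is the projection of D_s u_h, so the energy controls q_h as
    -- well.
    have h5 : φ.dist2 (fun x => qh x t s) (diffQuot s fun x => U x t) =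
        φ.dist2 (diffQuot s fun x => uh x t) (diffQuot s fun x => U x t) := by
      simp only [OrthoBasis.dist2, h.coef_flux hab φ ht hs]
    have h6 : ∀ x, q x t s = diffQuot s (fun x => u x t) x := fun x => congrFun (hqe s hs) x
    simp only [h6]
    rw [h5] at h4
    refine (pow_le_pow_left₀ (l2Norm_nonneg _ _ _) (h4.trans (add_le_add (add_le_add le_rfl
      (h2 s hs)) (h3 s hs))) 2).trans ((sq_add_three_le _ _ _).trans_eq ?_)
    rw [Real.sq_sqrt (φ.dist2_nonneg _ _)]
  have hint : IntervalIntegrable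
      (fun s => s ^ 2 * γ s * l2Norm a b (fun x => qh x t s - q x t s) ^ 2) volume 0 δ := by
    have hdom : IntervalIntegrable (fun s => 3 * (s ^ 2 * γ s *
        φ.dist2 (diffQuot s fun x => uh x t) (diffQuot s fun x => U x t) +
        s ^ 2 * γ s * (η₀ ^ 2 + η₁ ^ 2))) volume 0 δ :=
      (hdi.add (hω.mul_const _)).const_mul 3
    refine hdom.mono_fun ?_ ?_
    · rw [uIoc_of_le hδ.le]
      have hωm := ((intervalIntegrable_iff_integrableOn_Ioc_of_le hδ.le).1 hω).aestronglyMeasurable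
      refine hωm.mul ?_
      -- The error norm is measurable in s because q_h may be replaced by its coordinate formula,
      -- which is jointly Borel in (s,x) and a.e. equal to it in x.
      set d : ι → ℝ → ℝ := fun l s => ∑ n, φ.coef (fun x => uh x t) n * φ.stiff s n l with hd
      have hdm : ∀ l, Measurable (d l) := fun l =>
        Finset.measurable_sum _ fun n _ => (φ.measurable_stiff hab n l).const_mul _
      have hum : Measurable fun x => u x t := (hu.continuous_slice ht).measurable
      have hjm : Measurable (Function.uncurry fun s x =>
          ((∑ l, d l s * φ.fn l x) - diffQuot s (fun x => u x t) x) ^ 2) := by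
        refine Measurable.pow_const (Measurable.sub ?_ ?_) 2
        · exact Finset.measurable_sum _ fun l _ =>
            ((hdm l).comp measurable_fst).mul ((φ.measurable l).comp measurable_snd)
        · exact ((hum.comp (measurable_snd.add measurable_fst)).sub
            (hum.comp measurable_snd)).div measurable_fst
      have hm := (hjm.stronglyMeasurable.integral_prod_right
        (ν := volume.restrict (Ioc a b))).measurable
      refine hm.aestronglyMeasurable.congr
        ((ae_restrict_iff' measurableSet_Ioc).2 (.of_forall fun s hs => ?_))
      beta_reduce
      rw [l2Norm_sq hab.le, intervalIntegral.integral_of_le hab.le]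
      refine integral_congr_ae (ae_restrict_of_ae ?_)
      filter_upwards [φ.ae_eq_comb_coef hab (h.mem_q t ht s hs)] with x hx
      rw [hx, congrFun (hqe s hs) x]
      simp only [OrthoBasis.comb, h.coef_flux_eq_sum hab φ ht hs, hd]
    · rw [uIoc_of_le hδ.le]
      refine (ae_restrict_iff' measurableSet_Ioc).2 (.of_forall fun s hs => ?_)
      beta_reduce
      rw [Real.norm_of_nonneg (mul_nonneg (hω0 s) (sq_nonneg _))]
      refine le_trans ?_ (Real.le_norm_self _)
      have := mul_le_mul_of_nonneg_left (hqb s hs) (hω0 s)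
      linarith
  refine ⟨?_, hint, ?_⟩
  · have h4 := φ.l2Norm_sub_le hab (h.mem_u t ht) huP hUP
    refine (pow_le_pow_left₀ (l2Norm_nonneg _ _ _) (h4.trans (add_le_add (add_le_add le_rfl
      h0) h1)) 2).trans ((sq_add_three_le _ _ _).trans ?_)
    rw [Real.sq_sqrt hd0]
    linarith
  · have h5 : ∫ s in (0 : ℝ)..δ, s ^ 2 * γ s * l2Norm a b (fun x => qh x t s - q x t s) ^ 2 ≤
        ∫ s in (0 : ℝ)..δ, 3 * (s ^ 2 * γ s *
          φ.dist2 (diffQuot s fun x => uh x t) (diffQuot s fun x => U x t) +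
          s ^ 2 * γ s * (η₀ ^ 2 + η₁ ^ 2)) := by
      refine intervalIntegral.integral_mono_on_of_le_Ioo hδ.le hint
        ((hdi.add (hω.mul_const _)).const_mul 3) fun s hs => ?_
      have := mul_le_mul_of_nonneg_left (hqb s ⟨hs.1, hs.2.le⟩) (hω0 s)
      linarith
    rw [intervalIntegral.integral_const_mul, intervalIntegral.integral_add hdi (hω.mul_const _),
      intervalIntegral.integral_mul_const] at h5
    have h6 := mul_le_mul_of_nonneg_left hωM (by positivity : 0 ≤ η₀ ^ 2 + η₁ ^ 2)
    linarith

theorem IsL2Projection.coef_eq {a b : ℝ} {m : Mesh a b} {k : ℕ} {ι : Type} [Fintype ι]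
    [DecidableEq ι] (φ : OrthoBasis m k ι) (hab : a < b) {f P : ℝ → ℝ} (hf : PerBdd (b - a) f)
    (h : IsL2Projection m k f P) (i : ι) : φ.coef P i = φ.coef f i := by
  have hP := h.1.perBdd hab
  rw [eq_comm, ← sub_eq_zero, ← φ.coef_sub hab hf hP, OrthoBasis.coef,
    ← m.sum_integral ((hf.sub hP).mul (φ.perBdd hab i)).intervalIntegrable]
  refine Finset.sum_eq_zero fun j _ => ?_
  obtain ⟨p, hp, hpe⟩ := (φ.memVh i).2 j
  rw [m.integral_cell_congr j (g := fun x => (f x - P x) * p.eval x) fun x hx => by rw [hpe x hx]]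
  exact h.2 j p hp

theorem IsExactSolution.flux_eq {a b T δ : ℝ} {γ : ℝ → ℝ} {u : ℝ → ℝ → ℝ}
    {q : ℝ → ℝ → ℝ → ℝ} (h : IsExactSolution a b T δ γ u q) {t s : ℝ} (ht : t ∈ Icc 0 T)
    (hs : s ∈ Ioc 0 δ) : (fun x => q x t s) = diffQuot s fun x => u x t :=
  funext fun x => sub_eq_zero.1 (h.flux x t ht s hs)

theorem contDiff_diffQuot {n : ℕ} {f : ℝ → ℝ} (hf : ContDiff ℝ n f) (s : ℝ) :
    ContDiff ℝ n (diffQuot s f) := by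
  unfold diffQuot
  exact ((hf.comp (contDiff_id.add contDiff_const)).sub hf).div_const s

/-! ### Degree k ≥ 1 -/

/-- Error estimate for degree `k ≥ 1` on regular meshes. -/
theorem exists_errorsBounded_of_regular {a b T : ℝ} (hab : a < b) (hT : 0 < T) {k : ℕ}
    (hk : 1 ≤ k) {ν : ℝ} (hν : 0 < ν) (M R : ℝ) : ∃ C : ℝ, 0 < C ∧
      ∀ (δ : ℝ) (γ : ℝ → ℝ), 0 < δ → IsKernel δ γ → kernelMass δ γ ≤ M →
      ∀ (u : ℝ → ℝ → ℝ) (q : ℝ → ℝ → ℝ → ℝ), IsExactSolution a b T δ γ u q →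
        IsSmoothOfOrder T (k + 4) u → SeminormsBounded a b T δ k R u q →
      ∀ m : Mesh a b, m.IsRegular ν → ∀ (uh : ℝ → ℝ → ℝ) (qh : ℝ → ℝ → ℝ → ℝ),
        IsDGSolution T δ γ m k uh qh → HasProjectedData T m k u uh →
        ErrorsBounded a b T δ γ u uh q qh (C * m.size ^ (2 * k)) := by
  obtain ⟨Cs, hCs0, hCs⟩ := exists_shiftBound_const k hν
  obtain ⟨K, hK0, hK⟩ := exists_err_const k
  -- With H = h^k, A·H will be the consistency constant, D·H the projection error (one factor h
  -- being estimated by b - a) and E·H² the energy bound.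
  set A : ℝ := Cs * R with hA
  set D : ℝ := K * (b - a) * R with hD
  set E : ℝ := Real.exp (3 * T) * (A ^ 2 * M / 2 + A ^ 2 * (M ^ 2 + M) / 2 * T) with hE
  -- Absolute values and the added 1 make the constant positive although M and R have no sign yet.
  refine ⟨|3 * (2 * E + D ^ 2)| + |3 * (E + D ^ 2 * (M / 2))| + 1, by positivity, ?_⟩
  intro δ γ hδ hγ hM u q hex hu hR m hm uh qh h hdata
  obtain ⟨φ⟩ := exists_orthoBasis hab m k
  have hL := sub_pos.2 hab
  have h0T : (0 : ℝ) ∈ Icc 0 T := ⟨le_rfl, hT.le⟩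
  have hω := hγ.intervalIntegrable hδ
  have hωM : 2 * ∫ s in (0 : ℝ)..δ, s ^ 2 * γ s ≤ M := (hγ.two_mul_integral hδ).trans_le hM
  have hM0 : 0 ≤ M := hγ.mass_pos.le.trans hM
  have hR0 : 0 ≤ R := (l2Norm_nonneg _ _ _).trans (hR 0 h0T).2.1
  have hs0 := m.size_pos hab
  set H : ℝ := m.size ^ k with hH
  have hH0 : 0 ≤ H := by positivity
  have hu3 : IsSmoothOfOrder T (k + 1 + 3) u := hu
  have hu1 : IsSmoothOfOrder T (k + 1 + 2) (timeDeriv T u) := hu3.time hT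
  have hwave := hex.solvesWave (n := k + 1 + 1) hab hT hδ hω hu3
  have hcd : ∀ t ∈ Icc 0 T, ContDiff ℝ (k + 1 : ℕ) fun x => u x t := fun t ht =>
    (hu.mono (by omega)).contDiff_slice ht
  have hcd1 : ∀ t ∈ Icc 0 T, ContDiff ℝ (k + 1 : ℕ) fun x => timeDeriv T u x t := fun t ht =>
    (hu1.mono (by omega)).contDiff_slice ht
  have hcq : ∀ t ∈ Icc 0 T, ∀ s, ContDiff ℝ (k + 1 : ℕ) (diffQuot s fun x => u x t) :=
    fun t ht s => contDiff_diffQuot (hcd t ht) s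
  have huP : ∀ t ∈ Icc 0 T, PerBdd (b - a) fun x => u x t := fun t ht =>
    .of_continuous hL (hex.periodic t ht) (hcd t ht).continuous
  have hRq : ∀ t ∈ Icc 0 T, ∀ s ∈ Ioc 0 δ,
      hSeminorm a b (k + 1) (diffQuot s fun x => u x t) ≤ R := fun t ht s hs => by
    rw [← hex.flux_eq ht hs]; exact (hR t ht).2.2 s hs
  have hsb : ∀ f : ℝ → ℝ, Function.Periodic f (b - a) → ContDiff ℝ (k + 1 : ℕ) f →
      hSeminorm a b (k + 1) f ≤ R → ShiftBound m k (φ.err f) (A * H) := fun f hp hf hfR =>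
    (hCs hab hm φ hp hf).mono (by
      rw [hA, mul_right_comm Cs R H]
      exact mul_le_mul_of_nonneg_left hfR (mul_nonneg hCs0 hH0))
  have herr : ∀ f : ℝ → ℝ, Function.Periodic f (b - a) → ContDiff ℝ (k + 1 : ℕ) f →
      hSeminorm a b (k + 1) f ≤ R → l2Norm a b (φ.err f) ≤ D * H := fun f hp hf hfR => by
    refine (hK hab φ hp hf).trans ?_
    calc K * m.size ^ (k + 1) * hSeminorm a b (k + 1) f
        ≤ K * m.size ^ (k + 1) * R := by gcongr
      _ = K * m.size * R * H := by rw [hH]; ring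
      _ ≤ D * H := by
        rw [hD]
        have := m.size_le hab
        gcongr
  have hA0 : 0 ≤ A := mul_nonneg hCs0 hR0
  have hqp : ∀ t ∈ Icc 0 T, ∀ s, Function.Periodic (diffQuot s fun x => u x t) (b - a) :=
    fun t ht s => ((huP t ht).diffQuot s).periodic
  have hen := h.energy φ hab hT hδ hω hγ.nonneg hωM hu3 hwave (mul_nonneg hA0 hH0)
    (fun t ht => hsb _ (timeDeriv_periodic hex.periodic (Ioo_subset_Icc_self ht))
      (hcd1 t (Ioo_subset_Icc_self ht)) (hR t (Ioo_subset_Icc_self ht)).1)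
    (fun t ht s hs => hsb _ (hqp t (Ioo_subset_Icc_self ht) s) (hcq t (Ioo_subset_Icc_self ht) s)
      (hRq t (Ioo_subset_Icc_self ht) s hs))
  -- the initial energy
  obtain ⟨hd0, hd1⟩ := hdata.1 hk
  have hc0 := hd0.coef_eq φ hab (huP 0 h0T)
  have hc1 := hd1.coef_eq φ hab (.of_continuous hL (timeDeriv_periodic hex.periodic h0T)
    (hcd1 0 h0T).continuous)
  have hY0 : φ.dist2 (fun x => uh x 0) (fun x => u x 0) = 0 := by simp [OrthoBasis.dist2, hc0]
  have hX0 : φ.dist2 (fun x => timeDeriv T uh x 0) (fun x => timeDeriv T u x 0) = 0 := by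
    simp [OrthoBasis.dist2, hc1]
  -- The first two parts of the initial energy vanish. The third does not, since D_s does not
  -- commute with the projection; but u_h - u is initially a projection error, so its shift bound
  -- applies.
  have hsb0 : ShiftBound m k (fun x => uh x 0 - u x 0) (A * H) := by
    refine (hsb _ (hex.periodic 0 h0T) (hcd 0 h0T) (hR 0 h0T).2.1).congr_ae ?_
    filter_upwards [φ.ae_eq_comb_coef hab hd0.1] with x hx
    simp only [OrthoBasis.err, ← funext hc0]
    rw [hx]
  obtain ⟨hu1', -, ⟨B, hB0, hB⟩, -⟩ := hu3.exists_space_bound hL hT hex.periodic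
  have hZ0 : ∫ s in (0 : ℝ)..δ, s ^ 2 * γ s *
      φ.dist2 (diffQuot s fun x => uh x 0) (diffQuot s fun x => u x 0) ≤
      (A * H) ^ 2 * (M / 2) := by
    have h1 : ∫ s in (0 : ℝ)..δ, s ^ 2 * γ s *
        φ.dist2 (diffQuot s fun x => uh x 0) (diffQuot s fun x => u x 0) ≤
        ∫ s in (0 : ℝ)..δ, s ^ 2 * γ s * (A * H) ^ 2 :=
      intervalIntegral.integral_mono_on_of_le_Ioo hδ.le
        (φ.intervalIntegrable_dist2 hab hδ.le hω hd0.1 (hex.periodic 0 h0T) (hu1' 0 h0T) hB0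
          (hB 0 h0T)) (hω.mul_const _) fun s hs =>
        mul_le_mul_of_nonneg_left (φ.dist2_diffQuot_le hab (hd0.1.perBdd hab) (huP 0 h0T)
          hs.1.ne' hsb0) (mul_nonneg (sq_nonneg s) (hγ.nonneg s))
    rw [intervalIntegral.integral_mul_const] at h1
    have h2 := mul_le_mul_of_nonneg_left hωM (sq_nonneg (A * H))
    linarith
  intro t ht
  have hEt := hen t ht
  rw [hY0, hX0] at hEt
  have hEt' := hEt.trans (b := _) (c := E * H ^ 2) (by
    have h1 : (0 : ℝ) / 2 + 0 / 2 + (∫ s in (0 : ℝ)..δ, s ^ 2 * γ s *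
        φ.dist2 (diffQuot s fun x => uh x 0) (diffQuot s fun x => u x 0)) +
        (A * H) ^ 2 * (M ^ 2 + M) / 2 * T ≤
        (A ^ 2 * M / 2 + A ^ 2 * (M ^ 2 + M) / 2 * T) * H ^ 2 := by linarith
    refine (mul_le_mul_of_nonneg_left h1 (Real.exp_nonneg _)).trans_eq ?_
    rw [hE]; ring)
  -- The comparison solution is u itself, hence η₀ = 0 below.
  have hzero : l2Norm a b (fun x => u x t - u x t) ≤ 0 := by simp [l2Norm]
  obtain ⟨r1, r2, r3⟩ := h.errors_le (n := k + 1 + 1) (η₀ := 0) (η₁ := D * H) φ hab hT hδ hω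
    hγ.nonneg hωM hu3 hex hu3 hex.periodic ht hEt' hzero
    (herr _ (hex.periodic t ht) (hcd t ht) (hR t ht).2.1) (fun s _ => by simp [l2Norm])
    (fun s hs => herr _ (hqp t ht s) (hcq t ht s) (hRq t ht s hs))
  have hHH : m.size ^ (2 * k) = H ^ 2 := by rw [hH, ← pow_mul, mul_comm]
  rw [hHH]
  refine ⟨r1.trans ?_, r2, r3.trans ?_⟩
  · have h1 : 3 * (2 * (E * H ^ 2) + 0 ^ 2 + (D * H) ^ 2) = 3 * (2 * E + D ^ 2) * H ^ 2 := by ring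
    rw [h1]
    refine mul_le_mul_of_nonneg_right ?_ (sq_nonneg H)
    have := le_abs_self (3 * (2 * E + D ^ 2))
    have := abs_nonneg (3 * (E + D ^ 2 * (M / 2)))
    linarith
  · have h1 : 3 * (E * H ^ 2 + (0 ^ 2 + (D * H) ^ 2) * (M / 2)) =
        3 * (E + D ^ 2 * (M / 2)) * H ^ 2 := by ring
    rw [h1]
    refine mul_le_mul_of_nonneg_right ?_ (sq_nonneg H)
    have := le_abs_self (3 * (E + D ^ 2 * (M / 2)))
    have := abs_nonneg (3 * (2 * E + D ^ 2))
    linarith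

/-! ### Degree zero: preparations -/

theorem hSeminorm_one {a b : ℝ} {f f' : ℝ → ℝ} (hf : ∀ x, HasDerivAt f (f' x) x) :
    hSeminorm a b 1 f = l2Norm a b f' := by
  rw [hSeminorm, iteratedDeriv_one]
  congr 1
  exact funext fun x => (hf x).deriv

theorem PerBdd.l2Norm_sum_le {L a b : ℝ} (hab : a ≤ b) {ι : Type*} (I : Finset ι)
    {F : ι → ℝ → ℝ} (h : ∀ i ∈ I, PerBdd L (F i)) :
    l2Norm a b (fun x => ∑ i ∈ I, F i x) ≤ ∑ i ∈ I, l2Norm a b (F i) := by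
  classical
  induction I using Finset.induction_on with
  | empty => simp [l2Norm]
  | insert i I hi ih =>
    simp only [Finset.sum_insert hi]
    have h' : ∀ l ∈ I, PerBdd L (F l) := fun l hl => h l (Finset.mem_insert_of_mem hl)
    exact (PerBdd.l2Norm_add_le hab (h i (Finset.mem_insert_self _ _)) (PerBdd.sum I h')).trans
      (add_le_add_right (ih h') _)

theorem PerBdd.l2Norm_mul_shift_sub_le {a b : ℝ} (hab : a ≤ b) {f : ℝ → ℝ}
    (hf : PerBdd (b - a) f) (s : ℝ) (N : ℕ) :
    l2Norm a b (fun x => f (x + N * s) - f x) ≤ N * l2Norm a b (fun x => f (x + s) - f x) := by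
  induction N with
  | zero => simp [l2Norm]
  | succ N ih =>
    have e : (fun x => f (x + (N + 1 : ℕ) * s) - f x) = fun x =>
        (fun x => f (x + s) - f x) (x + N * s) + (f (x + N * s) - f x) := by
      funext x
      rw [show x + ((N + 1 : ℕ) : ℝ) * s = x + N * s + s by push_cast; ring]
      ring
    have h1 := (hf.translate s).sub hf
    rw [e]
    refine (PerBdd.l2Norm_add_le hab (h1.translate (N * s))
      ((hf.translate (N * s)).sub hf)).trans ?_
    rw [h1.l2Norm_translate]
    push_cast
    linarith

/-! ### Averages over translates by multiples of the mesh size -/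

/-- The average of the translates `f(x + ih)`, `i < n`. -/
noncomputable def average (n : ℕ) (h : ℝ) (f : ℝ → ℝ) (x : ℝ) : ℝ :=
  (n : ℝ)⁻¹ * ∑ i ∈ Finset.range n, f (x + i * h)

/-- Telescoping leaves only the two end translates. The factor 1/n is the whole gain of averaging.
-/
theorem average_shift_sub (n : ℕ) (h : ℝ) (f : ℝ → ℝ) (x : ℝ) :
    average n h f (x + h) - average n h f x = (n : ℝ)⁻¹ * (f (x + n * h) - f x) := by
  rw [average, average, ← mul_sub, ← Finset.sum_sub_distrib]
  congr 1
  have h1 := Finset.sum_range_sub (fun i : ℕ => f (x + i * h)) n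
  simp only [Nat.cast_zero, zero_mul, add_zero] at h1
  rw [← h1]
  refine Finset.sum_congr rfl fun i _ => ?_
  rw [show x + h + i * h = x + ((i + 1 : ℕ) : ℝ) * h by push_cast; ring]

theorem diffQuot_average (n : ℕ) (h s : ℝ) (f : ℝ → ℝ) :
    diffQuot s (average n h f) = average n h (diffQuot s f) := by
  funext x
  simp only [diffQuot, average]
  rw [← mul_sub, ← Finset.sum_sub_distrib, mul_div_assoc, Finset.sum_div]
  congr 1
  exact Finset.sum_congr rfl fun i _ => by rw [add_right_comm]

theorem average_perBdd {L : ℝ} (n : ℕ) (h : ℝ) {f : ℝ → ℝ} (hf : PerBdd L f) :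
    PerBdd L (average n h f) := by
  unfold average
  exact (PerBdd.sum (Finset.range n) fun i _ => hf.translate (i * h)).const_mul _

theorem average_continuous (n : ℕ) (h : ℝ) {f : ℝ → ℝ} (hf : Continuous f) :
    Continuous (average n h f) := by unfold average; fun_prop

/-- The price of averaging: each translate moves the function by at most nh, at cost nh‖f'‖. -/
theorem l2Norm_average_sub_le {a b : ℝ} (hab : a < b) {n : ℕ} (hn : n ≠ 0) {h R : ℝ} (hh : 0 ≤ h)
    {f f' : ℝ → ℝ} (hp : Function.Periodic f (b - a)) (hf : ∀ x, HasDerivAt f (f' x) x)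
    (hf' : Continuous f') (hp' : Function.Periodic f' (b - a)) (hR : l2Norm a b f' ≤ R) :
    l2Norm a b (fun x => average n h f x - f x) ≤ n * h * R := by
  have hR0 := (l2Norm_nonneg _ _ _).trans hR
  have hn' : (n : ℝ) ≠ 0 := Nat.cast_ne_zero.2 hn
  have hfP : PerBdd (b - a) f := .of_continuous (sub_pos.2 hab) hp
    (continuous_iff_continuousAt.2 fun x => (hf x).continuousAt)
  have e : (fun x => average n h f x - f x) = fun x =>
      (n : ℝ)⁻¹ * ∑ i ∈ Finset.range n, (f (x + i * h) - f x) := by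
    funext x
    rw [Finset.sum_sub_distrib, Finset.sum_const, Finset.card_range, nsmul_eq_mul, mul_sub,
      inv_mul_cancel_left₀ hn', average]
  rw [e, l2Norm_const_mul, abs_of_nonneg (by positivity), inv_mul_le_iff₀ (by positivity)]
  refine (PerBdd.l2Norm_sum_le hab.le _ fun i _ => (hfP.translate _).sub hfP).trans ?_
  refine (Finset.sum_le_card_nsmul _ _ (n * h * R) fun i hi => ?_).trans_eq (by simp)
  refine (l2Norm_shift_sub_le hab hf hf' hp' _).trans ?_
  rw [abs_of_nonneg (by positivity)]
  have : (i : ℝ) ≤ n := Nat.cast_le.2 (Finset.mem_range.1 hi).le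
  have := l2Norm_nonneg a b f'
  gcongr

/-- By telescoping, one mesh increment of the average has derivative (f'(x+nh) - f'(x))/n; the
triangle inequality suffices for the numerator. -/
theorem shiftBound_err_average {a b : ℝ} (hab : a < b) {m : Mesh a b} (hm : m.IsUniform)
    {ι : Type} [Fintype ι] [DecidableEq ι] (φ : OrthoBasis m 0 ι) (n : ℕ) {f f' : ℝ → ℝ} {R : ℝ}
    (hp : Function.Periodic f (b - a)) (hf : ∀ x, HasDerivAt f (f' x) x) (hf' : Continuous f')
    (hp' : Function.Periodic f' (b - a)) (hR : l2Norm a b f' ≤ R) :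
    ShiftBound m 0 (φ.err (average n m.size f)) (2 * R / n) := by
  have hL := sub_pos.2 hab
  have hc : Continuous f := continuous_iff_continuousAt.2 fun x => (hf x).continuousAt
  have hfP : PerBdd (b - a) f := .of_continuous hL hp hc
  have hfP' : PerBdd (b - a) f' := .of_continuous hL hp' hf'
  refine (shiftBound_err_of_uniform hab hm φ
    (g' := fun x => (n : ℝ)⁻¹ * (f' (x + n * m.size) - f' x))
    (average_perBdd n _ hfP).periodic (average_continuous n _ hc) (fun x => ?_)
    (by fun_prop)).mono ?_
  · simp only [average_shift_sub]
    exact (((hf _).comp_add_const x _).sub (hf x)).const_mul _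
  · rw [l2Norm_const_mul, abs_of_nonneg (by positivity), inv_mul_eq_div]
    refine div_le_div_of_nonneg_right ?_ (Nat.cast_nonneg n)
    refine (PerBdd.l2Norm_sub_le hab.le (hfP'.translate _) hfP').trans ?_
    rw [hfP'.l2Norm_translate]
    linarith

/-! ### Gauss-Radau data of degree zero -/

theorem IsGaussRadauPlus.eq_left {a b : ℝ} {m : Mesh a b} {f P : ℝ → ℝ} (hf : Continuous f)
    (h : IsGaussRadauPlus m 0 f P) (j : Fin m.N) : ∀ x ∈ m.cell j, P x = f (m.left j) := by
  obtain ⟨c, hc⟩ := h.1.exists_const j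
  have h1 : Tendsto (fun x => f x - P x) (𝓝[>] m.left j) (𝓝 (f (m.left j) - c)) := by
    have h2 : Tendsto (fun x => f x - c) (𝓝[>] m.left j) (𝓝 (f (m.left j) - c)) :=
      (hf.tendsto _).mono_left nhdsWithin_le_nhds |>.sub_const c
    refine h2.congr' ?_
    filter_upwards [Ioo_mem_nhdsGT (m.left_lt_right j)] with x hx
    rw [hc x hx]
  have h3 := tendsto_nhds_unique h1 (h.2.2 j)
  intro x hx
  rw [hc x hx]
  linarith

theorem IsGaussRadauPlus.l2Norm_sub_le {a b : ℝ} (hab : a < b) {m : Mesh a b} {f f' P : ℝ → ℝ}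
    (hp : Function.Periodic f (b - a)) (hf : ∀ x, HasDerivAt f (f' x) x) (hf' : Continuous f')
    (h : IsGaussRadauPlus m 0 f P) :
    l2Norm a b (fun x => P x - f x) ≤ m.size * l2Norm a b f' := by
  have hc : Continuous f := continuous_iff_continuousAt.2 fun x => (hf x).continuousAt
  have hP := (h.1.perBdd hab).sub (.of_continuous (sub_pos.2 hab) hp hc)
  have hs := (m.size_pos hab).le
  refine abs_le_of_sq_le_sq' ?_ (mul_nonneg hs (l2Norm_nonneg _ _ _)) |>.2
  have hi : ∀ x y, IntervalIntegrable (fun x => f' x ^ 2) volume x y :=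
    fun x y => (hf'.pow 2).intervalIntegrable x y
  rw [mul_pow, l2Norm_sq hab.le, l2Norm_sq hab.le, ← m.sum_integral hP.sq.intervalIntegrable,
    ← m.sum_integral hi, Finset.mul_sum]
  refine Finset.sum_le_sum fun j _ => ?_
  have h0 : 0 ≤ ∫ x in m.left j..m.right j, f' x ^ 2 :=
    intervalIntegral.integral_nonneg (m.left_lt_right j).le fun x _ => sq_nonneg _
  have h1 := Mesh.integral_sq_le hP j (B := (m.right j - m.left j) *
      ∫ x in m.left j..m.right j, f' x ^ 2) (fun x hx => by
    rw [h.eq_left hc j x hx]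
    exact sq_sub_le_integral_deriv hf hf' ⟨le_rfl, (m.left_lt_right j).le⟩
      (Ioo_subset_Icc_self hx)) (m.left_lt_right j).le le_rfl le_rfl
  refine h1.trans ?_
  have h2 : m.right j - m.left j ≤ m.size := m.length_le_size j
  have h3 := (m.length_pos j).le
  rw [Mesh.length] at h3
  rw [← mul_assoc, sq]
  gcongr

/-- Evaluation at left nodes commutes with one mesh step, so the point required in the cell is its
left node. -/
theorem IsGaussRadauPlus.shiftBound {a b : ℝ} (hab : a < b) {m : Mesh a b} (hm : m.IsUniform)
    {f f' P : ℝ → ℝ} (hp : Function.Periodic f (b - a)) (hf : ∀ x, HasDerivAt f (f' x) x)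
    (hf' : Continuous f') (h : IsGaussRadauPlus m 0 f P) :
    ShiftBound m 0 (fun x => P x - f x) (l2Norm a b fun x => f' (x + m.size) - f' x) := by
  have hc : Continuous f := continuous_iff_continuousAt.2 fun x => (hf x).continuousAt
  refine shiftBound_sub_of_uniform hab hm (.of_continuous (sub_pos.2 hab) hp hc)
    (h.1.perBdd hab) (fun x => ((hf _).comp_add_const x _).sub (hf x)) (by fun_prop) fun j => ?_
  refine ⟨m.left j, ⟨le_rfl, (m.left_lt_right j).le⟩, fun x hx => ?_⟩
  obtain ⟨i, z, hi, hcell⟩ := hm.exists_shift j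
  have h1 := h.eq_left hc i _ (hcell x hx)
  rw [Periodic.add_int h.1.1, hi, Periodic.add_int hp] at h1
  rw [h1, h.eq_left hc j x hx]

/-- The seminorm bound on the fluxes controls shifts of `u_x` by the mesh size. -/
theorem l2Norm_shift_deriv_le {a b δ R h : ℝ} (hab : a < b) (hδ : 0 < δ) (hh : 0 < h)
    {f f' : ℝ → ℝ} (hf : ∀ x, HasDerivAt f (f' x) x) (hfP' : PerBdd (b - a) f')
    (hR : ∀ s ∈ Ioc 0 δ, hSeminorm a b 1 (diffQuot s f) ≤ R) :
    l2Norm a b (fun x => f' (x + h) - f' x) ≤ h * R := by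
  obtain ⟨N, hN⟩ := exists_nat_gt (h / δ)
  have hN0 : (0 : ℝ) < N := (div_pos hh hδ).trans hN
  -- The flux bound concerns shifts of at most δ, whereas the mesh size may be larger; the step is
  -- therefore divided into N admissible ones.
  have hs : h / N ∈ Ioc 0 δ := ⟨div_pos hh hN0, by
    rw [div_le_iff₀ hN0, mul_comm]
    exact ((div_lt_iff₀ hδ).1 hN).le⟩
  have h1 := hfP'.l2Norm_mul_shift_sub_le hab.le (h / N) N
  rw [mul_div_cancel₀ _ hN0.ne'] at h1
  have h2 := hR _ hs
  rw [hSeminorm_one (hasDerivAt_diffQuot hf _)] at h2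
  unfold diffQuot at h2
  rw [l2Norm_div_const, abs_of_pos hs.1, div_le_iff₀ hs.1] at h2
  refine h1.trans ((mul_le_mul_of_nonneg_left h2 hN0.le).trans_eq ?_)
  field_simp

/-- The choice n = ⌈h^{-1/2}⌉ balances the averaging error nh against the consistency constant 1/n.
-/
theorem exists_nat_mul_le {h L : ℝ} (hh : 0 < h) (hhL : h ≤ L) :
    ∃ n : ℕ, n ≠ 0 ∧ (n * h) ^ 2 ≤ 2 * (1 + L) * h ∧ (1 / (n : ℝ)) ^ 2 ≤ h := by
  set r := Real.sqrt h with hr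
  have hr0 : 0 < r := Real.sqrt_pos.2 hh
  have hrr : r ^ 2 = h := Real.sq_sqrt hh.le
  have h1 := Nat.le_ceil (1 / r)
  have h2 := Nat.ceil_lt_add_one (a := 1 / r) (by positivity)
  have hn : 0 < ⌈1 / r⌉₊ := Nat.ceil_pos.2 (by positivity)
  set n := ⌈1 / r⌉₊
  have hn' : (0 : ℝ) < n := Nat.cast_pos.2 hn
  refine ⟨n, hn.ne', ?_, ?_⟩
  · have h3 : n * r ≤ 1 + r := by
      have := mul_le_mul_of_nonneg_right h2.le hr0.le
      rwa [add_mul, one_div_mul_cancel hr0.ne', one_mul] at this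
    have h4 : (n * r) ^ 2 ≤ (1 + r) ^ 2 := pow_le_pow_left₀ (by positivity) h3 2
    have h5 : (1 + r) ^ 2 ≤ 2 * (1 + L) := by nlinarith [sq_nonneg (1 - r)]
    calc (n * h) ^ 2 = (n * r) ^ 2 * h := by rw [mul_pow, mul_pow, hrr]; ring
      _ ≤ 2 * (1 + L) * h := mul_le_mul_of_nonneg_right (h4.trans h5) hh.le
  · rw [← hrr]
    refine pow_le_pow_left₀ (by positivity) ?_ 2
    rwa [one_div_le hn' hr0]

/-- Averages of translates of a solution are solutions. -/
theorem SolvesWave.average {L T δ : ℝ} {ω : ℝ → ℝ} {U : ℝ → ℝ → ℝ} {k : ℕ} (hL : 0 < L)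
    (hT : 0 < T) (hδ : 0 ≤ δ) (hω : IntervalIntegrable ω volume 0 δ)
    (hU : IsSmoothOfOrder T (k + 2) U) (h : SolvesWave L T δ ω U (fun _ _ => 0)) (n : ℕ) (y : ℝ) :
    SolvesWave L T δ ω (fun x t => average n y (fun x => U x t) x) (fun _ _ => 0) := by
  have := (SolvesWave.sum hL hT hδ hω (Finset.range n)
    (fun i _ => hU.translate (i * y)) fun i _ => h.translate (i * y)).const_mul (n : ℝ)⁻¹
  simpa only [NonlocalDG.average, Finset.sum_const_zero, mul_zero] using this

theorem IsSmoothOfOrder.average {T : ℝ} {U : ℝ → ℝ → ℝ} {k : ℕ} (hU : IsSmoothOfOrder T k U)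
    (n : ℕ) (y : ℝ) : IsSmoothOfOrder T k (fun x t => average n y (fun x => U x t) x) :=
  (IsSmoothOfOrder.sum (Finset.range n) fun i _ => hU.translate (i * y)).const_mul (n : ℝ)⁻¹

theorem timeDeriv_average {T : ℝ} {U : ℝ → ℝ → ℝ} {k : ℕ} (hT : 0 < T)
    (hU : IsSmoothOfOrder T (k + 1) U) (n : ℕ) (y x : ℝ) {t : ℝ} (ht : t ∈ Icc 0 T) :
    timeDeriv T (fun x t => average n y (fun x => U x t) x) x t =
      average n y (fun x => timeDeriv T U x t) x := by
  unfold NonlocalDG.average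
  rw [SolvesWave.timeDeriv_const_mul]
  exact congrArg _ (SolvesWave.timeDeriv_sum hT (Finset.range n)
    (V := fun i x t => U (x + i * y) t) (fun i _ => hU.translate (i * y)) x ht)

/-- Error estimate for degree `0` on uniform meshes. -/
theorem exists_errorsBounded_of_uniform {a b T : ℝ} (hab : a < b) (hT : 0 < T) (M R : ℝ) :
    ∃ C : ℝ, 0 < C ∧
      ∀ (δ : ℝ) (γ : ℝ → ℝ), 0 < δ → IsKernel δ γ → kernelMass δ γ ≤ M →
      ∀ (u : ℝ → ℝ → ℝ) (q : ℝ → ℝ → ℝ → ℝ), IsExactSolution a b T δ γ u q →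
        IsSmoothOfOrder T 4 u → SeminormsBounded a b T δ 0 R u q →
      ∀ m : Mesh a b, m.IsUniform → ∀ (uh : ℝ → ℝ → ℝ) (qh : ℝ → ℝ → ℝ → ℝ),
        IsDGSolution T δ γ m 0 uh qh → HasProjectedData T m 0 u uh →
        ErrorsBounded a b T δ γ u uh q qh (C * m.size) := by
  obtain ⟨K, hK0, hK⟩ := exists_err_const 0
  set L : ℝ := b - a with hLdef
  -- The constant in (nh)² ≤ A h; likewise L is the constant in h² ≤ L h.
  set A : ℝ := 2 * (1 + L) with hA
  set E : ℝ := Real.exp (3 * T) *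
    (2 * (L + A) + M * (L + A) + 2 * (M ^ 2 + M) * T) * R ^ 2 with hE
  set D : ℝ := (A + K ^ 2 * L) * R ^ 2 with hD
  refine ⟨|3 * (2 * E + D)| + |3 * (E + D * (M / 2))| + 1, by positivity, ?_⟩
  intro δ γ hδ hγ hM u q hex hu hR m hm uh qh h hdata
  obtain ⟨φ⟩ := exists_orthoBasis hab m 0
  have hL : 0 < L := sub_pos.2 hab
  have h0T : (0 : ℝ) ∈ Icc 0 T := ⟨le_rfl, hT.le⟩
  have hω := hγ.intervalIntegrable hδ
  have hωM : 2 * ∫ s in (0 : ℝ)..δ, s ^ 2 * γ s ≤ M := (hγ.two_mul_integral hδ).trans_le hM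
  have hM0 : 0 ≤ M := hγ.mass_pos.le.trans hM
  have hR0 : 0 ≤ R := (l2Norm_nonneg _ _ _).trans (hR 0 h0T).2.1
  have hs0 := m.size_pos hab
  have hsL : m.size ≤ L := m.size_le hab
  obtain ⟨n, hn, hθ, hn1⟩ := exists_nat_mul_le hs0 hsL
  set y := m.size with hy
  set θ : ℝ := n * y with hθdef
  have hθ0 : 0 ≤ θ := by positivity
  have hy2 : y ^ 2 ≤ L * y := by rw [sq]; gcongr
  -- regularity of `u`, `u_t` and the fluxes
  have hu4 : IsSmoothOfOrder T (1 + 3) u := hu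
  have hut : IsSmoothOfOrder T (1 + 2) (timeDeriv T u) := hu4.time hT
  have hwave := hex.solvesWave (n := 1 + 1) hab hT hδ hω hu4
  have hux : IsSmoothOfOrder T (1 + 2) (spaceDeriv u) := hu4.space hT
  have hutx : IsSmoothOfOrder T (1 + 1) (spaceDeriv (timeDeriv T u)) := hut.space hT
  obtain ⟨hd, -, ⟨B, hB0, hB⟩, -⟩ := hu4.exists_space_bound hL hT hex.periodic
  have hper1 : ∀ t ∈ Icc 0 T, Function.Periodic (fun x => timeDeriv T u x t) L :=
    fun t ht => timeDeriv_periodic hex.periodic ht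
  have hd1 : ∀ t ∈ Icc 0 T, ∀ x,
      HasDerivAt (fun x => timeDeriv T u x t) (spaceDeriv (timeDeriv T u) x t) x :=
    fun t ht x => hut.hasDerivAt_space (by norm_num) x ht
  have hcx : ∀ t ∈ Icc 0 T, Continuous fun x => spaceDeriv u x t :=
    fun t ht => hux.continuous_slice ht
  have hcx1 : ∀ t ∈ Icc 0 T, Continuous fun x => spaceDeriv (timeDeriv T u) x t :=
    fun t ht => hutx.continuous_slice ht
  have hpx : ∀ t ∈ Icc 0 T, Function.Periodic (fun x => spaceDeriv u x t) L :=
    fun t ht => spaceDeriv_periodic (hex.periodic t ht)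
  have hpx1 : ∀ t ∈ Icc 0 T, Function.Periodic (fun x => spaceDeriv (timeDeriv T u) x t) L :=
    fun t ht => spaceDeriv_periodic (hper1 t ht)
  have huP : ∀ t ∈ Icc 0 T, PerBdd L fun x => u x t := fun t ht =>
    .of_continuous hL (hex.periodic t ht) (hu.continuous_slice ht)
  have hutP : ∀ t ∈ Icc 0 T, PerBdd L fun x => timeDeriv T u x t := fun t ht =>
    .of_continuous hL (hper1 t ht) (hut.continuous_slice ht)
  have huxP : ∀ t ∈ Icc 0 T, PerBdd L fun x => spaceDeriv u x t := fun t ht =>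
    .of_continuous hL (hpx t ht) (hcx t ht)
  have hRu : ∀ t ∈ Icc 0 T, l2Norm a b (fun x => spaceDeriv u x t) ≤ R := fun t ht => by
    rw [← hSeminorm_one (hd t ht)]; exact (hR t ht).2.1
  have hRut : ∀ t ∈ Icc 0 T, l2Norm a b (fun x => spaceDeriv (timeDeriv T u) x t) ≤ R :=
    fun t ht => by rw [← hSeminorm_one (hd1 t ht)]; exact (hR t ht).1
  have hRq' : ∀ t ∈ Icc 0 T, ∀ s ∈ Ioc 0 δ,
      hSeminorm a b 1 (diffQuot s fun x => u x t) ≤ R := fun t ht s hs => by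
    rw [← hex.flux_eq ht hs]; exact (hR t ht).2.2 s hs
  have hRq : ∀ t ∈ Icc 0 T, ∀ s ∈ Ioc 0 δ,
      l2Norm a b (diffQuot s fun x => spaceDeriv u x t) ≤ R := fun t ht s hs => by
    rw [← hSeminorm_one (hasDerivAt_diffQuot (hd t ht) s)]; exact hRq' t ht s hs
  -- the averaged solution
  set U : ℝ → ℝ → ℝ := fun x t => average n y (fun x => u x t) x with hU
  have hU4 : IsSmoothOfOrder T (1 + 3) U := hu4.average n y
  have hUwave : SolvesWave L T δ (fun s => s ^ 2 * γ s) U fun _ _ => 0 :=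
    hwave.average (k := 1 + 1) hL hT hδ.le hω hu4 n y
  have hUt : ∀ t ∈ Icc 0 T, (fun x => timeDeriv T U x t) =
      average n y fun x => timeDeriv T u x t :=
    fun t ht => funext fun x => timeDeriv_average (k := 1 + 2) hT hu4 n y x ht
  have hUq : ∀ t s, diffQuot s (fun x => U x t) = average n y (diffQuot s fun x => u x t) :=
    fun t s => diffQuot_average n y s _
  have hUP : ∀ t ∈ Icc 0 T, PerBdd L fun x => U x t := fun t ht => average_perBdd n y (huP t ht)
  have hη : ∀ t ∈ Icc 0 T, l2Norm a b (fun x => U x t - u x t) ≤ θ * R := fun t ht =>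
    l2Norm_average_sub_le hab hn hs0.le (hex.periodic t ht) (hd t ht) (hcx t ht) (hpx t ht)
      (hRu t ht)
  have hηt : ∀ t ∈ Icc 0 T, l2Norm a b (fun x => timeDeriv T U x t - timeDeriv T u x t) ≤ θ * R :=
    fun t ht => by
      have := l2Norm_average_sub_le hab hn hs0.le (hper1 t ht) (hd1 t ht) (hcx1 t ht) (hpx1 t ht)
        (hRut t ht)
      rwa [← hUt t ht] at this
  have hηq : ∀ t ∈ Icc 0 T, ∀ s ∈ Ioc 0 δ, l2Norm a b
      (fun x => diffQuot s (fun x => U x t) x - diffQuot s (fun x => u x t) x) ≤ θ * R :=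
    fun t ht s hs => by
      rw [hUq]
      exact l2Norm_average_sub_le hab hn hs0.le ((huP t ht).diffQuot s).periodic
        (hasDerivAt_diffQuot (hd t ht) s) (diffQuot_continuous (hcx t ht) s)
        ((huxP t ht).diffQuot s).periodic (hRq t ht s hs)
  -- The discrete solution is compared with the averaged solution U rather than with u; this is
  -- where the factor 1/n enters.
  have hen := h.energy (α := 2 * R / n) φ hab hT hδ hω hγ.nonneg hωM hU4 hUwave (by positivity)
    (fun t ht => by
      have ht := Ioo_subset_Icc_self ht
      rw [hUt t ht]
      exact shiftBound_err_average hab hm φ n (hper1 t ht) (hd1 t ht) (hcx1 t ht) (hpx1 t ht)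
        (hRut t ht))
    (fun t ht s hs => by
      have ht := Ioo_subset_Icc_self ht
      rw [hUq]
      exact shiftBound_err_average hab hm φ n ((huP t ht).diffQuot s).periodic
        (hasDerivAt_diffQuot (hd t ht) s) (diffQuot_continuous (hcx t ht) s)
        ((huxP t ht).diffQuot s).periodic (hRq t ht s hs))
  -- the initial energy
  obtain ⟨hg, hgt⟩ := hdata.2 rfl
  -- Initial errors consist of an interpolation part of size hR and an averaging part of size nhR.
  have hsum : ∀ {x z w : ℝ}, x ≤ y * R → z ≤ θ * R → 0 ≤ w → w ≤ x + z →
      w ^ 2 ≤ 2 * (L + A) * R ^ 2 * y := by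
    intro x z w hx hz hw hwxz
    have h1 : w ^ 2 ≤ (y * R + θ * R) ^ 2 := pow_le_pow_left₀ hw (by linarith) 2
    have h2 : (y * R + θ * R) ^ 2 ≤ 2 * (y ^ 2 + θ ^ 2) * R ^ 2 := by
      nlinarith [sq_nonneg (y * R - θ * R)]
    have h3 : 2 * (y ^ 2 + θ ^ 2) * R ^ 2 ≤ 2 * (L * y + A * y) * R ^ 2 := by gcongr
    linarith
  have hY0 : φ.dist2 (fun x => uh x 0) (fun x => U x 0) ≤ 2 * (L + A) * R ^ 2 * y := by
    refine (φ.dist2_le hab (hg.1.perBdd hab) (hUP 0 h0T)).trans (hsum ((hg.l2Norm_sub_le hab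
      (hex.periodic 0 h0T) (hd 0 h0T) (hcx 0 h0T)).trans (mul_le_mul_of_nonneg_left (hRu 0 h0T)
      hs0.le)) (hη 0 h0T) (l2Norm_nonneg _ _ _) ?_)
    have := PerBdd.l2Norm_sub_le hab.le ((hg.1.perBdd hab).sub (huP 0 h0T))
      ((hUP 0 h0T).sub (huP 0 h0T))
    simpa only [sub_sub_sub_cancel_right] using this
  have hX0 : φ.dist2 (fun x => timeDeriv T uh x 0) (fun x => timeDeriv T U x 0) ≤
      2 * (L + A) * R ^ 2 * y := by
    have hUtP : PerBdd L fun x => timeDeriv T U x 0 := by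
      rw [hUt 0 h0T]; exact average_perBdd n y (hutP 0 h0T)
    refine (φ.dist2_le hab (hgt.1.perBdd hab) hUtP).trans (hsum ((hgt.l2Norm_sub_le hab
      (hper1 0 h0T) (hd1 0 h0T) (hcx1 0 h0T)).trans (mul_le_mul_of_nonneg_left (hRut 0 h0T)
      hs0.le)) (hηt 0 h0T) (l2Norm_nonneg _ _ _) ?_)
    have := PerBdd.l2Norm_sub_le hab.le ((hgt.1.perBdd hab).sub (hutP 0 h0T))
      (hUtP.sub (hutP 0 h0T))
    simpa only [sub_sub_sub_cancel_right] using this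
  -- For the initial flux, D_s u is inserted between D_s u_h and D_s U. The Radau error is handled
  -- by its shift bound, the averaging error by the seminorm bound on the fluxes.
  have hZs : ∀ s ∈ Ioc 0 δ, φ.dist2 (diffQuot s fun x => uh x 0) (diffQuot s fun x => U x 0) ≤
      2 * (L + A) * R ^ 2 * y := by
    intro s hs
    have h1 : φ.dist2 (diffQuot s fun x => uh x 0) (diffQuot s fun x => u x 0) ≤ (y * R) ^ 2 :=
      φ.dist2_diffQuot_le hab (hg.1.perBdd hab) (huP 0 h0T) hs.1.ne'
        ((hg.shiftBound hab hm (hex.periodic 0 h0T) (hd 0 h0T) (hcx 0 h0T)).mono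
          (l2Norm_shift_deriv_le hab hδ hs0 (hd 0 h0T) (huxP 0 h0T) (hRq' 0 h0T)))
    have h2 : φ.dist2 (diffQuot s fun x => u x 0) (diffQuot s fun x => U x 0) ≤ (θ * R) ^ 2 := by
      have h3 := φ.dist2_le hab ((hUP 0 h0T).diffQuot s) ((huP 0 h0T).diffQuot s)
      have h4 : φ.dist2 (diffQuot s fun x => u x 0) (diffQuot s fun x => U x 0) =
          φ.dist2 (diffQuot s fun x => U x 0) (diffQuot s fun x => u x 0) :=
        Finset.sum_congr rfl fun i _ => by ring
      rw [h4]
      exact h3.trans (pow_le_pow_left₀ (l2Norm_nonneg _ _ _) (hηq 0 h0T s hs) 2)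
    have h5 := φ.dist2_triangle (diffQuot s fun x => uh x 0) (diffQuot s fun x => u x 0)
      (diffQuot s fun x => U x 0)
    have h6 : (y ^ 2 + θ ^ 2) * R ^ 2 ≤ (L * y + A * y) * R ^ 2 := by gcongr
    linarith
  obtain ⟨hUd, -, ⟨B', hB0', hB'⟩, -⟩ := hU4.exists_space_bound hL hT hUwave.periodic
  have hZ0 : ∫ s in (0 : ℝ)..δ, s ^ 2 * γ s *
      φ.dist2 (diffQuot s fun x => uh x 0) (diffQuot s fun x => U x 0) ≤
      2 * (L + A) * R ^ 2 * y * (M / 2) := by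
    have h1 : ∫ s in (0 : ℝ)..δ, s ^ 2 * γ s *
        φ.dist2 (diffQuot s fun x => uh x 0) (diffQuot s fun x => U x 0) ≤
        ∫ s in (0 : ℝ)..δ, s ^ 2 * γ s * (2 * (L + A) * R ^ 2 * y) :=
      intervalIntegral.integral_mono_on_of_le_Ioo hδ.le
        (φ.intervalIntegrable_dist2 hab hδ.le hω hg.1 (hUwave.periodic 0 h0T) (hUd 0 h0T) hB0'
          (hB' 0 h0T)) (hω.mul_const _) fun s hs =>
        mul_le_mul_of_nonneg_left (hZs s ⟨hs.1, hs.2.le⟩)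
          (mul_nonneg (sq_nonneg s) (hγ.nonneg s))
    rw [intervalIntegral.integral_mul_const] at h1
    have h2 : 0 ≤ 2 * (L + A) * R ^ 2 * y := by positivity
    have h3 := mul_le_mul_of_nonneg_left hωM h2
    linarith
  intro t ht
  have hEt := (hen t ht).trans (c := E * y) (by
    have h1 : (2 * R / n) ^ 2 * (M ^ 2 + M) / 2 * T ≤ 2 * (M ^ 2 + M) * T * R ^ 2 * y := by
      have h2 : (2 * R / n) ^ 2 * (M ^ 2 + M) / 2 * T =
          2 * (M ^ 2 + M) * T * R ^ 2 * (1 / (n : ℝ)) ^ 2 := by ring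
      rw [h2]
      gcongr
    calc Real.exp (3 * T) * (_ + _ + _ + _) ≤ Real.exp (3 * T) *
          ((2 * (L + A) + M * (L + A) + 2 * (M ^ 2 + M) * T) * R ^ 2 * y) := by
          refine mul_le_mul_of_nonneg_left ?_ (Real.exp_nonneg _)
          linarith
      _ = E * y := by rw [hE]; ring)
  have herr : ∀ f : ℝ → ℝ, Function.Periodic f (b - a) → ContDiff ℝ (0 + 1 : ℕ) f →
      hSeminorm a b (0 + 1) f ≤ R → l2Norm a b (φ.err f) ≤ K * y * R := fun f hp hf hfR => by
    refine (hK hab φ hp hf).trans ?_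
    rw [zero_add, pow_one]
    gcongr
  have hcd : ContDiff ℝ (0 + 1 : ℕ) fun x => u x t := (hu.mono (by norm_num)).contDiff_slice ht
  obtain ⟨r1, r2, r3⟩ := h.errors_le (n := 1 + 1) (η₀ := θ * R) (η₁ := K * y * R) φ hab hT hδ hω
    hγ.nonneg hωM hu4 hex hU4 hUwave.periodic ht hEt (hη t ht)
    (herr _ (hex.periodic t ht) hcd (hR t ht).2.1) (hηq t ht)
    (fun s hs => herr _ ((huP t ht).diffQuot s).periodic (contDiff_diffQuot hcd s)
      (hRq' t ht s hs))
  have hDy : (θ * R) ^ 2 + (K * y * R) ^ 2 ≤ D * y := by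
    have h1 : (θ ^ 2 + K ^ 2 * y ^ 2) * R ^ 2 ≤ (A * y + K ^ 2 * (L * y)) * R ^ 2 := by gcongr
    rw [hD]
    linarith
  refine ⟨r1.trans ?_, r2, r3.trans ?_⟩
  · have h1 : 3 * (2 * (E * y) + (θ * R) ^ 2 + (K * y * R) ^ 2) ≤ 3 * (2 * E + D) * y := by linarith
    refine h1.trans (mul_le_mul_of_nonneg_right ?_ hs0.le)
    have := le_abs_self (3 * (2 * E + D))
    have := abs_nonneg (3 * (E + D * (M / 2)))
    linarith
  · have h1 : 3 * (E * y + ((θ * R) ^ 2 + (K * y * R) ^ 2) * (M / 2)) ≤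
        3 * (E + D * (M / 2)) * y := by
      have := mul_le_mul_of_nonneg_right hDy (by linarith : 0 ≤ M / 2)
      linarith
    refine h1.trans (mul_le_mul_of_nonneg_right ?_ hs0.le)
    have := le_abs_self (3 * (E + D * (M / 2)))
    have := abs_nonneg (3 * (2 * E + D))
    linarith

/-! ### Energy estimate for the nonlocal wave equation -/

theorem IsSmoothOfOrder.diffQuot {T : ℝ} {n : ℕ} {U : ℝ → ℝ → ℝ} (hU : IsSmoothOfOrder T n U)
    (s : ℝ) : IsSmoothOfOrder T n (fun x t => diffQuot s (fun x => U x t) x) :=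
  (((hU.translate s).sub hU).const_mul s⁻¹).congr fun x t _ => by
    simp only [NonlocalDG.diffQuot, div_eq_inv_mul]

theorem timeDeriv_diffQuot {T : ℝ} (hT : 0 < T) {n : ℕ} {U : ℝ → ℝ → ℝ}
    (hU : IsSmoothOfOrder T (n + 1) U) (s x : ℝ) {t : ℝ} (ht : t ∈ Icc 0 T) :
    timeDeriv T (fun x t => diffQuot s (fun x => U x t) x) x t =
      diffQuot s (fun x => timeDeriv T U x t) x :=
  (((hU.hasDerivWithinAt_time hT n.succ_ne_zero (x + s) ht).sub
    (hU.hasDerivWithinAt_time hT n.succ_ne_zero x ht)).div_const s).derivWithin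
    (uniqueDiffOn_Icc hT t ht)

theorem continuousOn_integral_sq {T a b : ℝ} {n : ℕ} (hab : a ≤ b) {f : ℝ → ℝ → ℝ}
    (hf : IsSmoothOfOrder T n f) : ContinuousOn (fun t => ∫ x in a..b, f x t ^ 2) (Icc 0 T) := by
  have hsq : IsSmoothOfOrder T n (fun x t => f x t ^ 2) := ContDiffOn.pow hf 2
  have := continuousOn_integral_mul hab hsq (w := fun _ => 1) intervalIntegrable_const
  simpa only [mul_one] using this

theorem hasDerivAt_integral_sq {T a b : ℝ} {n : ℕ} (hT : 0 < T) (hab : a ≤ b) {f : ℝ → ℝ → ℝ}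
    (hf : IsSmoothOfOrder T (n + 1) f) {t : ℝ} (ht : t ∈ Ioo 0 T) :
    HasDerivAt (fun t => ∫ x in a..b, f x t ^ 2)
      (2 * ∫ x in a..b, f x t * timeDeriv T f x t) t := by
  have ht' := Ioo_subset_Icc_self ht
  have hsq : IsSmoothOfOrder T (n + 1) (fun x t => f x t ^ 2) := ContDiffOn.pow hf 2
  have h := hasDerivAt_integral_mul hT hab hsq (w := fun _ => 1) intervalIntegrable_const ht
  simp only [mul_one] at h
  convert h using 1
  rw [← intervalIntegral.integral_const_mul]
  refine intervalIntegral.integral_congr fun x _ => ?_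
  have h1 := ((hf.hasDerivWithinAt_time hT n.succ_ne_zero x ht').fun_pow 2).derivWithin
    (uniqueDiffOn_Icc hT t ht')
  simp only [timeDeriv] at h1 ⊢
  rw [h1]
  simp only [Nat.cast_ofNat, Nat.add_one_sub_one, pow_one]
  ring

theorem l2Norm_diffQuot_le {a b : ℝ} (hab : a < b) {f f' : ℝ → ℝ}
    (hf : ∀ x, HasDerivAt f (f' x) x) (hf' : Continuous f') (hp' : Function.Periodic f' (b - a))
    (s : ℝ) : l2Norm a b (diffQuot s f) ≤ l2Norm a b f' := by
  have h := l2Norm_shift_sub_le hab hf hf' hp' s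
  unfold diffQuot
  rw [l2Norm_div_const]
  exact div_le_of_le_mul₀ (abs_nonneg _) (l2Norm_nonneg _ _ _) (by rwa [mul_comm])

theorem abs_integral_mul_le_of_abs_le {a b B : ℝ} (hab : a ≤ b) {f g : ℝ → ℝ} (hB : 0 ≤ B)
    (hf : ∀ x, |f x| ≤ B) (hg : ∀ x, |g x| ≤ B) :
    |∫ x in a..b, f x * g x| ≤ B * B * (b - a) := by
  have h := intervalIntegral.norm_integral_le_of_norm_le_const (a := a) (b := b) (C := B * B)
    (f := fun x => f x * g x) fun x _ => by
      rw [Real.norm_eq_abs, abs_mul]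
      exact mul_le_mul (hf x) (hg x) (abs_nonneg _) hB
  rwa [Real.norm_eq_abs, abs_of_nonneg (sub_nonneg.2 hab)] at h

theorem measurable_integral_diffQuot_mul {a b : ℝ} (hab : a ≤ b) {f g : ℝ → ℝ} (hf : Measurable f)
    (hg : Measurable g) : Measurable fun s => ∫ x in a..b, diffQuot s f x * diffQuot s g x := by
  have hj : ∀ f : ℝ → ℝ, Measurable f → Measurable fun p : ℝ × ℝ => diffQuot p.1 f p.2 :=
    fun f hf => ((hf.comp (measurable_snd.add measurable_fst)).sub
      (hf.comp measurable_snd)).div measurable_fst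
  have h : Measurable (Function.uncurry fun s x => diffQuot s f x * diffQuot s g x) :=
    (hj f hf).mul (hj g hg)
  simp only [intervalIntegral.integral_of_le hab]
  exact (h.stronglyMeasurable.integral_prod_right (ν := volume.restrict (Ioc a b))).measurable

/-- Testing with U_t makes the cancellation between velocity and flux exact, so the abstract
estimate applies with α = 0. At time zero the flux energy is at most half of M times ‖U_x‖², and at
time t it is dropped. -/
theorem SolvesWave.energy {a b T δ M ρ : ℝ} {ω : ℝ → ℝ} {U F : ℝ → ℝ → ℝ} {n : ℕ} (hab : a < b)
    (hT : 0 < T) (hδ : 0 < δ) (hω : IntervalIntegrable ω volume 0 δ) (hω0 : ∀ s, 0 ≤ ω s)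
    (hωM : 2 * ∫ s in (0 : ℝ)..δ, ω s ≤ M) (h : SolvesWave (b - a) T δ ω U F)
    (hU : IsSmoothOfOrder T (n + 2) U) (hF : ∀ t ∈ Ioo 0 T, PerBdd (b - a) fun x => F x t)
    (hρ : ∀ t ∈ Ioo 0 T, l2Norm a b (fun x => F x t) ≤ ρ) :
    ∀ t ∈ Icc 0 T, l2Norm a b (fun x => U x t) ^ 2 + l2Norm a b (fun x => timeDeriv T U x t) ^ 2 ≤
      Real.exp (3 * T) * (l2Norm a b (fun x => U x 0) ^ 2 +
        l2Norm a b (fun x => timeDeriv T U x 0) ^ 2 +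
        M * l2Norm a b (fun x => NonlocalDG.spaceDeriv U x 0) ^ 2 + ρ ^ 2 * T) := by
  have hL := sub_pos.2 hab
  have h0T : (0 : ℝ) ∈ Icc 0 T := ⟨le_rfl, hT.le⟩
  have hU1 : IsSmoothOfOrder T (n + 1) (timeDeriv T U) := hU.time hT
  have hU2 : IsSmoothOfOrder T n (timeDeriv T (timeDeriv T U)) := hU1.time hT
  have hUx : IsSmoothOfOrder T (n + 1) (NonlocalDG.spaceDeriv U) := hU.space hT
  have hU1x : IsSmoothOfOrder T n (NonlocalDG.spaceDeriv (timeDeriv T U)) := hU1.space hT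
  have hper1 : ∀ t ∈ Icc 0 T, Function.Periodic (fun x => timeDeriv T U x t) (b - a) :=
    fun t ht => timeDeriv_periodic h.periodic ht
  have hpx : ∀ t ∈ Icc 0 T, Function.Periodic (fun x => NonlocalDG.spaceDeriv U x t) (b - a) :=
    fun t ht => spaceDeriv_periodic (h.periodic t ht)
  have hd : ∀ t ∈ Icc 0 T, ∀ x, HasDerivAt (fun x => U x t) (NonlocalDG.spaceDeriv U x t) x :=
    fun t ht x => hU.hasDerivAt_space (by omega) x ht
  have hd1 : ∀ t ∈ Icc 0 T, ∀ x,
      HasDerivAt (fun x => timeDeriv T U x t) (NonlocalDG.spaceDeriv (timeDeriv T U) x t) x :=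
    fun t ht x => hU1.hasDerivAt_space (by omega) x ht
  obtain ⟨B1, hB10, hB1⟩ := hUx.exists_bound hL hpx
  obtain ⟨B2, hB20, hB2⟩ := hU1x.exists_bound hL fun t ht => spaceDeriv_periodic (hper1 t ht)
  set B := max B1 B2 with hB
  have hB0 : 0 ≤ B := hB10.trans (le_max_left _ _)
  have hq : ∀ t ∈ Icc 0 T, ∀ s x, |NonlocalDG.diffQuot s (fun x => U x t) x| ≤ B :=
    fun t ht s x => (abs_diffQuot_le (hd t ht) (fun y => hB1 y t ht) s x).trans (le_max_left _ _)
  have hq1 : ∀ t ∈ Icc 0 T, ∀ s x, |NonlocalDG.diffQuot s (fun x => timeDeriv T U x t) x| ≤ B :=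
    fun t ht s x => (abs_diffQuot_le (hd1 t ht) (fun y => hB2 y t ht) s x).trans (le_max_right _ _)
  have hUP : ∀ t ∈ Icc 0 T, PerBdd (b - a) fun x => U x t := fun t ht =>
    .of_continuous hL (h.periodic t ht) (hU.continuous_slice ht)
  have hU1P : ∀ t ∈ Icc 0 T, PerBdd (b - a) fun x => timeDeriv T U x t := fun t ht =>
    .of_continuous hL (hper1 t ht) (hU1.continuous_slice ht)
  have hsqB : ∀ t ∈ Icc 0 T, ∀ s,
      |∫ x in a..b, NonlocalDG.diffQuot s (fun x => U x t) x ^ 2| ≤ 2 * (B * B * (b - a)) :=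
    fun t ht s => by
      have := abs_integral_mul_le_of_abs_le hab.le hB0 (hq t ht s) (hq t ht s)
      simp only [sq]
      linarith [abs_nonneg (∫ x in a..b, NonlocalDG.diffQuot s (fun x => U x t) x *
        NonlocalDG.diffQuot s (fun x => U x t) x)]
  have hest := energy_estimate (T := T) (δ := δ) (M := M) (α := 0) (ρ := ρ)
    (B := 2 * (B * B * (b - a))) hδ.le hω hω0 hωM
    (Y := fun t => ∫ x in a..b, U x t ^ 2)
    (Y' := fun t => 2 * ∫ x in a..b, U x t * timeDeriv T U x t)
    (X := fun t => ∫ x in a..b, timeDeriv T U x t ^ 2)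
    (X' := fun t => 2 * ∫ x in a..b, timeDeriv T U x t * timeDeriv T (timeDeriv T U) x t)
    (Z := fun s t => ∫ x in a..b, NonlocalDG.diffQuot s (fun x => U x t) x ^ 2)
    (Z' := fun s t => 2 * ∫ x in a..b, NonlocalDG.diffQuot s (fun x => U x t) x *
      NonlocalDG.diffQuot s (fun x => timeDeriv T U x t) x)
    (fun t => intervalIntegral.integral_nonneg hab.le fun x _ => sq_nonneg _)
    (fun t => intervalIntegral.integral_nonneg hab.le fun x _ => sq_nonneg _)
    (fun s t => intervalIntegral.integral_nonneg hab.le fun x _ => sq_nonneg _)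
    (continuousOn_integral_sq hab.le hU) (continuousOn_integral_sq hab.le hU1)
    (fun s _ => continuousOn_integral_sq hab.le (hU.diffQuot s))
    (fun t ht => hasDerivAt_integral_sq (n := n + 1) hT hab.le hU ht)
    (fun t ht => hasDerivAt_integral_sq (n := n) hT hab.le hU1 ht)
    (fun s _ t ht => by
      have := hasDerivAt_integral_sq (n := n + 1) hT hab.le (hU.diffQuot s) ht
      simpa only [timeDeriv_diffQuot (n := n + 1) hT hU s _ (Ioo_subset_Icc_self ht)] using this)
    (fun t ht => by
      have hm := (hU.continuous_slice ht).measurable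
      have := measurable_integral_diffQuot_mul hab.le hm hm
      simp only [sq]
      exact this.aestronglyMeasurable)
    (fun t ht => ((measurable_integral_diffQuot_mul hab.le (hU.continuous_slice ht).measurable
      (hU1.continuous_slice ht).measurable).const_mul 2).aestronglyMeasurable)
    (fun s _ t ht => hsqB t ht s)
    (fun s _ t ht => by
      rw [abs_mul, abs_two]
      exact mul_le_mul_of_nonneg_left
        (abs_integral_mul_le_of_abs_le hab.le hB0 (hq t ht s) (hq1 t ht s)) zero_le_two)
    (fun t ht => by
      have ht' := Ioo_subset_Icc_self ht
      have i1 := (hUP t ht').sq.intervalIntegrable a b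
      have i2 := (hU1P t ht').sq.intervalIntegrable a b
      rw [← intervalIntegral.integral_const_mul, ← intervalIntegral.integral_add i1 i2]
      refine intervalIntegral.integral_mono_on (μ := volume) hab.le
        ((((hUP t ht').mul (hU1P t ht')).const_mul 2).intervalIntegrable a b) (i1.add i2)
        fun x _ => ?_
      have := two_mul_le_add_sq (U x t) (timeDeriv T U x t)
      linarith)
    ?_ le_rfl
  · intro t ht
    have h1 := hest t ht
    have hZt : 0 ≤ ∫ s in (0 : ℝ)..δ, ω s *
        ∫ x in a..b, NonlocalDG.diffQuot s (fun x => U x t) x ^ 2 :=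
      intervalIntegral.integral_nonneg hδ.le fun s _ => mul_nonneg (hω0 s)
        (intervalIntegral.integral_nonneg hab.le fun x _ => sq_nonneg _)
    have hZ0 : ∫ s in (0 : ℝ)..δ, ω s *
        (∫ x in a..b, NonlocalDG.diffQuot s (fun x => U x 0) x ^ 2) ≤
        (∫ s in (0 : ℝ)..δ, ω s) * l2Norm a b (fun x => NonlocalDG.spaceDeriv U x 0) ^ 2 := by
      rw [← intervalIntegral.integral_mul_const]
      have hm := (hU.continuous_slice h0T).measurable
      have hmm := measurable_integral_diffQuot_mul hab.le hm hm
      simp only [← sq] at hmm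
      refine intervalIntegral.integral_mono_on (μ := volume) hδ.le
        (intervalIntegrable_weight_mul hδ.le hω hmm.aestronglyMeasurable fun s _ => hsqB 0 h0T s)
        (hω.mul_const _) fun s _ => ?_
      refine mul_le_mul_of_nonneg_left ?_ (hω0 s)
      rw [← l2Norm_sq hab.le]
      exact pow_le_pow_left₀ (l2Norm_nonneg _ _ _) (l2Norm_diffQuot_le hab (hd 0 h0T)
        (hUx.continuous_slice h0T) (hpx 0 h0T) s) 2
    simp only [← l2Norm_sq hab.le] at h1 hZt hZ0
    have h2 := mul_le_mul_of_nonneg_right hωM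
      (sq_nonneg (l2Norm a b fun x => NonlocalDG.spaceDeriv U x 0))
    have h5 := h1.trans (mul_le_mul_of_nonneg_left
      (c := (l2Norm a b (fun x => U x 0) ^ 2 + l2Norm a b (fun x => timeDeriv T U x 0) ^ 2 +
        M * l2Norm a b (fun x => NonlocalDG.spaceDeriv U x 0) ^ 2 + ρ ^ 2 * T) / 2)
      (by linarith) (Real.exp_nonneg (3 * T)))
    linarith
  · intro t ht
    have ht' := Ioo_subset_Icc_self ht
    obtain ⟨hi, hw⟩ := h.weak hab hT hδ.le hω hU ht (hU1P t ht')
    refine ⟨fun s => -∫ x in a..b, NonlocalDG.diffQuot s (fun x => U x t) x *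
      NonlocalDG.diffQuot s (fun x => timeDeriv T U x t) x, ?_, ?_, fun s _ => ?_⟩
    · simp only [mul_neg]
      exact hi.neg
    · have h1 : ∫ x in a..b, timeDeriv T U x t * timeDeriv T (timeDeriv T U) x t =
          ∫ x in a..b, timeDeriv T (timeDeriv T U) x t * timeDeriv T U x t :=
        intervalIntegral.integral_congr fun x _ => mul_comm _ _
      have h2 : ∫ x in a..b, F x t * timeDeriv T U x t ≤
          ρ * Real.sqrt (∫ x in a..b, timeDeriv T U x t ^ 2) :=
        (le_abs_self _).trans (((hF t ht).abs_integral_mul_le hab.le (hU1P t ht')).trans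
          (mul_le_mul_of_nonneg_right (hρ t ht) (l2Norm_nonneg _ _ _)))
      have h3 : ∫ s in (0 : ℝ)..δ, ω s * -∫ x in a..b, NonlocalDG.diffQuot s (fun x => U x t) x *
          NonlocalDG.diffQuot s (fun x => timeDeriv T U x t) x =
          -∫ s in (0 : ℝ)..δ, ω s * ∫ x in a..b, NonlocalDG.diffQuot s (fun x => U x t) x *
          NonlocalDG.diffQuot s (fun x => timeDeriv T U x t) x := by
        simp only [mul_neg, intervalIntegral.integral_neg]
      rw [h1, hw, h3]
      linarith
    · simp

/-! ### Seminorm bounds uniform in the horizon -/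

theorem SolvesWave.iterate_spaceDeriv {L T δ : ℝ} {ω : ℝ → ℝ} {U : ℝ → ℝ → ℝ} {n : ℕ} (hL : 0 < L)
    (hT : 0 < T) (hδ : 0 ≤ δ) (hω : IntervalIntegrable ω volume 0 δ) (j : ℕ)
    (hU : IsSmoothOfOrder T (n + 2 + j) U) (h : SolvesWave L T δ ω U (fun _ _ => 0)) :
    SolvesWave L T δ ω (NonlocalDG.spaceDeriv^[j] U) (fun _ _ => 0) := by
  induction j with
  | zero => exact h
  | succ j ih =>
    rw [Function.iterate_succ_apply']
    have h1 : IsSmoothOfOrder T (n + 3) (NonlocalDG.spaceDeriv^[j] U) :=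
      IsSmoothOfOrder.iterate_space hT j (hU.mono (by omega))
    exact (ih (hU.mono (by omega))).spaceDeriv hL hT hδ hω h1

theorem SolvesWave.l2Norm_le {a b T δ M S : ℝ} {ω : ℝ → ℝ} {U : ℝ → ℝ → ℝ} {n : ℕ} (hab : a < b)
    (hT : 0 < T) (hδ : 0 < δ) (hω : IntervalIntegrable ω volume 0 δ) (hω0 : ∀ s, 0 ≤ ω s)
    (hωM : 2 * ∫ s in (0 : ℝ)..δ, ω s ≤ M) (h : SolvesWave (b - a) T δ ω U (fun _ _ => 0))
    (hU : IsSmoothOfOrder T (n + 2) U) (h0 : l2Norm a b (fun x => U x 0) ≤ S)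
    (h1 : l2Norm a b (fun x => timeDeriv T U x 0) ≤ S)
    (h2 : l2Norm a b (fun x => NonlocalDG.spaceDeriv U x 0) ≤ S) :
    ∀ t ∈ Icc 0 T, l2Norm a b (fun x => U x t) ≤ Real.sqrt (Real.exp (3 * T) * (2 + M)) * S ∧
      l2Norm a b (fun x => timeDeriv T U x t) ≤ Real.sqrt (Real.exp (3 * T) * (2 + M)) * S := by
  intro t ht
  have hS : 0 ≤ S := (l2Norm_nonneg _ _ _).trans h0
  have hM : 0 ≤ M := le_trans (mul_nonneg zero_le_two
    (intervalIntegral.integral_nonneg hδ.le fun s _ => hω0 s)) hωM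
  have h3 := h.energy hab hT hδ hω hω0 hωM hU (ρ := 0) (fun _ _ => PerBdd.const _ 0)
    (fun _ _ => by simp [l2Norm]) t ht
  have e0 := pow_le_pow_left₀ (l2Norm_nonneg _ _ _) h0 2
  have e1 := pow_le_pow_left₀ (l2Norm_nonneg _ _ _) h1 2
  have e2 := mul_le_mul_of_nonneg_left (pow_le_pow_left₀ (l2Norm_nonneg _ _ _) h2 2) hM
  have h4 := h3.trans (mul_le_mul_of_nonneg_left (c := (2 + M) * S ^ 2) (by linarith)
    (Real.exp_nonneg (3 * T)))
  have h5 : (Real.sqrt (Real.exp (3 * T) * (2 + M)) * S) ^ 2 =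
      Real.exp (3 * T) * ((2 + M) * S ^ 2) := by
    rw [mul_pow, Real.sq_sqrt (by positivity)]; ring
  have h6 : 0 ≤ Real.sqrt (Real.exp (3 * T) * (2 + M)) * S := by positivity
  constructor
  · refine (abs_le_of_sq_le_sq' ?_ h6).2
    rw [h5]
    linarith [sq_nonneg (l2Norm a b fun x => timeDeriv T U x t)]
  · refine (abs_le_of_sq_le_sq' ?_ h6).2
    rw [h5]
    linarith [sq_nonneg (l2Norm a b fun x => U x t)]

theorem hasDerivAt_iteratedDeriv {n : ℕ} {f : ℝ → ℝ} (hf : ContDiff ℝ (n + 1 : ℕ) f) (x : ℝ) :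
    HasDerivAt (iteratedDeriv n f) (iteratedDeriv (n + 1) f x) x := by
  rw [iteratedDeriv_succ]
  exact (hf.differentiable_iteratedDeriv n (by norm_cast; omega) x).hasDerivAt

theorem iteratedDeriv_diffQuot {n : ℕ} {f : ℝ → ℝ} (hf : ContDiff ℝ n f) (s : ℝ) :
    iteratedDeriv n (diffQuot s f) = diffQuot s (iteratedDeriv n f) := by
  induction n with
  | zero => simp only [iteratedDeriv_zero]
  | succ n ih =>
    rw [iteratedDeriv_succ, ih (hf.of_le (by norm_cast; omega))]
    exact funext fun x => (hasDerivAt_diffQuot (hasDerivAt_iteratedDeriv hf) s x).deriv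

theorem l2Norm_diffQuot_iteratedDeriv_le {a b : ℝ} (hab : a < b) {n : ℕ} {f : ℝ → ℝ}
    (hp : Function.Periodic f (b - a)) (hf : ContDiff ℝ (n + 1 : ℕ) f) (s : ℝ) :
    l2Norm a b (diffQuot s (iteratedDeriv n f)) ≤ hSeminorm a b (n + 1) f := by
  refine l2Norm_diffQuot_le hab (hasDerivAt_iteratedDeriv hf)
    (hf.continuous_iteratedDeriv (n + 1) le_rfl) ?_ s
  rw [iteratedDeriv_eq_iterate_spaceDeriv (fun x _ => f x) 0]
  exact iterate_spaceDeriv_periodic (t := 0) (n + 1) hp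

/-- The function ∂_x^{k+1}u and its difference quotients solve the same equation, so the energy at
time zero bounds them. That energy costs one space derivative and the difference quotient another,
whence order k + 3 of the initial data. Neither δ nor s enters the constant. -/
theorem IsExactSolution.seminormsBounded {a b T δ M S : ℝ} {γ : ℝ → ℝ} {u : ℝ → ℝ → ℝ}
    {q : ℝ → ℝ → ℝ → ℝ} {k : ℕ} (hab : a < b) (hT : 0 < T) (hδ : 0 < δ) (hγ : IsKernel δ γ)
    (hM : kernelMass δ γ ≤ M) (h : IsExactSolution a b T δ γ u q)
    (hu : IsSmoothOfOrder T (k + 4) u)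
    (h1 : hSeminorm a b (k + 1) (fun x => u x 0) ≤ S)
    (h2 : hSeminorm a b (k + 2) (fun x => u x 0) ≤ S)
    (h3 : hSeminorm a b (k + 3) (fun x => u x 0) ≤ S)
    (h4 : hSeminorm a b (k + 1) (fun x => timeDeriv T u x 0) ≤ S)
    (h5 : hSeminorm a b (k + 2) (fun x => timeDeriv T u x 0) ≤ S) :
    SeminormsBounded a b T δ k (Real.sqrt (Real.exp (3 * T) * (2 + M)) * S) u q := by
  have hL := sub_pos.2 hab
  have h0T : (0 : ℝ) ∈ Icc 0 T := ⟨le_rfl, hT.le⟩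
  have hω := hγ.intervalIntegrable hδ
  have hω0 : ∀ s, 0 ≤ s ^ 2 * γ s := fun s => mul_nonneg (sq_nonneg s) (hγ.nonneg s)
  have hωM : 2 * ∫ s in (0 : ℝ)..δ, s ^ 2 * γ s ≤ M := (hγ.two_mul_integral hδ).trans_le hM
  have hwave := h.solvesWave (n := k + 2) hab hT hδ hω hu
  have hut : IsSmoothOfOrder T (k + 3) (timeDeriv T u) := hu.time hT
  have hc : ∀ t ∈ Icc 0 T, ContDiff ℝ (k + 4 : ℕ) fun x => u x t := fun t ht => hu.contDiff_slice ht
  have hct : ∀ t ∈ Icc 0 T, ContDiff ℝ (k + 3 : ℕ) fun x => timeDeriv T u x t :=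
    fun t ht => hut.contDiff_slice ht
  set W : ℝ → ℝ → ℝ := spaceDeriv^[k + 1] u with hW
  have hWs : IsSmoothOfOrder T (1 + 2) W :=
    IsSmoothOfOrder.iterate_space hT (k + 1) (hu.mono (by omega))
  have hWwave : SolvesWave (b - a) T δ (fun s => s ^ 2 * γ s) W fun _ _ => 0 :=
    hwave.iterate_spaceDeriv (n := 1) hL hT hδ.le hω (k + 1) (hu.mono (by omega))
  have e0 : ∀ t, (fun x => W x t) = iteratedDeriv (k + 1) fun x => u x t := fun t =>
    (iteratedDeriv_eq_iterate_spaceDeriv u t (k + 1)).symm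
  have e1 : ∀ t ∈ Icc 0 T, (fun x => timeDeriv T W x t) =
      iteratedDeriv (k + 1) fun x => timeDeriv T u x t := fun t ht => by
    rw [iteratedDeriv_eq_iterate_spaceDeriv]
    exact funext fun x => (IsSmoothOfOrder.iterate_spaceDeriv_timeDeriv hT (n := 2) (k + 1)
      (hu.mono (by omega)) x ht).symm
  have e2 : ∀ t, (fun x => spaceDeriv W x t) = iteratedDeriv (k + 2) fun x => u x t := fun t => by
    rw [iteratedDeriv_eq_iterate_spaceDeriv, Function.iterate_succ_apply']
  intro t ht
  obtain ⟨r1, r2⟩ := hWwave.l2Norm_le (S := S) hab hT hδ hω hω0 hωM hWs (by rw [e0]; exact h1)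
    (by rw [e1 0 h0T]; exact h4) (by rw [e2]; exact h2) t ht
  rw [e0] at r1
  rw [e1 t ht] at r2
  refine ⟨r2, r1, fun s hs => ?_⟩
  have hQwave := hWwave.diffQuot hL hT hδ.le hω hWs s
  have f1 : (fun x => timeDeriv T (fun x t => diffQuot s (fun x => W x t) x) x 0) =
      diffQuot s (iteratedDeriv (k + 1) fun x => timeDeriv T u x 0) := by
    rw [← e1 0 h0T]
    exact funext fun x => timeDeriv_diffQuot (n := 2) hT hWs s x h0T
  have f2 : (fun x => spaceDeriv (fun x t => diffQuot s (fun x => W x t) x) x 0) =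
      diffQuot s (iteratedDeriv (k + 2) fun x => u x 0) := by
    rw [← e2]
    exact funext fun x =>
      (hasDerivAt_diffQuot (fun y => hWs.hasDerivAt_space (by norm_num) y h0T) s x).deriv
  obtain ⟨r3, -⟩ := hQwave.l2Norm_le (S := S) hab hT hδ hω hω0 hωM (hWs.diffQuot s)
    (by
      simp only [e0]
      exact (l2Norm_diffQuot_iteratedDeriv_le hab (h.periodic 0 h0T)
        ((hc 0 h0T).of_le (by norm_cast; omega)) s).trans h2)
    (by
      rw [f1]
      exact (l2Norm_diffQuot_iteratedDeriv_le hab (timeDeriv_periodic h.periodic h0T)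
        ((hct 0 h0T).of_le (by norm_cast; omega)) s).trans h5)
    (by
      rw [f2]
      exact (l2Norm_diffQuot_iteratedDeriv_le hab (h.periodic 0 h0T)
        ((hc 0 h0T).of_le (by norm_cast; omega)) s).trans h3) t ht
  rw [h.flux_eq ht hs, hSeminorm, iteratedDeriv_diffQuot ((hc t ht).of_le (by norm_cast; omega))]
  simpa only [e0] using r3

/-! ### Convergence of the nonlocal to the local problem -/

/-- Two mean value theorems. The first point lies in (x-s, x) and the second within s to its right,
so the result stays within s of x. -/
theorem exists_diffQuot_diffQuot_eq {f f' f'' : ℝ → ℝ} (hf : ∀ x, HasDerivAt f (f' x) x)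
    (hf' : ∀ x, HasDerivAt f' (f'' x) x) {s : ℝ} (hs : 0 < s) (x : ℝ) :
    ∃ z, |z - x| ≤ s ∧ diffQuot (-s) (diffQuot s f) x = f'' z := by
  have hd := hasDerivAt_diffQuot hf s
  obtain ⟨ξ, hξ, h1⟩ := exists_hasDerivAt_eq_slope (diffQuot s f) (diffQuot s f')
    (sub_lt_self x hs) (fun y _ => (hd y).continuousAt.continuousWithinAt) fun y _ => hd y
  obtain ⟨z, hz, h2⟩ := exists_hasDerivAt_eq_slope f' f'' (lt_add_of_pos_right ξ hs)
    (fun y _ => (hf' y).continuousAt.continuousWithinAt) fun y _ => hf' y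
  refine ⟨z, abs_le.2 ⟨by linarith [hξ.1, hz.1], by linarith [hξ.2, hz.2]⟩, ?_⟩
  rw [h2, add_sub_cancel_left, ← diffQuot, h1, sub_sub_cancel]
  rw [diffQuot, ← sub_eq_add_neg, div_neg, ← neg_div, neg_sub]

/-- The weight 2ω has mass C_δ on (0,δ). The operator thus takes a weighted mean of values of f''
within δ of x, and the mass defect C_δ - 1 multiplies f''(x). -/
theorem abs_nonlocalLap_sub_le {δ ε B : ℝ} {γ : ℝ → ℝ} (hδ : 0 < δ) (hγ : IsKernel δ γ)
    {f f' f'' : ℝ → ℝ} (hf : ∀ x, HasDerivAt f (f' x) x) (hf' : ∀ x, HasDerivAt f' (f'' x) x)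
    (hB : ∀ x, |f'' x| ≤ B) (hε : ∀ x z, |z - x| ≤ δ → |f'' z - f'' x| ≤ ε) (x : ℝ) :
    |nonlocalLap δ (fun s => s ^ 2 * γ s) f x - f'' x| ≤
      kernelMass δ γ * ε + |kernelMass δ γ - 1| * B := by
  have hω := hγ.intervalIntegrable hδ
  have hω0 : ∀ s, 0 ≤ s ^ 2 * γ s := fun s => mul_nonneg (sq_nonneg s) (hγ.nonneg s)
  have hi := intervalIntegrable_lap hδ.le hω hf hf' hB x
  have e : nonlocalLap δ (fun s => s ^ 2 * γ s) f x - f'' x =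
      2 * (∫ s in (0 : ℝ)..δ, s ^ 2 * γ s * (diffQuot (-s) (diffQuot s f) x - f'' x)) +
        (kernelMass δ γ - 1) * f'' x := by
    have h1 : ∫ s in (0 : ℝ)..δ, s ^ 2 * γ s * (diffQuot (-s) (diffQuot s f) x - f'' x) =
        (∫ s in (0 : ℝ)..δ, s ^ 2 * γ s * diffQuot (-s) (diffQuot s f) x) -
          (∫ s in (0 : ℝ)..δ, s ^ 2 * γ s) * f'' x := by
      rw [← intervalIntegral.integral_mul_const, ← intervalIntegral.integral_sub hi
        (hω.mul_const _)]
      exact intervalIntegral.integral_congr fun s _ => mul_sub _ _ _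
    rw [h1, ← hγ.two_mul_integral hδ, nonlocalLap]
    ring
  have h2 : |∫ s in (0 : ℝ)..δ, s ^ 2 * γ s * (diffQuot (-s) (diffQuot s f) x - f'' x)| ≤
      (∫ s in (0 : ℝ)..δ, s ^ 2 * γ s) * ε := by
    rw [← intervalIntegral.integral_mul_const, ← Real.norm_eq_abs]
    refine intervalIntegral.norm_integral_le_of_norm_le hδ.le (.of_forall fun s hs => ?_)
      (hω.mul_const _)
    rw [Real.norm_eq_abs, abs_mul, abs_of_nonneg (hω0 s)]
    refine mul_le_mul_of_nonneg_left ?_ (hω0 s)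
    obtain ⟨z, hz, hzx⟩ := exists_diffQuot_diffQuot_eq hf hf' hs.1 x
    rw [hzx]
    exact hε x z (hz.trans hs.2)
  rw [e]
  refine (abs_add_le _ _).trans (add_le_add ?_ ?_)
  · rw [abs_mul, abs_two, ← hγ.two_mul_integral hδ, mul_assoc]
    exact mul_le_mul_of_nonneg_left h2 zero_le_two
  · rw [abs_mul]
    exact mul_le_mul_of_nonneg_left (hB x) (abs_nonneg _)

/-- A periodic continuous function on the space-time slab is uniformly continuous in space. -/
theorem IsSmoothOfOrder.exists_modulus {a b T : ℝ} (hab : a < b) {n : ℕ} {g : ℝ → ℝ → ℝ}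
    (hg : IsSmoothOfOrder T n g)
    (hp : ∀ t ∈ Icc 0 T, Function.Periodic (fun x => g x t) (b - a)) {ε : ℝ} (hε : 0 < ε) :
    ∃ η, 0 < η ∧ ∀ t ∈ Icc 0 T, ∀ x z, |z - x| ≤ η → |g z t - g x t| ≤ ε := by
  have hK : IsCompact (Icc (a - 1) (b + 1) ×ˢ Icc 0 T : Set (ℝ × ℝ)) :=
    isCompact_Icc.prod isCompact_Icc
  have huc := hK.uniformContinuousOn_of_continuous
    (hg.continuousOn.mono (prod_mono (subset_univ _) le_rfl))
  obtain ⟨η, hη, h⟩ := Metric.uniformContinuousOn_iff.1 huc ε hε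
  refine ⟨min (η / 2) 1, by positivity, fun t ht x z hxz => ?_⟩
  set y := wrap a b x with hy
  have hyI := wrap_mem hab x
  have hyx := wrap_eq_sub hab x
  set j := ⌊(x - a) / (b - a)⌋
  have e1 : g x t = g y t := (Function.Periodic.wrap_eq hab (hp t ht) x).symm
  -- Both points are moved by the same number of periods, which preserves their distance; the second
  -- may leave [a,b) by at most 1, which explains the enlarged compact set.
  have e2 : g z t = g (z - x + y) t := by
    have := Periodic.add_int (hp t ht) (-j) z
    rw [← this]
    congr 1
    rw [hy, hyx]; push_cast; ring
  have hle := abs_le.1 (hxz.trans (min_le_right _ _))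
  rw [e1, e2]
  refine (h (z - x + y, t) ⟨⟨by linarith [hyI.1], by linarith [hyI.2]⟩, ht⟩ (y, t)
    ⟨⟨by linarith [hyI.1], by linarith [hyI.2]⟩, ht⟩ ?_).le
  rw [Prod.dist_eq, dist_self, max_eq_left dist_nonneg, Real.dist_eq, add_sub_cancel_right]
  exact (hxz.trans (min_le_left _ _)).trans_lt (half_lt_self hη)

theorem IsLocalSolution.wave_eq {a b T : ℝ} {u : ℝ → ℝ → ℝ} (hab : a < b) (hT : 0 < T)
    (h : IsLocalSolution a b T u) (x : ℝ) {t : ℝ} (ht : t ∈ Ioo 0 T) :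
    timeDeriv T (timeDeriv T u) x t = spaceDeriv (spaceDeriv u) x t := by
  have ht' := Ioo_subset_Icc_self ht
  have h1 : IsSmoothOfOrder T 1 (timeDeriv T u) := IsSmoothOfOrder.time (n := 1) hT h.smooth
  have h2 : IsSmoothOfOrder T 0 (timeDeriv T (timeDeriv T u)) := IsSmoothOfOrder.time (n := 0) hT h1
  have h3 : IsSmoothOfOrder T 1 (spaceDeriv u) := IsSmoothOfOrder.space (n := 1) hT h.smooth
  have h4 : IsSmoothOfOrder T 0 (spaceDeriv (spaceDeriv u)) := IsSmoothOfOrder.space (n := 0) hT h3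
  have hp2 : Function.Periodic (fun x => timeDeriv T (timeDeriv T u) x t) (b - a) :=
    timeDeriv_periodic (fun τ hτ => timeDeriv_periodic h.periodic hτ) ht'
  have hp4 : Function.Periodic (fun x => spaceDeriv (spaceDeriv u) x t) (b - a) :=
    spaceDeriv_periodic (spaceDeriv_periodic (h.periodic t ht'))
  have hIoo : EqOn (fun x => timeDeriv T (timeDeriv T u) x t)
      (fun x => spaceDeriv (spaceDeriv u) x t) (Ioo a b) := fun x hx => by
    have h5 := sub_eq_zero.1 (h.wave x hx t ht)
    rw [iteratedDeriv_eq_iterate_spaceDeriv] at h5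
    exact h5
  have hIcc := hIoo.closure (h2.continuous_slice ht') (h4.continuous_slice ht')
  rw [closure_Ioo hab.ne] at hIcc
  have h6 := hIcc (Ico_subset_Icc_self (wrap_mem hab x))
  exact (Function.Periodic.wrap_eq hab hp2 x).symm.trans
    (h6.trans (Function.Periodic.wrap_eq hab hp4 x))

/-- Solutions of the nonlocal problem converge to the solution of the local one. -/
theorem IsLocalSolution.exists_l2Norm_sub_le {a b T σ : ℝ} {uloc : ℝ → ℝ → ℝ} (hab : a < b)
    (hT : 0 < T) (hloc : IsLocalSolution a b T uloc) (hσ : 0 < σ) : ∃ η : ℝ, 0 < η ∧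
    ∀ (δ : ℝ) (γ : ℝ → ℝ), 0 < δ → δ < η → IsKernel δ γ → |kernelMass δ γ - 1| ≤ η →
    ∀ (u : ℝ → ℝ → ℝ) (q : ℝ → ℝ → ℝ → ℝ), IsExactSolution a b T δ γ u q →
      IsSmoothOfOrder T 2 u → (∀ x, u x 0 = uloc x 0) →
      (∀ x, timeDeriv T u x 0 = timeDeriv T uloc x 0) →
      ∀ t ∈ Icc 0 T, l2Norm a b (fun x => u x t - uloc x t) ≤ σ := by
  have hL := sub_pos.2 hab
  have h0T : (0 : ℝ) ∈ Icc 0 T := ⟨le_rfl, hT.le⟩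
  have hs : IsSmoothOfOrder T (0 + 2) uloc := hloc.smooth
  have hsx : IsSmoothOfOrder T (0 + 1) (spaceDeriv uloc) := hs.space hT
  have hxx : IsSmoothOfOrder T 0 (spaceDeriv (spaceDeriv uloc)) := hsx.space hT
  have hpxx : ∀ t ∈ Icc 0 T, Function.Periodic (fun x => spaceDeriv (spaceDeriv uloc) x t) (b - a) :=
    fun t ht => spaceDeriv_periodic (spaceDeriv_periodic (hloc.periodic t ht))
  obtain ⟨hd, hd', -, B, hB0, hB⟩ := hs.exists_space_bound hL hT hloc.periodic
  -- Forcing of size σ/κ contributes (κ - 1)(σ/κ)² to the energy bound, and the added 1 makes this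
  -- at most σ².
  set κ : ℝ := Real.exp (3 * T) * (T * (b - a)) + 1 with hκ
  have hκ1 : 1 ≤ κ := by
    have : 0 ≤ Real.exp (3 * T) * (T * (b - a)) := by positivity
    linarith
  have hκ0 : 0 < κ := one_pos.trans_le hκ1
  -- Chosen so that 2ε + εB = σ/κ, where 2 bounds C_δ and B bounds the second space derivative of
  -- the local solution.
  set ε : ℝ := σ / κ / (2 + B) with hε
  have hε0 : 0 < ε := by positivity
  obtain ⟨η, hη0, hη⟩ := hxx.exists_modulus hab hpxx hε0
  refine ⟨min η (min ε 1), by positivity, fun δ γ hδ hδη hγ hmass u q hex hu hu0 hu1 => ?_⟩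
  have hω := hγ.intervalIntegrable hδ
  have hω0 : ∀ s, 0 ≤ s ^ 2 * γ s := fun s => mul_nonneg (sq_nonneg s) (hγ.nonneg s)
  have hmε : |kernelMass δ γ - 1| ≤ ε := hmass.trans ((min_le_right _ _).trans (min_le_left _ _))
  have hm2 : kernelMass δ γ ≤ 2 := by
    have := (le_abs_self _).trans (hmass.trans ((min_le_right _ _).trans (min_le_right _ _)))
    linarith
  have hωM : 2 * ∫ s in (0 : ℝ)..δ, s ^ 2 * γ s ≤ 2 := (hγ.two_mul_integral hδ).trans_le hm2
  -- the consistency error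
  set ρ : ℝ → ℝ → ℝ := fun x t => spaceDeriv (spaceDeriv uloc) x t -
    nonlocalLap δ (fun s => s ^ 2 * γ s) (fun y => uloc y t) x with hρ
  have hlocw : SolvesWave (b - a) T δ (fun s => s ^ 2 * γ s) uloc ρ :=
    ⟨hloc.periodic, fun x t ht => by rw [hloc.wave_eq hab hT x ht, hρ]; ring⟩
  have hρB : ∀ t ∈ Icc 0 T, ∀ x, |ρ x t| ≤ σ / κ := fun t ht x => by
    have h1 := abs_nonlocalLap_sub_le hδ hγ (hd t ht) (hd' t ht) (hB t ht)
      (fun x z hz => hη t ht x z (hz.trans (hδη.le.trans (min_le_left _ _)))) x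
    rw [abs_sub_comm] at h1
    refine h1.trans ?_
    calc kernelMass δ γ * ε + |kernelMass δ γ - 1| * B ≤ 2 * ε + ε * B := by gcongr
      _ = σ / κ := by rw [hε]; field_simp
  have hρP : ∀ t ∈ Icc 0 T, PerBdd (b - a) fun x => ρ x t := fun t ht => by
    refine .of_continuous hL (fun x => ?_) ((hxx.continuous_slice ht).sub
      (continuous_lap hδ.le hω (hd t ht) (hd' t ht) (hB t ht)))
    have h1 := hpxx t ht x
    simp only [hρ] at h1 ⊢
    rw [h1, ← nonlocalLap_translate (f := fun y => uloc y t)]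
    congr 2
    exact funext (hloc.periodic t ht)
  have hw := (hex.solvesWave (n := 0) hab hT hδ hω hu).sub (n := 0) hL hT hδ.le hω hu hs hlocw
  have hsm : IsSmoothOfOrder T (0 + 2) fun x t => u x t - uloc x t := IsSmoothOfOrder.sub hu hs
  have hsqrt : 0 ≤ Real.sqrt (b - a) := Real.sqrt_nonneg _
  have hen := hw.energy (ρ := Real.sqrt (b - a) * (σ / κ)) hab hT hδ hω hω0 hωM hsm
    (fun t ht => (PerBdd.const _ 0).sub (hρP t (Ioo_subset_Icc_self ht)))
    (fun t ht => by
      have ht' := Ioo_subset_Icc_self ht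
      refine l2Norm_le_of_abs_le hab ((PerBdd.const _ 0).sub (hρP t ht')) (by positivity)
        fun x => ?_
      rw [zero_sub, abs_neg]
      exact hρB t ht' x)
  intro t ht
  have h1 := hen t ht
  have z0 : l2Norm a b (fun x => u x 0 - uloc x 0) = 0 := by simp [l2Norm, hu0]
  have z1 : l2Norm a b (fun x => timeDeriv T (fun x t => u x t - uloc x t) x 0) = 0 := by
    have : ∀ x, timeDeriv T (fun x t => u x t - uloc x t) x 0 = 0 := fun x => by
      rw [SolvesWave.timeDeriv_sub (n := 1) hT hu hs x h0T, hu1, sub_self]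
    simp [l2Norm, this]
  have z2 : l2Norm a b (fun x => spaceDeriv (fun x t => u x t - uloc x t) x 0) = 0 := by
    have : ∀ x, spaceDeriv (fun x t => u x t - uloc x t) x 0 = 0 := fun x => by
      simp [spaceDeriv, hu0]
    simp [l2Norm, this]
  rw [z0, z1, z2] at h1
  have h2 : Real.exp (3 * T) * (0 ^ 2 + 0 ^ 2 + 2 * 0 ^ 2 +
      (Real.sqrt (b - a) * (σ / κ)) ^ 2 * T) = (κ - 1) * (σ / κ) ^ 2 := by
    rw [mul_pow, Real.sq_sqrt hL.le, hκ]; ring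
  have h3 : (κ - 1) * (σ / κ) ^ 2 ≤ σ ^ 2 := by
    rw [div_pow, mul_div_assoc', div_le_iff₀ (by positivity), mul_comm]
    refine mul_le_mul_of_nonneg_left ?_ (sq_nonneg σ)
    nlinarith
  refine (abs_le_of_sq_le_sq' ?_ hσ.le).2
  linarith [sq_nonneg (l2Norm a b fun x => timeDeriv T (fun x t => u x t - uloc x t) x t)]

/-- Asymptotic compatibility of the scheme. -/
theorem tendsto_local {a b T : ℝ} (hab : a < b) (hT : 0 < T) (k : ℕ) {ν : ℝ} (hν : 0 < ν)
    {δ₀ : ℝ} {γ : ℝ → ℝ → ℝ} (hγ : ∀ δ ∈ Ioo 0 δ₀, IsKernel δ (γ δ))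
    (hmass : Tendsto (fun δ => kernelMass δ (γ δ)) (𝓝[>] 0) (𝓝 1))
    {uloc : ℝ → ℝ → ℝ} (hloc : IsLocalSolution a b T uloc)
    {u : ℝ → ℝ → ℝ → ℝ} {q : ℝ → ℝ → ℝ → ℝ → ℝ}
    (hu : ∀ δ ∈ Ioo 0 δ₀, IsExactSolution a b T δ (γ δ) (u δ) (q δ) ∧
      IsSmoothOfOrder T (k + 4) (u δ) ∧
      ∀ x, u δ x 0 = uloc x 0 ∧ timeDeriv T (u δ) x 0 = timeDeriv T uloc x 0)
    {ε : ℝ} (hε : 0 < ε) : ∃ η : ℝ, 0 < η ∧ ∀ δ ∈ Ioo 0 δ₀, δ < η →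
      ∀ m : Mesh a b, m.IsRegular ν → (k = 0 → m.IsUniform) → m.size < η →
      ∀ (uh : ℝ → ℝ → ℝ) (qh : ℝ → ℝ → ℝ → ℝ), IsDGSolution T δ (γ δ) m k uh qh →
        HasProjectedData T m k (u δ) uh →
        ∀ t ∈ Icc 0 T, l2Norm a b (fun x => uh x t - uloc x t) < ε := by
  have hL := sub_pos.2 hab
  obtain ⟨η₁, hη₁, hcons⟩ := hloc.exists_l2Norm_sub_le hab hT (half_pos hε)
  set f : ℝ → ℝ := fun x => uloc x 0 with hf
  set g : ℝ → ℝ := fun x => timeDeriv T uloc x 0 with hg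
  -- All nonlocal solutions share the initial data f and g, so S, and with it R and the constant of
  -- the error estimate, does not depend on δ.
  set S : ℝ := hSeminorm a b (k + 1) f + hSeminorm a b (k + 2) f + hSeminorm a b (k + 3) f +
    hSeminorm a b (k + 1) g + hSeminorm a b (k + 2) g with hS
  have hnn : ∀ n f, 0 ≤ hSeminorm a b n f := fun n f => l2Norm_nonneg _ _ _
  set R : ℝ := Real.sqrt (Real.exp (3 * T) * (2 + 2)) * S with hR
  -- the error estimate in the form `‖u_h - u‖² ≤ C h`
  have hest : ∃ C : ℝ, 0 < C ∧ ∀ (δ : ℝ) (γ : ℝ → ℝ), 0 < δ → IsKernel δ γ → kernelMass δ γ ≤ 2 →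
      ∀ (u : ℝ → ℝ → ℝ) (q : ℝ → ℝ → ℝ → ℝ), IsExactSolution a b T δ γ u q →
        IsSmoothOfOrder T (k + 4) u → SeminormsBounded a b T δ k R u q →
      ∀ m : Mesh a b, m.IsRegular ν → (k = 0 → m.IsUniform) → m.size ≤ 1 →
      ∀ (uh : ℝ → ℝ → ℝ) (qh : ℝ → ℝ → ℝ → ℝ),
        IsDGSolution T δ γ m k uh qh → HasProjectedData T m k u uh →
        ∀ t ∈ Icc 0 T, l2Norm a b (fun x => uh x t - u x t) ^ 2 ≤ C * m.size := by
    rcases Nat.eq_zero_or_pos k with rfl | hk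
    · obtain ⟨C, hC, h⟩ := exists_errorsBounded_of_uniform hab hT 2 R
      exact ⟨C, hC, fun δ γ hδ hγ hM u q hex hs hR m _ hm _ uh qh hdg hdata t ht =>
        (h δ γ hδ hγ hM u q hex hs hR m (hm rfl) uh qh hdg hdata t ht).1⟩
    · obtain ⟨C, hC, h⟩ := exists_errorsBounded_of_regular hab hT hk hν 2 R
      refine ⟨C, hC, fun δ γ hδ hγ hM u q hex hs hR m hm _ hm1 uh qh hdg hdata t ht =>
        (h δ γ hδ hγ hM u q hex hs hR m hm uh qh hdg hdata t ht).1.trans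
          (mul_le_mul_of_nonneg_left ?_ hC.le)⟩
      exact (pow_le_pow_of_le_one (m.size_pos hab).le hm1 (by omega : 1 ≤ 2 * k)).trans_eq (pow_one _)
  obtain ⟨C, hC, hest⟩ := hest
  have hev : ∀ᶠ δ in 𝓝[>] (0 : ℝ), |kernelMass δ (γ δ) - 1| < min η₁ 1 := by
    have := (Metric.tendsto_nhds.1 hmass) (min η₁ 1) (by positivity)
    simpa only [Real.dist_eq] using this
  obtain ⟨η₂, hη₂, hη₂'⟩ := mem_nhdsGT_iff_exists_Ioo_subset.1 hev
  have hη₂0 : 0 < η₂ := hη₂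
  -- The thresholds ensure, in order: u^δ within ε/2 of the local solution, C_δ close enough to 1,
  -- h^{2k} ≤ h when k ≥ 1, and Ch < (ε/2)².
  refine ⟨min (min η₁ η₂) (min 1 ((ε / 2) ^ 2 / C)), by positivity, ?_⟩
  intro δ hδ hδη m hm hm0 hmη uh qh hdg hdata t ht
  obtain ⟨hex, hs, hinit⟩ := hu δ hδ
  have hk := hγ δ hδ
  have hδ1 : δ < η₁ := hδη.trans_le ((min_le_left _ _).trans (min_le_left _ _))
  have hδ2 : δ < η₂ := hδη.trans_le ((min_le_left _ _).trans (min_le_right _ _))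
  have hms : |kernelMass δ (γ δ) - 1| < min η₁ 1 := hη₂' ⟨hδ.1, hδ2⟩
  have hm2 : kernelMass δ (γ δ) ≤ 2 := by
    have := (le_abs_self _).trans (hms.le.trans (min_le_right _ _))
    linarith
  have hff : (fun x => u δ x 0) = f := funext fun x => (hinit x).1
  have hgg : (fun x => timeDeriv T (u δ) x 0) = g := funext fun x => (hinit x).2
  have n1 := hnn (k + 1) f
  have n2 := hnn (k + 2) f
  have n3 := hnn (k + 3) f
  have n4 := hnn (k + 1) g
  have n5 := hnn (k + 2) g
  have hsem : SeminormsBounded a b T δ k R (u δ) (q δ) :=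
    hex.seminormsBounded (S := S) hab hT hδ.1 hk hm2 hs (by rw [hff]; linarith)
      (by rw [hff]; linarith) (by rw [hff]; linarith) (by rw [hgg]; linarith)
      (by rw [hgg]; linarith)
  have h1 := hest δ (γ δ) hδ.1 hk hm2 (u δ) (q δ) hex hs hsem m hm hm0
    (hmη.le.trans ((min_le_right _ _).trans (min_le_left _ _))) uh qh hdg hdata t ht
  have h2 : l2Norm a b (fun x => uh x t - u δ x t) < ε / 2 := by
    refine lt_of_pow_lt_pow_left₀ 2 (by positivity) (h1.trans_lt ?_)
    have := hmη.trans_le ((min_le_right _ _).trans (min_le_right _ _))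
    rw [lt_div_iff₀ hC] at this
    linarith
  have h3 := hcons δ (γ δ) hδ.1 hδ1 hk (hms.le.trans (min_le_left _ _)) (u δ) (q δ) hex
    (hs.mono (by omega)) (fun x => (hinit x).1) (fun x => (hinit x).2) t ht
  have huP : PerBdd (b - a) fun x => u δ x t :=
    .of_continuous hL (hex.periodic t ht) (hs.continuous_slice ht)
  have hlP : PerBdd (b - a) fun x => uloc x t :=
    .of_continuous hL (hloc.periodic t ht) (hloc.smooth.continuous_slice ht)
  have h4 := PerBdd.l2Norm_add_le hab.le (((hdg.mem_u t ht).perBdd hab).sub huP) (huP.sub hlP)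
  simp only [sub_add_sub_cancel] at h4
  linarith

end NonlocalDG

theorem theorem3p3 (a b T : ℝ) (hab : a < b) (hT : 0 < T) :
    -- degree `k ≥ 1`, regular meshes
    (∀ k : ℕ, 1 ≤ k → ∀ ν : ℝ, 0 < ν → ∀ M R : ℝ, ∃ C : ℝ, 0 < C ∧
      ∀ (δ : ℝ) (γ : ℝ → ℝ), 0 < δ → NonlocalDG.IsKernel δ γ → NonlocalDG.kernelMass δ γ ≤ M →
      ∀ (u : ℝ → ℝ → ℝ) (q : ℝ → ℝ → ℝ → ℝ),
        NonlocalDG.IsExactSolution a b T δ γ u q →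
        NonlocalDG.IsSmoothOfOrder T (k + 4) u →
        NonlocalDG.SeminormsBounded a b T δ k R u q →
      ∀ m : NonlocalDG.Mesh a b, m.IsRegular ν →
      ∀ (uh : ℝ → ℝ → ℝ) (qh : ℝ → ℝ → ℝ → ℝ),
        NonlocalDG.IsDGSolution T δ γ m k uh qh →
        NonlocalDG.HasProjectedData T m k u uh →
        NonlocalDG.ErrorsBounded a b T δ γ u uh q qh (C * m.size ^ (2 * k))) ∧
    -- degree `k = 0`, uniform meshes
    (∀ M R : ℝ, ∃ C : ℝ, 0 < C ∧
      ∀ (δ : ℝ) (γ : ℝ → ℝ), 0 < δ → NonlocalDG.IsKernel δ γ → NonlocalDG.kernelMass δ γ ≤ M →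
      ∀ (u : ℝ → ℝ → ℝ) (q : ℝ → ℝ → ℝ → ℝ),
        NonlocalDG.IsExactSolution a b T δ γ u q →
        NonlocalDG.IsSmoothOfOrder T 4 u →
        NonlocalDG.SeminormsBounded a b T δ 0 R u q →
      ∀ m : NonlocalDG.Mesh a b, m.IsUniform →
      ∀ (uh : ℝ → ℝ → ℝ) (qh : ℝ → ℝ → ℝ → ℝ),
        NonlocalDG.IsDGSolution T δ γ m 0 uh qh →
        NonlocalDG.HasProjectedData T m 0 u uh →
        NonlocalDG.ErrorsBounded a b T δ γ u uh q qh (C * m.size)) ∧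
    -- asymptotic compatibility
    (∀ (k : ℕ) (ν : ℝ), 0 < ν →
      ∀ (δ₀ : ℝ) (γ : ℝ → ℝ → ℝ), 0 < δ₀ →
        (∀ δ ∈ Set.Ioo 0 δ₀, NonlocalDG.IsKernel δ (γ δ)) →
        Filter.Tendsto (fun δ => NonlocalDG.kernelMass δ (γ δ)) (nhdsWithin 0 (Set.Ioi 0))
          (nhds 1) →
      ∀ (uloc : ℝ → ℝ → ℝ), NonlocalDG.IsLocalSolution a b T uloc →
      ∀ (u : ℝ → ℝ → ℝ → ℝ) (q : ℝ → ℝ → ℝ → ℝ → ℝ),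
        (∀ δ ∈ Set.Ioo 0 δ₀,
          NonlocalDG.IsExactSolution a b T δ (γ δ) (u δ) (q δ) ∧
          NonlocalDG.IsSmoothOfOrder T (k + 4) (u δ) ∧
          ∀ x, u δ x 0 = uloc x 0 ∧
            NonlocalDG.timeDeriv T (u δ) x 0 = NonlocalDG.timeDeriv T uloc x 0) →
      ∀ ε : ℝ, 0 < ε → ∃ η : ℝ, 0 < η ∧
        ∀ δ ∈ Set.Ioo 0 δ₀, δ < η →
        ∀ m : NonlocalDG.Mesh a b, m.IsRegular ν → (k = 0 → m.IsUniform) → m.size < η →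
        ∀ (uh : ℝ → ℝ → ℝ) (qh : ℝ → ℝ → ℝ → ℝ),
          NonlocalDG.IsDGSolution T δ (γ δ) m k uh qh →
          NonlocalDG.HasProjectedData T m k (u δ) uh →
          ∀ t ∈ Set.Icc 0 T, NonlocalDG.l2Norm a b (fun x => uh x t - uloc x t) < ε) := by
  refine ⟨fun k hk ν hν M R =>
      NonlocalDG.exists_errorsBounded_of_regular hab hT hk hν M R,
    fun M R => NonlocalDG.exists_errorsBounded_of_uniform hab hT M R, ?_⟩
  intro k ν hν δ₀ γ _ hγ hmass uloc hloc u q hu ε hε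
  exact NonlocalDG.tendsto_local hab hT k hν hγ hmass hloc hu hε
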